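/- Let $A>0$ and $\gamma>1$, and consider in three space dimensions the isentropic polytropic compressible Euler equations $$\rho_t+\nabla\cdot(\rho u)=0,\qquad (\rho u)_t+\nabla\cdot(\rho u\otimes u)+\nabla p=0,\qquad p=A\rho^\gamma,$$ with sound speed $c(\rho)=\sqrt{A\gamma}\,\rho^{(\gamma-1)/2}$ and radially symmetric initial data $\rho(0,x)=\rho_0(r)$, $u(0,x)=u_0(x)=\frac{x}{r}v_0(r)$, where $r=|x|$. Assume that $\rho_0\ge 0$, that $(c_0,u_0)\in H^3(\mathbb{R}^3)$ with $c_0=c(\rho_0)$, that $\rho_0(0)=0$, that $\int_{\mathbb{R}^3}\rho_0(r)\,dx>0$ (the value $+\infty$ is allowed), and that $$-\int_{\mathbb{R}^3}\frac{(1+r)\rho_0v_0}{r^2e^r}\,dx\;\ge\;C_0\Big(\int_{\mathbb{R}^3}\frac{\rho_0}{re^r}\,dx\Big)^{\frac{\gamma+1}{2}},\qquad C_0=\sqrt{\frac{A}{(\gamma+1)(4\pi)^{\gamma-1}}}.$$ For $0<T\le\infty$, an $H^3$ solution on $[0,T)$ is a pair $(\rho,u)$ of functions continuous on $[0,T)\times\mathbb{R}^3$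 with $\rho\ge0$ that attains these initial data, satisfies the Euler equations in the sense of distributions on $(0,T)\times\mathbb{R}^3$, and has $c(\rho),u\in C([0,T),H^3(\mathbb{R}^3))\cap C^1([0,T),H^2(\mathbb{R}^3))$. Then the solution develops a singularity in finite time, no later than $$T^*=\frac{2}{(\gamma-1)C_0}\Big(\int_{\mathbb{R}^3}\frac{\rho_0}{re^r}\,dx\Big)^{-\frac{\gamma-1}{2}}<\infty,$$ in the following sense: every $H^3$ solution on $[0,T)$, $0<T\le\infty$, with these initial data has $T\le T^*$ (in particular there is no global $H^3$ solution), and if $T=T^*$, then $\sup_{0\le t<T^*}\|(c(\rho),u)(t)\|_{H^3(\mathbb{R}^3)}=\infty$. In other words, the $H^3$ norm of $(c,u)$ cannot remain bounded up to the time $T^*$. -/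

import Mathlib

open MeasureTheory Set Filter Topology
open scoped FourierTransform ENNReal ContDiff

noncomputable section

namespace EulerVacuum

/-- Three-dimensional Euclidean space. -/
abbrev E3 : Type := EuclideanSpace ℝ (Fin 3)

/-! ### Sobolev spaces on `ℝ³` -/

/-- The `H^s(ℝ³)` norm, with values in `[0, ∞]`, of a real function on `ℝ³`: the `L²` norm of
`(1 + |ξ|²)^{s/2}` times the (Plancherel) Fourier transform, and `∞` if the function is not in
`L²`. -/
def sobolevENorm (s : ℝ) (f : E3 → ℝ) : ℝ≥0∞ :=
  open Classical in
  if h : MemLp (fun x => (f x : ℂ)) 2 (volume : Measure E3) then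
    eLpNorm (fun ξ : E3 => (((1 + ‖ξ‖ ^ 2) ^ (s / 2) : ℝ) : ℂ) * (𝓕 (h.toLp _)) ξ) 2 volume
  else ⊤

/-- Membership of a real function in `H^s(ℝ³)`. -/
def MemH (s : ℝ) (f : E3 → ℝ) : Prop := sobolevENorm s f < ⊤

/-- `f ∈ C(J, H^s(ℝ³))`. -/
def ContInH (s : ℝ) (J : Set ℝ) (f : ℝ → E3 → ℝ) : Prop :=
  (∀ t ∈ J, MemH s (f t)) ∧
    ∀ t ∈ J, Tendsto (fun τ => sobolevENorm s (fun x => f τ x - f t x)) (𝓝[J] t) (𝓝 0)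

/-- `f ∈ C¹(J, H^s(ℝ³))`; the derivative is one-sided at an endpoint belonging to `J`. -/
def C1InH (s : ℝ) (J : Set ℝ) (f : ℝ → E3 → ℝ) : Prop :=
  (∀ t ∈ J, MemH s (f t)) ∧
    ∃ f' : ℝ → E3 → ℝ, ContInH s J f' ∧
      ∀ t ∈ J, Tendsto
        (fun τ => sobolevENorm s (fun x => (f τ x - f t x) / (τ - t) - f' t x))
        (𝓝[J \ {t}] t) (𝓝 0)

/-! ### The isentropic compressible Euler equations -/

/-- The pressure `p = A ρ^γ`. -/
def pressure (A γ ρ : ℝ) : ℝ := A * ρ ^ γ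

/-- The sound speed `c(ρ) = √(Aγ) ρ^{(γ-1)/2}`. -/
def soundSpeed (A γ ρ : ℝ) : ℝ := √(A * γ) * ρ ^ ((γ - 1) / 2)

/-- The time interval `[0, T)`, where `T = ∞` is allowed. -/
def timeInterval (T : EReal) : Set ℝ := {t : ℝ | 0 ≤ t ∧ (t : EReal) < T}

/-- Test functions: smooth, with compact support contained in `(0, T) × ℝ³`. -/
def IsTestFunction (T : EReal) (φ : ℝ × E3 → ℝ) : Prop :=
  ContDiff ℝ ∞ φ ∧ HasCompactSupport φ ∧
    tsupport φ ⊆ {z : ℝ × E3 | 0 < z.1 ∧ (z.1 : EReal) < T}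

/-- `ρ_t + ∇·(ρu) = 0` in the sense of distributions on `(0, T) × ℝ³`. Here
`fderiv ℝ φ z (1, u)` is `φ_t + u·∇φ`. -/
def MassEquation (T : EReal) (ρ : ℝ → E3 → ℝ) (u : ℝ → E3 → E3) : Prop :=
  ∀ φ : ℝ × E3 → ℝ, IsTestFunction T φ →
    ∫ z : ℝ × E3, ρ z.1 z.2 * fderiv ℝ φ z (1, u z.1 z.2) = 0

/-- `(ρu)_t + ∇·(ρu ⊗ u) + ∇p = 0` in the sense of distributions on `(0, T) × ℝ³`, component by
component. -/
def MomentumEquation (A γ : ℝ) (T : EReal) (ρ : ℝ → E3 → ℝ) (u : ℝ → E3 → E3) : Prop :=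
  ∀ φ : ℝ × E3 → ℝ, IsTestFunction T φ → ∀ i : Fin 3,
    ∫ z : ℝ × E3, (ρ z.1 z.2 * u z.1 z.2 i * fderiv ℝ φ z (1, u z.1 z.2)
      + pressure A γ (ρ z.1 z.2) * fderiv ℝ φ z (0, EuclideanSpace.single i 1)) = 0

/-- The radial vector field `x ↦ (x / |x|) v(|x|)`. -/
def radialField (v : ℝ → ℝ) (x : E3) : E3 := (v ‖x‖ / ‖x‖) • x

/-- `(ρ, u)` is an `H³` solution on `[0, T)` of the compressible Euler equations with the initial
data `ρ(0, x) = ρ₀(|x|)`, `u(0, x) = (x / |x|) v₀(|x|)`. -/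
structure IsH3Solution (A γ : ℝ) (ρ₀ v₀ : ℝ → ℝ) (T : EReal)
    (ρ : ℝ → E3 → ℝ) (u : ℝ → E3 → E3) : Prop where
  T_pos : 0 < T
  density_nonneg : ∀ t ∈ timeInterval T, ∀ x, 0 ≤ ρ t x
  density_continuous :
    ContinuousOn (fun z : ℝ × E3 => ρ z.1 z.2) (timeInterval T ×ˢ univ)
  velocity_continuous :
    ContinuousOn (fun z : ℝ × E3 => u z.1 z.2) (timeInterval T ×ˢ univ)
  sound_C0_H3 : ContInH 3 (timeInterval T) (fun t x => soundSpeed A γ (ρ t x))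
  sound_C1_H2 : C1InH 2 (timeInterval T) (fun t x => soundSpeed A γ (ρ t x))
  velocity_C0_H3 : ∀ i : Fin 3, ContInH 3 (timeInterval T) (fun t x => u t x i)
  velocity_C1_H2 : ∀ i : Fin 3, C1InH 2 (timeInterval T) (fun t x => u t x i)
  mass : MassEquation T ρ u
  momentum : MomentumEquation A γ T ρ u
  initial_density : ∀ x, ρ 0 x = ρ₀ ‖x‖
  initial_velocity : ∀ x, u 0 x = radialField v₀ x

/-- The `H³` norm of `(c(ρ), u)` at one time. -/
def stateH3Norm (A γ : ℝ) (ρ : E3 → ℝ) (u : E3 → E3) : ℝ≥0∞ :=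
  sobolevENorm 3 (fun x => soundSpeed A γ (ρ x)) + ∑ i : Fin 3, sobolevENorm 3 (fun x => u x i)

/-! ### The quantities attached to the initial data -/

/-- `∫ ρ₀ / (r e^r) dx`. -/
def weightedMass (ρ₀ : ℝ → ℝ) : ℝ := ∫ x : E3, ρ₀ ‖x‖ / (‖x‖ * Real.exp ‖x‖)

/-- `-∫ (1 + r) ρ₀ v₀ / (r² e^r) dx`. -/
def weightedInflow (ρ₀ v₀ : ℝ → ℝ) : ℝ :=
  -∫ x : E3, (1 + ‖x‖) * ρ₀ ‖x‖ * v₀ ‖x‖ / (‖x‖ ^ 2 * Real.exp ‖x‖)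

/-- `C₀ = √(A / ((γ + 1) (4π)^{γ-1}))`. -/
def riccatiConst (A γ : ℝ) : ℝ := √(A / ((γ + 1) * (4 * Real.pi) ^ (γ - 1)))

/-- The bound `2 F₀^{-(γ-1)/2} / ((γ - 1) C₀)` for the blow-up time, where
`F₀ = ∫ ρ₀ / (r e^r) dx`. -/
def blowupTime (A γ : ℝ) (ρ₀ : ℝ → ℝ) : ℝ :=
  2 * weightedMass ρ₀ ^ (-((γ - 1) / 2)) / ((γ - 1) * riccatiConst A γ)

end EulerVacuum

end

open EulerVacuum

noncomputable section

namespace EulerVacuum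

/-! ### Sobolev embeddings -/

/-! Put `w = e^{-r}/r`, `F(t) = ∫ ρ w dx` and `G(t) = ∫ ρ u·∇w dx`. Formally `F' = G` and `G' = ∫ ρ
∇²w(u,u) dx + ∫ p Δw dx`. Since `w` is the Yukawa potential, `Δw = w - 4πδ₀`, and the point mass
contributes nothing as long as the centre remains vacuum. If `u` is radial, then `∇²w(u,u) =
w''(r)|u|² ≥ 0`. As `∫ w = 4π`, Jensen's inequality yields `F'' ≥ ∫ p w ≥ A (4π)^{-(γ-1)} F^γ`. The
inflow hypothesis says `F' ≥ C₀ F^{(γ+1)/2}` at time `0`; this persists because `F'² - C₀² F^{γ+1}`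
is nondecreasing. Hence `F^{-(γ-1)/2}` decreases at least at the rate `(γ-1)C₀/2` and cannot stay
positive up to `T*` inclusive. A bound on the `H³` norm bounds `c` uniformly, hence `F` from above
and `F^{-(γ-1)/2}` away from `0`, which gives the statement at `T = T*`. The ODE argument is
`rpow_neg_le_of_integral_inequality`, Jensen is `rpow_integral_mul_wt_le`, the virial inequality is
`limMass_ge`.

Regularity. On `ℝ³` the Sobolev embeddings make `c` and `u` of class `C¹` with bounded derivatives
on compact time intervals (`exists_isC1Field`). The weak equations then hold pointwise where `c >
0`, in the variables `(c, u)` and with `κ = (γ-1)/2` (`IsClassicalSolution.of_weak`). The sound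
speed equation extends to the vacuum, the velocity equation does not: the conservation laws say
nothing about `u` there.

Symmetry. Solutions are not assumed radial, and `u` is undetermined in the vacuum, so ordinary
uniqueness is unavailable. The solution is compared with its own rotation through a small angle `ε`,
in the relative energy `κ⁻²(c-c₂)² + |u-u₂|²` weighted by `c²` and a decaying function. The velocity
equation of the rotated solution is missing only where `c > 0 = c₂`; there `c ≤ Mε|x|` and `|u-u₂| ≤
Mε(1+|x|)`, so the error is `O(ε³)` (`rotated_energy_le`). Division by `ε²` and `ε → 0` give
infinitesimal equivariance of `u` off vacuum (`IsClassicalSolution.deriv_rotation`). Equivariance in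
the three coordinate planes forces `x × u = 0`, and at the origin `u = 0`; the latter keeps the
centre vacuum (`IsClassicalSolution.vacuum_persists`).

Justification of the formal computation. The weight is smoothed by replacing `r` with `√(r²+δ²)`,
and the density `c^{1/κ}`, which need not be `C¹` in `c`, is replaced by `regDensity`. The smoothed
point mass is bounded by a multiple of `|x|⁻³`; vacuum at the centre gives `c ≤ M|x|`, whose power
`1/κ` is just enough to make the product integrable and to send it to `0` with `δ`. The inequalities
are integrated twice in time before the limit, so `F` itself is never differentiated. -/

lemma continuous_fourier_of_integrable {V : Type*} [NormedAddCommGroup V] [NormedSpace ℂ V]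
    {h : E3 → V} (hh : Integrable h) : Continuous (𝓕 h) :=
  VectorFourier.fourierIntegral_continuous Real.continuous_fourierChar
    (by simpa using (continuous_inner : Continuous fun p : E3 × E3 => inner ℝ p.1 p.2)) hh

/-- The inverse Fourier transform on `L²` of an integrable function is given by the integral. -/
lemma coeFn_fourierInv_Lp_two (v : Lp (α := E3) ℂ 2 volume) (hv : Integrable (v : E3 → ℂ)) :
    ((𝓕⁻ v : Lp (α := E3) ℂ 2 volume) : E3 → ℂ) =ᵐ[volume] 𝓕⁻ (v : E3 → ℂ) := by
  have hcont : Continuous (𝓕⁻ (v : E3 → ℂ)) := by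
    have h1 := continuous_fourier_of_integrable hv
    have h2 : 𝓕⁻ (v : E3 → ℂ) = fun x => 𝓕 (v : E3 → ℂ) (-x) := by
      ext x; exact Real.fourierInv_eq_fourier_neg _ _
    rw [h2]; fun_prop
  apply ae_eq_of_integral_contDiff_smul_eq
  · exact (Lp.memLp _).locallyIntegrable (by norm_num)
  · exact hcont.locallyIntegrable
  · intro g g_smooth g_cpt
    have hg₁ : HasCompactSupport (Complex.ofRealCLM ∘ g) := g_cpt.comp_left rfl
    have hg₂ : ContDiff ℝ ∞ (Complex.ofRealCLM ∘ g) := by fun_prop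
    set φ := hg₁.toSchwartzMap hg₂ with hφ
    have hφx : ∀ x, φ x = (g x : ℂ) := fun x => by simp [hφ]
    have e1 := congrArg (fun T => T φ) (Lp.fourierInv_toTemperedDistribution_eq v)
    simp only [TemperedDistribution.fourierInv_apply, Lp.toTemperedDistribution_apply] at e1
    -- By Fubini the transform moves from the test function to the integrable function `v`; this
    -- matches the distributional inverse transform with the integral one.
    have e2 : ∫ x, (𝓕⁻ φ) x • (v : E3 → ℂ) x = ∫ x, φ x • 𝓕⁻ (v : E3 → ℂ) x := by
      have e3 : ∀ x, (𝓕⁻ φ) x = 𝓕 (fun y => φ (-y)) x := fun x => by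
        rw [SchwartzMap.fourierInv_coe, Real.fourierInv_eq_fourier_comp_neg]
      simp_rw [e3]
      have hint : Integrable (fun y => φ (-y)) := φ.integrable.comp_neg
      have e4 := VectorFourier.integral_fourierIntegral_smul_eq_flip (L := innerₗ E3)
        (μ := volume) (ν := volume) Real.continuous_fourierChar continuous_inner hint hv
      have e5 : ∫ x, 𝓕 (fun y => φ (-y)) x • (v : E3 → ℂ) x
          = ∫ x, φ (-x) • 𝓕 (v : E3 → ℂ) x := by
        simpa using! e4
      rw [e5, ← integral_neg_eq_self]
      refine integral_congr_ae (Eventually.of_forall fun x => ?_)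
      simp only [neg_neg]
      rw [Real.fourierInv_eq_fourier_neg]
    rw [e2] at e1
    simpa [hφx] using e1.symm

/-- The `L²` norm of `(1 + |ξ|²)⁻¹` on `ℝ³`. -/
def embConst : ℝ≥0∞ := eLpNorm (fun ξ : E3 => (1 + ‖ξ‖ ^ 2)⁻¹) 2 volume

lemma embConst_lt_top : embConst < ⊤ := by
  have hc : Continuous (fun ξ : E3 => (1 + ‖ξ‖ ^ 2)⁻¹) :=
    Continuous.inv₀ (by fun_prop) (fun x => by positivity)
  have : MemLp (fun ξ : E3 => (1 + ‖ξ‖ ^ 2)⁻¹) 2 volume := by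
    rw [memLp_two_iff_integrable_sq hc.aestronglyMeasurable]
    have h := integrable_rpow_neg_one_add_norm_sq (E := E3) (μ := volume) (r := 4)
      (by simp; norm_num)
    refine h.congr (Eventually.of_forall fun x => ?_)
    have hp : (0 : ℝ) < 1 + ‖x‖ ^ 2 := by positivity
    change (1 + ‖x‖ ^ 2) ^ (-(4 : ℝ) / 2) = ((1 + ‖x‖ ^ 2)⁻¹) ^ 2
    rw [show (-(4 : ℝ) / 2) = -(2 : ℕ) by norm_num, Real.rpow_neg hp.le, Real.rpow_natCast, inv_pow]
  exact this.2

lemma eLpNorm_one_le_embConst_mul {F G : E3 → ℂ} (hG : AEStronglyMeasurable G volume)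
    (h : ∀ ξ, ‖F ξ‖ ≤ (1 + ‖ξ‖ ^ 2)⁻¹ * ‖G ξ‖) :
    eLpNorm F 1 volume ≤ embConst * eLpNorm G 2 volume := by
  have hc : Continuous (fun ξ : E3 => (1 + ‖ξ‖ ^ 2)⁻¹) :=
    Continuous.inv₀ (by fun_prop) (fun x => by positivity)
  calc eLpNorm F 1 volume
      ≤ eLpNorm ((fun ξ : E3 => (1 + ‖ξ‖ ^ 2)⁻¹) • G) 1 volume := by
        refine eLpNorm_mono fun ξ => ?_
        rw [Pi.smul_apply', norm_smul, Real.norm_of_nonneg (by positivity)]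
        exact h ξ
    _ ≤ _ := eLpNorm_smul_le_mul_eLpNorm hG hc.aestronglyMeasurable

/-- Representation of a function in `H^s(ℝ³)` by an absolutely convergent Fourier integral. -/
lemma exists_fourier_representation {s : ℝ} (hs : 2 ≤ s) {f : E3 → ℝ} (hf : MemH s f) :
    ∃ h : E3 → ℂ, Integrable h ∧ (∀ᵐ x, (f x : ℂ) = 𝓕 h (-x)) ∧
      eLpNorm h 1 volume ≤ embConst * sobolevENorm s f ∧
      (3 ≤ s → eLpNorm (fun ξ => ((‖ξ‖ : ℝ) : ℂ) * h ξ) 1 volume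
        ≤ embConst * sobolevENorm s f) := by
  classical
  by_cases hm : MemLp (fun x => (f x : ℂ)) 2 (volume : Measure E3)
  swap
  · simp [MemH, sobolevENorm, hm] at hf
  have hval : sobolevENorm s f =
      eLpNorm (fun ξ : E3 => (((1 + ‖ξ‖ ^ 2) ^ (s / 2) : ℝ) : ℂ) * (𝓕 (hm.toLp _)) ξ) 2 volume := by
    simp [sobolevENorm, hm]
  set v : Lp (α := E3) ℂ 2 volume := 𝓕 (hm.toLp _) with hv
  have hmeas : AEStronglyMeasurable
      (fun ξ : E3 => (((1 + ‖ξ‖ ^ 2) ^ (s / 2) : ℝ) : ℂ) * v ξ) volume := by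
    refine AEStronglyMeasurable.mul ?_ (Lp.aestronglyMeasurable v)
    refine Continuous.aestronglyMeasurable ?_
    refine Complex.continuous_ofReal.comp ?_
    exact Continuous.rpow_const (by fun_prop) (fun x => Or.inl (by positivity))
  have b1 : ∀ ξ : E3, ‖v ξ‖ ≤ (1 + ‖ξ‖ ^ 2)⁻¹ *
      ‖(((1 + ‖ξ‖ ^ 2) ^ (s / 2) : ℝ) : ℂ) * v ξ‖ := by
    intro ξ
    have hp : (1 : ℝ) ≤ 1 + ‖ξ‖ ^ 2 := by nlinarith [sq_nonneg ‖ξ‖]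
    have h1 : (1 + ‖ξ‖ ^ 2) ≤ (1 + ‖ξ‖ ^ 2) ^ (s / 2) :=
      Real.self_le_rpow_of_one_le hp (by linarith)
    rw [norm_mul, Complex.norm_real, Real.norm_of_nonneg (by positivity), ← mul_assoc]
    refine le_mul_of_one_le_left (norm_nonneg _) ?_
    rw [inv_mul_eq_div, one_le_div (by positivity)]
    exact h1
  have n1 : eLpNorm v 1 volume ≤ embConst * sobolevENorm s f := by
    rw [hval]; exact eLpNorm_one_le_embConst_mul hmeas b1
  have hint : Integrable (v : E3 → ℂ) := by
    rw [← memLp_one_iff_integrable]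
    refine ⟨Lp.aestronglyMeasurable v, n1.trans_lt ?_⟩
    exact ENNReal.mul_lt_top embConst_lt_top hf
  refine ⟨v, hint, ?_, n1, ?_⟩
  · have h1 := coeFn_fourierInv_Lp_two v hint
    have h2 : (𝓕⁻ v : Lp (α := E3) ℂ 2 volume) = hm.toLp _ := by
      rw [hv]; exact FourierTransform.fourierInv_fourier_eq _
    rw [h2] at h1
    filter_upwards [h1, hm.coeFn_toLp] with x hx hx'
    rw [← hx', hx, Real.fourierInv_eq_fourier_neg]
  · intro hs3
    rw [hval]
    refine eLpNorm_one_le_embConst_mul hmeas fun ξ => ?_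
    have hp : (1 : ℝ) ≤ 1 + ‖ξ‖ ^ 2 := by nlinarith [sq_nonneg ‖ξ‖]
    have h1 : (1 + ‖ξ‖ ^ 2) * ‖ξ‖ ≤ (1 + ‖ξ‖ ^ 2) ^ (s / 2) := by
      have : ‖ξ‖ ≤ (1 + ‖ξ‖ ^ 2) ^ ((1 : ℝ) / 2) := by
        rw [← Real.sqrt_eq_rpow]
        exact Real.le_sqrt_of_sq_le (by linarith)
      calc (1 + ‖ξ‖ ^ 2) * ‖ξ‖ ≤ (1 + ‖ξ‖ ^ 2) ^ (1 : ℝ) * (1 + ‖ξ‖ ^ 2) ^ ((1 : ℝ) / 2) := by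
            rw [Real.rpow_one]; gcongr
        _ = (1 + ‖ξ‖ ^ 2) ^ ((3 : ℝ) / 2) := by
            rw [← Real.rpow_add (by positivity)]; norm_num
        _ ≤ _ := Real.rpow_le_rpow_of_exponent_le hp (by linarith)
    rw [norm_mul, norm_mul, Complex.norm_real, Complex.norm_real, norm_norm,
      Real.norm_of_nonneg (by positivity), ← mul_assoc]
    refine mul_le_mul_of_nonneg_right ?_ (norm_nonneg _)
    rw [inv_mul_eq_div, le_div_iff₀ (by positivity), mul_comm]
    exact h1

lemma enorm_fourier_le {V : Type*} [NormedAddCommGroup V] [NormedSpace ℂ V]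
    (h : E3 → V) (x : E3) : ‖𝓕 h x‖ₑ ≤ eLpNorm h 1 volume := by
  rw [eLpNorm_one_eq_lintegral_enorm, Real.fourier_eq]
  refine (enorm_integral_le_lintegral_enorm _).trans (le_of_eq ?_)
  refine lintegral_congr fun y => ?_
  rw [← ofReal_norm, ← ofReal_norm, Circle.norm_smul]

/-- `H^s(ℝ³) ⊂ C⁰(ℝ³)` for `s ≥ 2`. -/
lemma exists_continuous_of_memH {s : ℝ} (hs : 2 ≤ s) {f : E3 → ℝ} (hf : MemH s f) :
    ∃ g : E3 → ℝ, Continuous g ∧ f =ᵐ[volume] g ∧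
      ∀ x, ‖g x‖ₑ ≤ embConst * sobolevENorm s f := by
  obtain ⟨h, hint, hrep, hn, -⟩ := exists_fourier_representation hs hf
  have h1 := continuous_fourier_of_integrable hint
  refine ⟨fun x => (𝓕 h (-x)).re, by fun_prop, ?_, fun x => ?_⟩
  · filter_upwards [hrep] with x hx
    rw [← hx, Complex.ofReal_re]
  · refine le_trans ?_ ((enorm_fourier_le h (-x)).trans hn)
    rw [← ofReal_norm, ← ofReal_norm]
    exact ENNReal.ofReal_le_ofReal (Complex.abs_re_le_norm _)

/-- `H³(ℝ³) ⊂ C¹(ℝ³)`. -/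
lemma exists_hasFDerivAt_of_memH {f : E3 → ℝ} (hfc : Continuous f) (hf : MemH 3 f) :
    ∃ g : E3 → (E3 →L[ℝ] ℝ), Continuous g ∧ (∀ x, HasFDerivAt f (g x) x) ∧
      ∀ x, ‖g x‖ₑ ≤ ENNReal.ofReal (2 * Real.pi) * (embConst * sobolevENorm 3 f) := by
  obtain ⟨h, hint, hrep, hn, hn1⟩ := exists_fourier_representation (by norm_num) hf
  have hn1 := hn1 le_rfl
  -- The third derivative in `H³` is spent here: integrability of `|ξ| |h|` permits differentiation
  -- under the Fourier integral.
  have hmul : Integrable (fun ξ : E3 => ‖ξ‖ * ‖h ξ‖) := by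
    have : Integrable (fun ξ : E3 => ((‖ξ‖ : ℝ) : ℂ) * h ξ) := by
      rw [← memLp_one_iff_integrable]
      refine ⟨?_, hn1.trans_lt (ENNReal.mul_lt_top embConst_lt_top hf)⟩
      exact (Continuous.aestronglyMeasurable (by fun_prop)).mul hint.aestronglyMeasurable
    refine this.norm.congr (Eventually.of_forall fun x => ?_)
    simp
  have h1 := continuous_fourier_of_integrable hint
  set D : E3 → (E3 →L[ℝ] ℂ) := VectorFourier.fourierSMulRight (innerSL ℝ) h with hD
  have hDmeas : AEStronglyMeasurable D volume :=
    hint.aestronglyMeasurable.fourierSMulRight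
  have hDn : ∀ ξ, ‖D ξ‖ ≤ 2 * Real.pi * (‖ξ‖ * ‖h ξ‖) := fun ξ => by
    rw [hD, VectorFourier.norm_fourierSMulRight, innerSL_apply_norm]
    exact le_of_eq (by ring)
  have hDint : Integrable D :=
    (hmul.const_mul (2 * Real.pi)).mono' hDmeas (Eventually.of_forall hDn)
  have hDL : eLpNorm D 1 volume
      ≤ ENNReal.ofReal (2 * Real.pi) * (embConst * sobolevENorm 3 f) := by
    calc eLpNorm D 1 volume
        ≤ eLpNorm ((2 * Real.pi) • (fun ξ : E3 => ((‖ξ‖ : ℝ) : ℂ) * h ξ)) 1 volume := by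
          refine eLpNorm_mono fun ξ => (hDn ξ).trans (le_of_eq ?_)
          rw [Pi.smul_apply, norm_smul, Real.norm_of_nonneg Real.two_pi_pos.le]
          simp
      _ = ENNReal.ofReal (2 * Real.pi)
          * eLpNorm (fun ξ : E3 => ((‖ξ‖ : ℝ) : ℂ) * h ξ) 1 volume := by
          rw [eLpNorm_const_smul, ← ofReal_norm, Real.norm_of_nonneg Real.two_pi_pos.le]
      _ ≤ _ := by gcongr
  have hDc := continuous_fourier_of_integrable hDint
  have hfx : ∀ x, f x = (𝓕 h (-x)).re := by
    have : f =ᵐ[volume] fun x => (𝓕 h (-x)).re := by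
      filter_upwards [hrep] with x hx
      rw [← hx, Complex.ofReal_re]
    exact fun x => congrFun (Continuous.ae_eq_iff_eq volume hfc (by fun_prop) |>.1 this) x
  refine ⟨fun x => -(Complex.reCLM.comp (𝓕 D (-x))), by fun_prop, fun x => ?_, fun x => ?_⟩
  · have e1 := Real.hasFDerivAt_fourier hint hmul (-x)
    have e2 : HasFDerivAt (fun y : E3 => -y) (-(ContinuousLinearMap.id ℝ E3)) x :=
      (hasFDerivAt_id x).neg
    have e3 := Complex.reCLM.hasFDerivAt.comp x (e1.comp x e2)
    have : f = fun x => (𝓕 h (-x)).re := funext hfx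
    rw [this]
    convert! e3 using 1
    ext v
    simp [hD]
  · refine le_trans ?_ ((enorm_fourier_le D (-x)).trans hDL)
    rw [← ofReal_norm, ← ofReal_norm, norm_neg]
    refine ENNReal.ofReal_le_ofReal ((ContinuousLinearMap.opNorm_comp_le _ _).trans ?_)
    rw [Complex.reCLM_norm, one_mul]

/-! ### From Sobolev regularity to classical regularity -/

lemma timeInterval_mem_nhds {T : EReal} {t : ℝ} (ht : t ∈ timeInterval T) (h0 : 0 < t) :
    timeInterval T ∈ 𝓝 t := by
  have h1 : {τ : ℝ | (τ : EReal) < T} ∈ 𝓝 t :=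
    (isOpen_lt continuous_coe_real_ereal continuous_const).mem_nhds ht.2
  filter_upwards [h1, lt_mem_nhds h0] with τ h2 h3 using ⟨h3.le, h2⟩

lemma Icc_subset_timeInterval {T : EReal} {t : ℝ} (ht : t ∈ timeInterval T) :
    Icc 0 t ⊆ timeInterval T := fun τ hτ =>
  ⟨hτ.1, lt_of_le_of_lt (by exact_mod_cast hτ.2) ht.2⟩

/-- A `C¹` field on `[0, T) × ℝ³` with time derivative `ft` and space derivative `fx`, all three
bounded on `[0, T'] × ℝ³` for each `T' < T`. -/
structure IsC1Field {V : Type*} [NormedAddCommGroup V] [NormedSpace ℝ V] (T : EReal)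
    (f ft : ℝ → E3 → V) (fx : ℝ → E3 → (E3 →L[ℝ] V)) : Prop where
  deriv_time : ∀ t ∈ timeInterval T, 0 < t → ∀ x, HasDerivAt (fun τ => f τ x) (ft t x) t
  deriv_space : ∀ t ∈ timeInterval T, ∀ x, HasFDerivAt (f t) (fx t x) x
  cont : ContinuousOn (fun z : ℝ × E3 => f z.1 z.2) (timeInterval T ×ˢ univ)
  cont_time : ContinuousOn (fun z : ℝ × E3 => ft z.1 z.2) (timeInterval T ×ˢ univ)
  cont_space : ContinuousOn (fun z : ℝ × E3 => fx z.1 z.2) (timeInterval T ×ˢ univ)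
  bound : ∀ T' ∈ timeInterval T, ∃ M : ℝ, ∀ t ∈ Icc 0 T', ∀ x,
    ‖f t x‖ ≤ M ∧ ‖ft t x‖ ≤ M ∧ ‖fx t x‖ ≤ M

section Uniform

variable {V : Type*} [NormedAddCommGroup V]

lemma continuousOn_uncurry_of_uniform {J : Set ℝ} {g : ℝ → E3 → V}
    (hc : ∀ t ∈ J, Continuous (g t))
    (hu : ∀ t ∈ J, ∀ ε > 0, ∀ᶠ τ in 𝓝[J] t, ∀ x, ‖g τ x - g t x‖ ≤ ε) :
    ContinuousOn (fun z : ℝ × E3 => g z.1 z.2) (J ×ˢ univ) := by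
  rintro ⟨t, x⟩ ⟨ht, -⟩
  rw [ContinuousWithinAt, Metric.tendsto_nhds]
  intro ε hε
  rw [nhdsWithin_prod_eq, nhdsWithin_univ]
  have h1 := hu t ht (ε / 2) (half_pos hε)
  have h2 : ∀ᶠ y in 𝓝 x, dist (g t y) (g t x) < ε / 2 :=
    Metric.tendsto_nhds.1 (hc t ht).continuousAt _ (half_pos hε)
  filter_upwards [h1.prod_mk h2] with z hz
  calc dist (g z.1 z.2) (g t x) ≤ dist (g z.1 z.2) (g t z.2) + dist (g t z.2) (g t x) :=
        dist_triangle _ _ _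
    _ < ε / 2 + ε / 2 := by
        refine add_lt_add_of_le_of_lt ?_ hz.2
        rw [dist_eq_norm]; exact hz.1 _
    _ = ε := add_halves _

lemma bounded_of_uniform {J K : Set ℝ} (hK : IsCompact K) (hKJ : K ⊆ J) {g : ℝ → E3 → V}
    (hb : ∀ t ∈ J, ∃ M, ∀ x, ‖g t x‖ ≤ M)
    (hu : ∀ t ∈ J, ∀ ε > 0, ∀ᶠ τ in 𝓝[J] t, ∀ x, ‖g τ x - g t x‖ ≤ ε) :
    ∃ M, ∀ t ∈ K, ∀ x, ‖g t x‖ ≤ M := by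
  refine hK.induction_on (p := fun s => ∃ M, ∀ t ∈ s, ∀ x, ‖g t x‖ ≤ M) ⟨0, by simp⟩ ?_ ?_ ?_
  · rintro s s' hss ⟨M, hM⟩
    exact ⟨M, fun t ht => hM t (hss ht)⟩
  · rintro s s' ⟨M, hM⟩ ⟨M', hM'⟩
    refine ⟨max M M', fun t ht x => ?_⟩
    rcases ht with ht | ht
    · exact (hM t ht x).trans (le_max_left _ _)
    · exact (hM' t ht x).trans (le_max_right _ _)
  · intro t ht
    obtain ⟨M, hM⟩ := hb t (hKJ ht)
    refine ⟨_, nhdsWithin_mono t hKJ (hu t (hKJ ht) 1 one_pos), M + 1, fun τ hτ x => ?_⟩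
    calc ‖g τ x‖ = ‖g t x + (g τ x - g t x)‖ := by congr 1; abel
      _ ≤ ‖g t x‖ + ‖g τ x - g t x‖ := norm_add_le _ _
      _ ≤ M + 1 := add_le_add (hM x) (hτ x)

end Uniform

lemma enorm_le_of_memH {s : ℝ} (hs : 2 ≤ s) {f g : E3 → ℝ} (hf : MemH s f)
    (hg : Continuous g) (hfg : f =ᵐ[volume] g) (x : E3) :
    ‖g x‖ₑ ≤ embConst * sobolevENorm s f := by
  obtain ⟨k, hk, hfk, hb⟩ := exists_continuous_of_memH hs hf
  rw [(Continuous.ae_eq_iff_eq volume hg hk).1 (hfg.symm.trans hfk)]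
  exact hb x

/-- Converts convergence in a Sobolev norm into uniform convergence on `ℝ³`. The embedding
inequality is needed only where the norm is finite, which is eventually the case. -/
lemma eventually_norm_le {V : Type*} [NormedAddCommGroup V] {l : Filter ℝ} {C : ℝ≥0∞}
    (hC : C < ⊤) {N : ℝ → ℝ≥0∞} {G : ℝ → E3 → V} (h0 : Tendsto N l (𝓝 0))
    (h : ∀ᶠ τ in l, N τ < ⊤ → ∀ x, ‖G τ x‖ₑ ≤ C * N τ) {ε : ℝ} (hε : 0 < ε) :
    ∀ᶠ τ in l, ∀ x, ‖G τ x‖ ≤ ε := by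
  have h1 : Tendsto (fun τ => C * N τ) l (𝓝 0) := by
    simpa using ENNReal.Tendsto.const_mul h0 (Or.inr hC.ne)
  filter_upwards [h, h1.eventually_lt_const (ENNReal.ofReal_pos.2 hε),
    h0.eventually_lt_const ENNReal.zero_lt_top] with τ h2 h3 h4 x
  have := ((h2 h4 x).trans_lt h3).le
  rwa [← ofReal_norm, ENNReal.ofReal_le_ofReal_iff hε.le] at this

lemma exists_norm_le_of_enorm {V : Type*} [NormedAddCommGroup V] {G : E3 → V} {C : ℝ≥0∞}
    (hC : C < ⊤) (h : ∀ x, ‖G x‖ₑ ≤ C) : ∃ M, ∀ x, ‖G x‖ ≤ M := by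
  refine ⟨C.toReal, fun x => ?_⟩
  have := h x
  rwa [← ofReal_norm, ENNReal.ofReal_le_iff_le_toReal hC.ne] at this

/-- The Sobolev embedding for time-dependent functions. -/
lemma exists_isC1Field {T : EReal} {f : ℝ → E3 → ℝ}
    (hf : ∀ t ∈ timeInterval T, Continuous (f t))
    (h3 : ContInH 3 (timeInterval T) f) (h2 : C1InH 2 (timeInterval T) f) :
    ∃ ft fx, IsC1Field T f ft fx := by
  classical
  obtain ⟨-, f', hf', hder⟩ := h2
  -- The `H²`-valued time derivative is known only up to null sets, so a continuous representative
  -- is chosen at each time.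
  have hrep : ∀ t : ℝ, ∃ g : E3 → ℝ, t ∈ timeInterval T → Continuous g ∧ f' t =ᵐ[volume] g := by
    intro t
    by_cases ht : t ∈ timeInterval T
    · obtain ⟨g, hg, hfg, -⟩ := exists_continuous_of_memH le_rfl (hf'.1 t ht)
      exact ⟨g, fun _ => ⟨hg, hfg⟩⟩
    · exact ⟨0, fun h => absurd h ht⟩
  choose ft hft using hrep
  have hC2 : ENNReal.ofReal (2 * Real.pi) * embConst < ⊤ :=
    ENNReal.mul_lt_top ENNReal.ofReal_lt_top embConst_lt_top
  have hd : ∀ t ∈ timeInterval T, Continuous (fderiv ℝ (f t)) ∧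
      (∀ x, HasFDerivAt (f t) (fderiv ℝ (f t) x) x) ∧
      ∀ x, ‖fderiv ℝ (f t) x‖ₑ
        ≤ ENNReal.ofReal (2 * Real.pi) * embConst * sobolevENorm 3 (f t) := by
    intro t ht
    obtain ⟨g, hg, hfg, hb⟩ := exists_hasFDerivAt_of_memH (hf t ht) (h3.1 t ht)
    have : fderiv ℝ (f t) = g := funext fun x => (hfg x).fderiv
    rw [this]
    exact ⟨hg, hfg, fun x => by rw [mul_assoc]; exact hb x⟩
  have u0 : ∀ t ∈ timeInterval T, ∀ ε > 0,
      ∀ᶠ τ in 𝓝[timeInterval T] t, ∀ x, ‖f τ x - f t x‖ ≤ ε := by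
    intro t ht ε hε
    refine eventually_norm_le embConst_lt_top (h3.2 t ht) ?_ hε
    filter_upwards [self_mem_nhdsWithin] with τ hτ hlt x
    exact enorm_le_of_memH (by norm_num) hlt ((hf τ hτ).sub (hf t ht)) ae_eq_rfl x
  have ut : ∀ t ∈ timeInterval T, ∀ ε > 0,
      ∀ᶠ τ in 𝓝[timeInterval T] t, ∀ x, ‖ft τ x - ft t x‖ ≤ ε := by
    intro t ht ε hε
    refine eventually_norm_le embConst_lt_top (hf'.2 t ht) ?_ hε
    filter_upwards [self_mem_nhdsWithin] with τ hτ hlt x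
    exact enorm_le_of_memH le_rfl hlt ((hft τ hτ).1.sub (hft t ht).1)
      ((hft τ hτ).2.sub (hft t ht).2) x
  have ux : ∀ t ∈ timeInterval T, ∀ ε > 0,
      ∀ᶠ τ in 𝓝[timeInterval T] t, ∀ x, ‖fderiv ℝ (f τ) x - fderiv ℝ (f t) x‖ ≤ ε := by
    intro t ht ε hε
    refine eventually_norm_le hC2 (h3.2 t ht) ?_ hε
    filter_upwards [self_mem_nhdsWithin] with τ hτ hlt x
    obtain ⟨g, hg, hfg, hb⟩ := exists_hasFDerivAt_of_memH ((hf τ hτ).sub (hf t ht)) hlt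
    have : fderiv ℝ (f τ) x - fderiv ℝ (f t) x = g x :=
      (((hd τ hτ).2.1 x).sub ((hd t ht).2.1 x)).unique (hfg x)
    rw [this, mul_assoc]
    exact hb x
  refine ⟨ft, fun t => fderiv ℝ (f t), ?_, fun t ht => (hd t ht).2.1,
    continuousOn_uncurry_of_uniform hf u0,
    continuousOn_uncurry_of_uniform (fun t ht => (hft t ht).1) ut,
    continuousOn_uncurry_of_uniform (fun t ht => (hd t ht).1) ux, ?_⟩
  · intro t ht h0 x
    have hJ := timeInterval_mem_nhds ht h0
    -- For `t > 0` the interval is a neighbourhood of `t`, so the one-sided convention of `C1InH`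
    -- gives the two-sided derivative.
    have hl : 𝓝[timeInterval T \ {t}] t = 𝓝[≠] t := by
      rw [show timeInterval T \ {t} = timeInterval T ∩ {t}ᶜ by ext; simp]
      exact nhdsWithin_inter_of_mem (mem_nhdsWithin_of_mem_nhds hJ)
    rw [hasDerivAt_iff_tendsto_slope, Metric.tendsto_nhds, ← hl]
    intro ε hε
    have := eventually_norm_le (G := fun τ x => (f τ x - f t x) / (τ - t) - ft t x)
      embConst_lt_top (hder t ht) ?_ (half_pos hε)
    · filter_upwards [this] with τ h
      rw [dist_eq_norm, slope_def_field]
      exact (h x).trans_lt (half_lt_self hε)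
    · filter_upwards [self_mem_nhdsWithin] with τ hτ hlt x
      refine enorm_le_of_memH (g := fun x => (f τ x - f t x) / (τ - t) - ft t x) le_rfl hlt ?_ ?_ x
      · exact (((hf τ hτ.1).sub (hf t ht)).div_const _).sub (hft t ht).1
      · filter_upwards [(hft t ht).2] with y hy
        rw [hy]
  · intro T' hT'
    have hK := Icc_subset_timeInterval hT'
    obtain ⟨M0, h0⟩ := bounded_of_uniform isCompact_Icc hK (fun t ht =>
      exists_norm_le_of_enorm (ENNReal.mul_lt_top embConst_lt_top (h3.1 t ht))
        (enorm_le_of_memH (by norm_num) (h3.1 t ht) (hf t ht) ae_eq_rfl)) u0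
    obtain ⟨M1, h1⟩ := bounded_of_uniform isCompact_Icc hK (fun t ht =>
      exists_norm_le_of_enorm (ENNReal.mul_lt_top embConst_lt_top (hf'.1 t ht))
        (enorm_le_of_memH le_rfl (hf'.1 t ht) (hft t ht).1 (hft t ht).2)) ut
    obtain ⟨M2, h2⟩ := bounded_of_uniform isCompact_Icc hK (fun t ht =>
      exists_norm_le_of_enorm (ENNReal.mul_lt_top hC2 (h3.1 t ht)) (hd t ht).2.2) ux
    refine ⟨max M0 (max M1 M2), fun t ht x => ⟨(h0 t ht x).trans (le_max_left _ _),
      (h1 t ht x).trans ?_, (h2 t ht x).trans ?_⟩⟩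
    · exact (le_max_left _ _).trans (le_max_right _ _)
    · exact (le_max_right _ _).trans (le_max_right _ _)

/-- A vector field is `C¹` if its components are. -/
lemma exists_isC1Field_vector {T : EReal} {u : ℝ → E3 → E3}
    (h : ∀ i : Fin 3, ∃ ft fx, IsC1Field T (fun t x => u t x i) ft fx) :
    ∃ ut ux, IsC1Field T u ut ux := by
  choose ft fx hi using h
  set e : Fin 3 → E3 := fun i => EuclideanSpace.single i (1 : ℝ) with he
  have hu : u = fun t x => ∑ i, u t x i • e i := by
    funext t x
    ext j
    simp [he, Finset.sum_apply, Pi.single_apply]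
  refine ⟨fun t x => ∑ i, ft i t x • e i, fun t x => ∑ i, (fx i t x).smulRight (e i),
    ?_, ?_, ?_, ?_, ?_, ?_⟩
  · intro t ht h0 x
    rw [hu]
    exact HasDerivAt.fun_sum fun i _ => ((hi i).deriv_time t ht h0 x).smul_const (e i)
  · intro t ht x
    rw [hu]
    exact HasFDerivAt.fun_sum fun i _ => ((hi i).deriv_space t ht x).smul_const (e i)
  · rw [hu]
    exact continuousOn_finsetSum _ fun i _ => (hi i).cont.smul continuousOn_const
  · exact continuousOn_finsetSum _ fun i _ => (hi i).cont_time.smul continuousOn_const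
  · refine continuousOn_finsetSum _ fun i _ => ?_
    exact ((ContinuousLinearMap.smulRightL ℝ E3 E3).flip (e i)).continuous.comp_continuousOn
      (hi i).cont_space
  · intro T' hT'
    choose M hM using fun i => (hi i).bound T' hT'
    have hen : ∀ i, ‖e i‖ = 1 := fun i => by simp [he]
    refine ⟨∑ i, M i, fun t ht x => ⟨?_, ?_, ?_⟩⟩
    · rw [hu]
      refine norm_sum_le_of_le _ fun i _ => ?_
      rw [norm_smul, hen, mul_one]; exact (hM i t ht x).1
    · refine norm_sum_le_of_le _ fun i _ => ?_
      rw [norm_smul, hen, mul_one]; exact (hM i t ht x).2.1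
    · refine norm_sum_le_of_le _ fun i _ => ?_
      rw [ContinuousLinearMap.norm_smulRight_apply, hen, mul_one]; exact (hM i t ht x).2.2

/-! ### From the weak to the classical equations -/

/-- A weak conservation law with `C¹` densities holds pointwise. -/
lemma sum_lineDeriv_eq_zero_of_weak {ι : Type*} [Fintype ι] {U : Set (ℝ × E3)} (hU : IsOpen U)
    (w : ι → ℝ × E3) (q d : ι → ℝ × E3 → ℝ)
    (hq : ∀ k, ContinuousOn (q k) U) (hd : ∀ k, ContinuousOn (d k) U)
    (hqd : ∀ k, ∀ z ∈ U, HasLineDerivAt ℝ (q k) (d k z) z (w k))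
    (hweak : ∀ φ : ℝ × E3 → ℝ, ContDiff ℝ ∞ φ → HasCompactSupport φ → tsupport φ ⊆ U →
      ∫ z, ∑ k, q k z * fderiv ℝ φ z (w k) = 0) :
    ∀ z ∈ U, ∑ k, d k z = 0 := by
  have hsum : ContinuousOn (fun z => ∑ k, d k z) U := continuousOn_finsetSum _ fun k _ => hd k
  have hae : ∀ᵐ z ∂(volume : Measure (ℝ × E3)), z ∈ U → ∑ k, d k z = 0 := by
    refine hU.ae_eq_zero_of_integral_contDiff_smul_eq_zero
      (hsum.locallyIntegrableOn hU.measurableSet) fun φ hφ hc hs => ?_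
    have int1 : ∀ {a b : ℝ × E3 → ℝ}, ContinuousOn a U → Continuous b → HasCompactSupport b →
        tsupport b ⊆ U → Integrable (fun z => a z * b z) := by
      intro a b ha hb hbc hbs
      refine Continuous.integrable_of_hasCompactSupport ?_ hbc.mul_left
      exact (ha.mul hb.continuousOn).continuous_of_tsupport_subset hU
        ((tsupport_mul_subset_right).trans hbs)
    have hφd : Differentiable ℝ φ := hφ.differentiable (by simp)
    have hφ' : ∀ v, Continuous fun z => fderiv ℝ φ z v := fun v =>
      (hφ.continuous_fderiv (by simp)).clm_apply continuous_const
    have i1 : ∀ k, Integrable (fun z => q k z * fderiv ℝ φ z (w k)) := fun k =>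
      int1 (hq k) (hφ' _) (hc.fderiv_apply ℝ _) ((tsupport_fderiv_apply_subset ℝ _).trans hs)
    have i2 : ∀ k, Integrable (fun z => d k z * φ z) := fun k => int1 (hd k) hφ.continuous hc hs
    have i3 : ∀ k, Integrable (fun z => q k z * φ z) := fun k => int1 (hq k) hφ.continuous hc hs
    have : (volume : Measure (ℝ × E3)).IsAddHaarMeasure :=
      Measure.prod.instIsAddHaarMeasure _ _
    have ibp : ∀ k, ∫ z, q k z * fderiv ℝ φ z (w k) = -∫ z, d k z * φ z := fun k =>
      integral_bilinear_hasLineDerivAt_right_eq_neg_left_of_integrable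
        (B := ContinuousLinearMap.mul ℝ ℝ) (i2 k) (i1 k) (i3 k)
        (fun z hz => hqd k z (hs hz)) (fun z _ => (hφd z).hasFDerivAt.hasLineDerivAt _)
    have h0 := hweak φ hφ hc hs
    rw [integral_finsetSum _ fun k _ => i1 k] at h0
    simp_rw [ibp] at h0
    rw [Finset.sum_neg_distrib, neg_eq_zero, ← integral_finsetSum _ fun k _ => i2 k] at h0
    rw [← h0]
    refine integral_congr_ae (Eventually.of_forall fun z => ?_)
    simp only [smul_eq_mul]
    rw [Finset.mul_sum]
    exact Finset.sum_congr rfl fun k _ => mul_comm _ _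
  have hres : (fun z => ∑ k, d k z) =ᵐ[volume.restrict U] fun _ => (0 : ℝ) := by
    rw [Filter.EventuallyEq, ae_restrict_iff' hU.measurableSet]
    exact hae
  exact Measure.eqOn_open_of_ae_eq hres hU hsum continuousOn_const

/-- The trace of a linear map of `ℝ³`, the divergence of a vector field with this derivative. -/
def dv (L : E3 →L[ℝ] E3) : ℝ := ∑ i : Fin 3, L (EuclideanSpace.single i 1) i

lemma sum_apply_single {V : Type*} [NormedAddCommGroup V] [NormedSpace ℝ V]
    (L : E3 →L[ℝ] V) (v : E3) : ∑ i : Fin 3, v i • L (EuclideanSpace.single i 1) = L v := by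
  conv_rhs => rw [show v = ∑ i, v i • (EuclideanSpace.single i (1 : ℝ)) by
    ext j; simp [Finset.sum_apply, Pi.single_apply]]
  simp

/-- Integration by parts against a test function uses one coordinate direction at a time, so line
derivatives suffice and joint differentiability in `(t, x)` is never needed. -/
lemma IsC1Field.hasLineDerivAt_time {V : Type*} [NormedAddCommGroup V] [NormedSpace ℝ V]
    {T : EReal} {f ft : ℝ → E3 → V} {fx : ℝ → E3 → (E3 →L[ℝ] V)} (h : IsC1Field T f ft fx)
    {z : ℝ × E3} (hz : z.1 ∈ timeInterval T) (h0 : 0 < z.1) :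
    HasLineDerivAt ℝ (fun z : ℝ × E3 => f z.1 z.2) (ft z.1 z.2) z (1, 0) := by
  have h1 := h.deriv_time z.1 hz h0 z.2
  have h2 : HasDerivAt (fun s : ℝ => z.1 + s) 1 0 := by
    simpa using (hasDerivAt_id (0 : ℝ)).const_add z.1
  have h3 := HasDerivAt.scomp_of_eq (0 : ℝ) h1 h2 (by simp)
  simpa [HasLineDerivAt, Function.comp_def] using h3

lemma IsC1Field.hasLineDerivAt_space {V : Type*} [NormedAddCommGroup V] [NormedSpace ℝ V]
    {T : EReal} {f ft : ℝ → E3 → V} {fx : ℝ → E3 → (E3 →L[ℝ] V)} (h : IsC1Field T f ft fx)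
    {z : ℝ × E3} (hz : z.1 ∈ timeInterval T) (v : E3) :
    HasLineDerivAt ℝ (fun z : ℝ × E3 => f z.1 z.2) (fx z.1 z.2 v) z (0, v) := by
  have h1 := (h.deriv_space z.1 hz z.2).hasLineDerivAt v
  simpa [HasLineDerivAt] using h1

lemma HasLineDerivAt.mul' {f g : ℝ × E3 → ℝ} {f' g' : ℝ} {z v : ℝ × E3}
    (hf : HasLineDerivAt ℝ f f' z v) (hg : HasLineDerivAt ℝ g g' z v) :
    HasLineDerivAt ℝ (fun z => f z * g z) (f' * g z + f z * g') z v := by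
  have := HasDerivAt.mul hf hg
  simpa [HasLineDerivAt] using! this

lemma HasLineDerivAt.div_const_rpow {f : ℝ × E3 → ℝ} {f' a m : ℝ} {z v : ℝ × E3} (ha : 0 < a)
    (hf : HasLineDerivAt ℝ f f' z v) (hz : 0 < f z) :
    HasLineDerivAt ℝ (fun z => (f z / a) ^ m) (m * (f z / a) ^ m / f z * f') z v := by
  have h1 := (HasDerivAt.div_const hf a).rpow_const (p := m)
    (Or.inl (by simpa using (div_pos hz ha).ne'))
  have h2 : (f z / a) ^ (m - 1) = (f z / a) ^ m / (f z / a) :=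
    Real.rpow_sub_one (div_pos hz ha).ne' m
  unfold HasLineDerivAt
  convert! h1 using 1
  simp only [zero_smul, add_zero]
  rw [h2]
  field_simp

lemma HasLineDerivAt.coord {f : ℝ × E3 → E3} {f' : E3} {z v : ℝ × E3} (i : Fin 3)
    (hf : HasLineDerivAt ℝ f f' z v) : HasLineDerivAt ℝ (fun z => f z i) (f' i) z v :=
  (EuclideanSpace.proj (𝕜 := ℝ) i).hasFDerivAt.comp_hasDerivAt (0 : ℝ) hf

/-- A solution of the Euler equations in the sound speed and the velocity, classical away from
vacuum; the equation for the velocity is required off vacuum only. -/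
structure IsClassicalSolution (κ : ℝ) (T : EReal) (c ct : ℝ → E3 → ℝ)
    (cx : ℝ → E3 → (E3 →L[ℝ] ℝ)) (u ut : ℝ → E3 → E3) (ux : ℝ → E3 → (E3 →L[ℝ] E3)) : Prop where
  sound_field : IsC1Field T c ct cx
  velocity_field : IsC1Field T u ut ux
  nonneg : ∀ t ∈ timeInterval T, ∀ x, 0 ≤ c t x
  sound : ∀ t ∈ timeInterval T, 0 < t → ∀ x,
    ct t x + cx t x (u t x) + κ * c t x * dv (ux t x) = 0
  velocity : ∀ t ∈ timeInterval T, 0 < t → ∀ x, 0 < c t x → ∀ v,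
    inner ℝ (ut t x + ux t x (u t x)) v + κ⁻¹ * c t x * cx t x v = 0

lemma soundSpeed_eq_mul {A γ ρ : ℝ} (hA : 0 < A) (hγ : 1 < γ) (hρ : 0 ≤ ρ) :
    (soundSpeed A γ ρ / √(A * γ)) ^ ((γ - 1) / 2)⁻¹ = ρ := by
  have ha : 0 < √(A * γ) := Real.sqrt_pos.2 (by positivity)
  rw [soundSpeed, mul_div_cancel_left₀ _ ha.ne', ← Real.rpow_mul hρ, mul_inv_cancel₀ (by linarith),
    Real.rpow_one]

lemma pressure_eq_mul {A γ ρ : ℝ} (hγ : 1 < γ) (hA : 0 < A) (hρ : 0 ≤ ρ) :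
    pressure A γ ρ = soundSpeed A γ ρ ^ 2 * ρ / γ := by
  have h0 : ρ ^ γ = (ρ ^ ((γ - 1) / 2)) ^ 2 * ρ := by
    rcases hρ.eq_or_lt with rfl | hρ
    · simp [Real.zero_rpow (by linarith : γ ≠ 0)]
    · rw [← Real.rpow_natCast, ← Real.rpow_mul hρ.le]
      conv_rhs => rw [← Real.rpow_one ρ, ← Real.rpow_mul hρ.le, ← Real.rpow_add hρ]
      congr 1
      push_cast
      ring
  have hAγ : 0 ≤ A * γ := by positivity
  rw [pressure, soundSpeed, mul_pow, Real.sq_sqrt hAγ, h0]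
  field_simp

lemma soundSpeed_nonneg {A γ ρ : ℝ} (hρ : 0 ≤ ρ) : 0 ≤ soundSpeed A γ ρ :=
  mul_nonneg (Real.sqrt_nonneg _) (Real.rpow_nonneg hρ _)

section Derivation

variable {A γ : ℝ} {T : EReal} {ρ : ℝ → E3 → ℝ} {u : ℝ → E3 → E3}

/-- The region in space-time occupied by the fluid. -/
def fluidRegion (T : EReal) (c : ℝ → E3 → ℝ) : Set (ℝ × E3) :=
  {z | 0 < z.1 ∧ (z.1 : EReal) < T ∧ 0 < c z.1 z.2}

lemma isOpen_fluidRegion {c : ℝ → E3 → ℝ}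
    (hc : ContinuousOn (fun z : ℝ × E3 => c z.1 z.2) (timeInterval T ×ˢ univ)) :
    IsOpen (fluidRegion T c) := by
  have h1 : IsOpen {z : ℝ × E3 | 0 < z.1 ∧ (z.1 : EReal) < T} :=
    (isOpen_lt continuous_const continuous_fst).inter
      (isOpen_lt (continuous_coe_real_ereal.comp continuous_fst) continuous_const)
  have h2 : ContinuousOn (fun z : ℝ × E3 => c z.1 z.2) {z : ℝ × E3 | 0 < z.1 ∧ (z.1 : EReal) < T} :=
    hc.mono fun z hz => ⟨⟨hz.1.le, hz.2⟩, mem_univ _⟩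
  have h3 := h2.isOpen_inter_preimage h1 (isOpen_Ioi (a := (0 : ℝ)))
  convert h3 using 1
  ext z
  simp [fluidRegion, and_assoc]

lemma fderiv_one_eq_sum (L : ℝ × E3 →L[ℝ] ℝ) (v : E3) :
    L (1, v) = L (1, 0) + ∑ i : Fin 3, v i * L (0, EuclideanSpace.single i 1) := by
  have h := sum_apply_single (L.comp (ContinuousLinearMap.inr ℝ ℝ E3)) v
  simp only [ContinuousLinearMap.comp_apply, ContinuousLinearMap.inr_apply, smul_eq_mul] at h
  rw [h, ← map_add]
  simp

lemma fderiv_eq_zero_off_tsupport {φ : ℝ × E3 → ℝ} {z : ℝ × E3} (hz : z ∉ tsupport φ) :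
    fderiv ℝ φ z = 0 := by
  by_contra h
  exact hz (support_fderiv_subset ℝ h)

/-- On the open fluid region the density `(c/a)^{1/κ}` inherits the `C¹` regularity of `c`, so both
conservation laws hold pointwise. The mass equation divided by `κ⁻¹ρ/c` is the sound speed equation.
The momentum equation minus `u` times the mass equation, divided by `ρ`, is the velocity equation;
this division is why the latter is limited to `c > 0`. -/
lemma IsClassicalSolution.of_weak (hA : 0 < A) (hγ : 1 < γ)
    (hρ : ∀ t ∈ timeInterval T, ∀ x, 0 ≤ ρ t x)
    {ct : ℝ → E3 → ℝ} {cx : ℝ → E3 → (E3 →L[ℝ] ℝ)} {ut : ℝ → E3 → E3}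
    {ux : ℝ → E3 → (E3 →L[ℝ] E3)}
    (hc : IsC1Field T (fun t x => soundSpeed A γ (ρ t x)) ct cx) (hu : IsC1Field T u ut ux)
    (hmass : MassEquation T ρ u) (hmom : MomentumEquation A γ T ρ u) :
    IsClassicalSolution ((γ - 1) / 2) T (fun t x => soundSpeed A γ (ρ t x)) ct cx u ut ux := by
  set c : ℝ → E3 → ℝ := fun t x => soundSpeed A γ (ρ t x) with hcdef
  set κ : ℝ := (γ - 1) / 2 with hκ
  have hκ0 : 0 < κ := by rw [hκ]; linarith
  have hγκ : γ = 2 * κ + 1 := by rw [hκ]; ring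
  set a : ℝ := √(A * γ) with hadef
  have ha : 0 < a := Real.sqrt_pos.2 (by positivity)
  have hc0 : ∀ t ∈ timeInterval T, ∀ x, 0 ≤ c t x := fun t ht x => soundSpeed_nonneg (hρ t ht x)
  set U := fluidRegion T c with hUdef
  have hU : IsOpen U := isOpen_fluidRegion hc.cont
  have hUJ : ∀ z ∈ U, z.1 ∈ timeInterval T := fun z hz => ⟨hz.1.le, hz.2.1⟩
  have hUs : U ⊆ timeInterval T ×ˢ univ := fun z hz => ⟨hUJ z hz, mem_univ _⟩
  set R : ℝ × E3 → ℝ := fun z => (c z.1 z.2 / a) ^ κ⁻¹ with hR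
  have hRρ : ∀ z ∈ U, R z = ρ z.1 z.2 := fun z hz =>
    soundSpeed_eq_mul hA hγ (hρ _ (hUJ z hz) _)
  have hRpos : ∀ z ∈ U, 0 < R z := fun z hz => Real.rpow_pos_of_pos (div_pos hz.2.2 ha) _
  have hcc : ContinuousOn (fun z : ℝ × E3 => c z.1 z.2) U := hc.cont.mono hUs
  have hcne : ∀ z ∈ U, c z.1 z.2 ≠ 0 := fun z hz => hz.2.2.ne'
  have hRc : ContinuousOn R U := (hcc.div_const a).rpow_const fun z hz =>
    Or.inl (div_pos hz.2.2 ha).ne'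
  have huc : ∀ i : Fin 3, ContinuousOn (fun z : ℝ × E3 => u z.1 z.2 i) U := fun i =>
    (EuclideanSpace.proj (𝕜 := ℝ) i).continuous.comp_continuousOn (hu.cont.mono hUs)
  have hutc : ∀ i : Fin 3, ContinuousOn (fun z : ℝ × E3 => ut z.1 z.2 i) U := fun i =>
    (EuclideanSpace.proj (𝕜 := ℝ) i).continuous.comp_continuousOn (hu.cont_time.mono hUs)
  have huxc : ∀ i j : Fin 3, ContinuousOn
      (fun z : ℝ × E3 => ux z.1 z.2 (EuclideanSpace.single i 1) j) U := fun i j =>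
    (EuclideanSpace.proj (𝕜 := ℝ) j).continuous.comp_continuousOn
      ((hu.cont_space.mono hUs).clm_apply continuousOn_const)
  have hctc : ContinuousOn (fun z : ℝ × E3 => ct z.1 z.2) U := hc.cont_time.mono hUs
  have hcxc : ∀ i : Fin 3, ContinuousOn
      (fun z : ℝ × E3 => cx z.1 z.2 (EuclideanSpace.single i 1)) U := fun i =>
      (hc.cont_space.mono hUs).clm_apply continuousOn_const
  have lct : ∀ z ∈ U, HasLineDerivAt ℝ (fun z : ℝ × E3 => c z.1 z.2) (ct z.1 z.2) z (1, 0) :=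
    fun z hz => hc.hasLineDerivAt_time (hUJ z hz) hz.1
  have lcx : ∀ z ∈ U, ∀ v, HasLineDerivAt ℝ (fun z : ℝ × E3 => c z.1 z.2) (cx z.1 z.2 v) z (0, v) :=
    fun z hz v => hc.hasLineDerivAt_space (hUJ z hz) v
  have lut : ∀ z ∈ U, ∀ j : Fin 3,
      HasLineDerivAt ℝ (fun z : ℝ × E3 => u z.1 z.2 j) (ut z.1 z.2 j) z (1, 0) :=
    fun z hz j => HasLineDerivAt.coord j (hu.hasLineDerivAt_time (hUJ z hz) hz.1)
  have lux : ∀ z ∈ U, ∀ v, ∀ j : Fin 3,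
      HasLineDerivAt ℝ (fun z : ℝ × E3 => u z.1 z.2 j) (ux z.1 z.2 v j) z (0, v) :=
    fun z hz v j => HasLineDerivAt.coord j (hu.hasLineDerivAt_space (hUJ z hz) v)
  have lRt : ∀ z ∈ U, HasLineDerivAt ℝ R (κ⁻¹ * R z / c z.1 z.2 * ct z.1 z.2) z (1, 0) :=
    fun z hz => HasLineDerivAt.div_const_rpow ha (lct z hz) hz.2.2
  have lRx : ∀ z ∈ U, ∀ v,
      HasLineDerivAt ℝ R (κ⁻¹ * R z / c z.1 z.2 * cx z.1 z.2 v) z (0, v) :=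
    fun z hz v => HasLineDerivAt.div_const_rpow ha (lcx z hz v) hz.2.2
  -- The space-time directions: `none` is time, `some i` is the `i`-th coordinate of space.
  set w : Option (Fin 3) → ℝ × E3 := fun k =>
    k.elim (1, 0) (fun i => (0, EuclideanSpace.single i 1)) with hw
  have test : ∀ φ : ℝ × E3 → ℝ, ContDiff ℝ ∞ φ → HasCompactSupport φ → tsupport φ ⊆ U →
      IsTestFunction T φ := fun φ h1 h2 h3 =>
    ⟨h1, h2, fun z hz => ⟨(h3 hz).1, (h3 hz).2.1⟩⟩
  have eqmass : ∀ z ∈ U, κ⁻¹ * R z / c z.1 z.2 * ct z.1 z.2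
      + ∑ i : Fin 3, (κ⁻¹ * R z / c z.1 z.2 * cx z.1 z.2 (EuclideanSpace.single i 1) * u z.1 z.2 i
        + R z * ux z.1 z.2 (EuclideanSpace.single i 1) i) = 0 := by
    have := sum_lineDeriv_eq_zero_of_weak hU w
      (fun k => k.elim R (fun i z => R z * u z.1 z.2 i))
      (fun k => k.elim (fun z => κ⁻¹ * R z / c z.1 z.2 * ct z.1 z.2)
        (fun i z => κ⁻¹ * R z / c z.1 z.2 * cx z.1 z.2 (EuclideanSpace.single i 1) * u z.1 z.2 i
          + R z * ux z.1 z.2 (EuclideanSpace.single i 1) i)) ?_ ?_ ?_ ?_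
    · intro z hz
      simpa [Fintype.sum_option] using this z hz
    · rintro (_ | i)
      · exact hRc
      · exact hRc.mul (huc i)
    · rintro (_ | i)
      · exact ((continuousOn_const.mul hRc).div hcc hcne).mul hctc
      · exact ((((continuousOn_const.mul hRc).div hcc hcne).mul (hcxc i)).mul (huc i)).add
          (hRc.mul (huxc i i))
    · rintro (_ | i) z hz
      · exact lRt z hz
      · exact HasLineDerivAt.mul' (lRx z hz _) (lux z hz _ i)
    · intro φ h1 h2 h3
      refine Eq.trans ?_ (hmass φ (test φ h1 h2 h3))
      refine integral_congr_ae (Eventually.of_forall fun z => ?_)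
      by_cases hz : z ∈ tsupport φ
      · simp only [Fintype.sum_option, Option.elim, hw]
        rw [fderiv_one_eq_sum _ (u z.1 z.2), hRρ z (h3 hz), mul_add, Finset.mul_sum]
        simp only [mul_assoc]
      · simp [fderiv_eq_zero_off_tsupport hz]
  have eqmom : ∀ j : Fin 3, ∀ z ∈ U,
      (κ⁻¹ * R z / c z.1 z.2 * ct z.1 z.2 * u z.1 z.2 j + R z * ut z.1 z.2 j)
      + ∑ i : Fin 3, (((κ⁻¹ * R z / c z.1 z.2 * cx z.1 z.2 (EuclideanSpace.single i 1) * u z.1 z.2 i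
        + R z * ux z.1 z.2 (EuclideanSpace.single i 1) i) * u z.1 z.2 j
        + R z * u z.1 z.2 i * ux z.1 z.2 (EuclideanSpace.single i 1) j)
        + (if i = j then (κ⁻¹ * c z.1 z.2 * R z) else 0)
          * cx z.1 z.2 (EuclideanSpace.single i 1)) = 0 := by
    intro j
    have := sum_lineDeriv_eq_zero_of_weak hU w
      (fun k => k.elim (fun z => R z * u z.1 z.2 j)
        (fun i z => R z * u z.1 z.2 i * u z.1 z.2 j
          + (if i = j then 1 / γ else 0) * (c z.1 z.2 * c z.1 z.2 * R z)))
      (fun k => k.elim (fun z => κ⁻¹ * R z / c z.1 z.2 * ct z.1 z.2 * u z.1 z.2 j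
          + R z * ut z.1 z.2 j)
        (fun i z => ((κ⁻¹ * R z / c z.1 z.2 * cx z.1 z.2 (EuclideanSpace.single i 1) * u z.1 z.2 i
            + R z * ux z.1 z.2 (EuclideanSpace.single i 1) i) * u z.1 z.2 j
            + R z * u z.1 z.2 i * ux z.1 z.2 (EuclideanSpace.single i 1) j)
          + (if i = j then (κ⁻¹ * c z.1 z.2 * R z) else 0)
            * cx z.1 z.2 (EuclideanSpace.single i 1))) ?_ ?_ ?_ ?_
    · intro z hz
      simpa only [Fintype.sum_option, Option.elim] using this z hz
    · rintro (_ | i)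
      · exact hRc.mul (huc j)
      · exact ((hRc.mul (huc i)).mul (huc j)).add (continuousOn_const.mul ((hcc.mul hcc).mul hRc))
    · rintro (_ | i)
      · exact ((((continuousOn_const.mul hRc).div hcc hcne).mul hctc).mul (huc j)).add
          (hRc.mul (hutc j))
      · refine (((((((continuousOn_const.mul hRc).div hcc hcne).mul (hcxc i)).mul (huc i)).add
          (hRc.mul (huxc i i))).mul (huc j)).add ((hRc.mul (huc i)).mul (huxc i j))).add ?_
        refine ContinuousOn.mul ?_ (hcxc i)
        split_ifs
        · exact (continuousOn_const.mul hcc).mul hRc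
        · exact continuousOn_const
    · rintro (_ | i) z hz
      · exact HasLineDerivAt.mul' (lRt z hz) (lut z hz j)
      · have h1 := HasLineDerivAt.mul' (HasLineDerivAt.mul' (lRx z hz (EuclideanSpace.single i 1))
          (lux z hz _ i)) (lux z hz (EuclideanSpace.single i 1) j)
        -- The pressure is `c²R/γ`. Its gradient `(2+κ⁻¹) c R ∇c / γ` collapses to `κ⁻¹ c R ∇c`
        -- because `γ = 2κ+1`.
        have h2 := HasLineDerivAt.mul' (HasLineDerivAt.mul' (lcx z hz (EuclideanSpace.single i 1))
          (lcx z hz _)) (lRx z hz (EuclideanSpace.single i 1))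
        have h3 := HasDerivAt.const_mul (if i = j then 1 / γ else 0) h2
        have h4 := HasDerivAt.add h1 h3
        unfold HasLineDerivAt
        convert! h4 using 1
        have := hcne z hz
        have hγ0 : (2 * κ + 1) ≠ 0 := by positivity
        simp only [Option.elim]
        split_ifs
        · rw [hγκ]
          field_simp
          ring
        · ring
    · intro φ h1 h2 h3
      refine Eq.trans ?_ (hmom φ (test φ h1 h2 h3) j)
      refine integral_congr_ae (Eventually.of_forall fun z => ?_)
      by_cases hz : z ∈ tsupport φ
      · simp only [Fintype.sum_option, Option.elim, hw]
        rw [fderiv_one_eq_sum _ (u z.1 z.2), ← hRρ z (h3 hz), mul_add, Finset.mul_sum,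
          pressure_eq_mul hγ hA (by rw [hRρ z (h3 hz)]; exact hρ _ (hUJ z (h3 hz)) _)]
        simp only [add_mul, Finset.sum_add_distrib, ite_mul, zero_mul, Finset.sum_ite_eq',
          Finset.mem_univ, if_true]
        have : soundSpeed A γ (R z) = c z.1 z.2 := by rw [hRρ z (h3 hz)]
        rw [this, ← add_assoc]
        congr 1
        · congr 1
          refine Finset.sum_congr rfl fun i _ => by ring
        · ring
      · simp [fderiv_eq_zero_off_tsupport hz]
  have sound_pos : ∀ z ∈ U,
      ct z.1 z.2 + cx z.1 z.2 (u z.1 z.2) + κ * c z.1 z.2 * dv (ux z.1 z.2) = 0 := by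
    intro z hz
    have h := eqmass z hz
    have hsum := sum_apply_single (cx z.1 z.2) (u z.1 z.2)
    simp only [smul_eq_mul] at hsum
    rw [Finset.sum_add_distrib, ← Finset.mul_sum,
      show (∑ i : Fin 3, κ⁻¹ * R z / c z.1 z.2 * cx z.1 z.2 (EuclideanSpace.single i 1)
        * u z.1 z.2 i) = κ⁻¹ * R z / c z.1 z.2 * cx z.1 z.2 (u z.1 z.2) by
        rw [← hsum, Finset.mul_sum]
        exact Finset.sum_congr rfl fun i _ => by ring] at h
    change _ + (_ + R z * dv (ux z.1 z.2)) = 0 at h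
    have h1 := hcne z hz
    have h2 := (hRpos z hz).ne'
    have h3 : R z * (ct z.1 z.2 + cx z.1 z.2 (u z.1 z.2)
        + κ * c z.1 z.2 * dv (ux z.1 z.2)) = 0 := by
      field_simp at h
      linarith
    exact (mul_eq_zero.1 h3).resolve_left h2
  refine ⟨hc, hu, hc0, ?_, ?_⟩
  · intro t ht h0 x
    -- At a vacuum point `c` attains its minimum `0` both in space and in time, so each of the three
    -- terms vanishes separately.
    rcases (hc0 t ht x).eq_or_lt with h | h
    · have hmin : IsLocalMin (c t) x := Eventually.of_forall fun y => by
        rw [← h]; exact hc0 t ht y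
      have hmint : IsLocalMin (fun τ => c τ x) t := by
        filter_upwards [timeInterval_mem_nhds ht h0] with τ hτ
        rw [← h]; exact hc0 τ hτ x
      have e1 : cx t x = 0 := hmin.hasFDerivAt_eq_zero (hc.deriv_space t ht x)
      have e2 : ct t x = 0 := hmint.hasDerivAt_eq_zero (hc.deriv_time t ht h0 x)
      have e3 : c t x = 0 := h.symm
      simp [e1, e2, e3]
    · exact sound_pos (t, x) ⟨h0, ht.2, h⟩
  · intro t ht h0 x hx v
    set z : ℝ × E3 := (t, x) with hz
    have hzU : z ∈ U := ⟨h0, ht.2, hx⟩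
    have key : ∀ j : Fin 3, ut t x j + ux t x (u t x) j
        + κ⁻¹ * c t x * cx t x (EuclideanSpace.single j 1) = 0 := by
      intro j
      have h1 := eqmass z hzU
      have h2 := eqmom j z hzU
      have h3 := sum_apply_single ((EuclideanSpace.proj (𝕜 := ℝ) j).comp (ux t x)) (u t x)
      simp only [ContinuousLinearMap.comp_apply, smul_eq_mul] at h3
      change ∑ i, u t x i * ux t x (EuclideanSpace.single i 1) j = ux t x (u t x) j at h3
      rw [Finset.sum_add_distrib, Finset.sum_add_distrib, ← Finset.sum_mul] at h2
      simp_rw [ite_mul, zero_mul, Finset.sum_ite_eq', Finset.mem_univ, if_true,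
        mul_assoc (R z)] at h2
      rw [← Finset.mul_sum] at h2
      change _ + (_ + R z * (∑ i, u t x i * ux t x (EuclideanSpace.single i 1) j) + _) = 0 at h2
      rw [h3] at h2
      have h4 : R z * (ut t x j + ux t x (u t x) j
        + κ⁻¹ * c t x * cx t x (EuclideanSpace.single j 1)) = 0 := by
        simp only [hz] at h1 h2 ⊢
        linear_combination h2 - u t x j * h1
      exact (mul_eq_zero.1 h4).resolve_left (hRpos z hzU).ne'
    have h5 := sum_apply_single (cx t x) v
    rw [← h5, PiLp.inner_apply, Finset.mul_sum, ← Finset.sum_add_distrib]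
    refine Finset.sum_eq_zero fun j _ => ?_
    have := key j
    simp only [PiLp.add_apply, smul_eq_mul, RCLike.inner_apply, conj_trivial]
    linear_combination v j * this

end Derivation

/-- An `H³` solution is a classical solution in the sound speed and the velocity. -/
lemma IsH3Solution.exists_isClassicalSolution {A γ : ℝ} (hA : 0 < A) (hγ : 1 < γ) {ρ₀ v₀ : ℝ → ℝ}
    {T : EReal} {ρ : ℝ → E3 → ℝ} {u : ℝ → E3 → E3} (h : IsH3Solution A γ ρ₀ v₀ T ρ u) :
    ∃ ct cx ut ux, IsClassicalSolution ((γ - 1) / 2) T (fun t x => soundSpeed A γ (ρ t x))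
      ct cx u ut ux := by
  have hρc : ∀ t ∈ timeInterval T, Continuous (ρ t) := fun t ht =>
    h.density_continuous.comp_continuous (f := fun x => (t, x)) (by fun_prop)
      fun x => ⟨ht, mem_univ _⟩
  have huc : ∀ t ∈ timeInterval T, Continuous (u t) := fun t ht =>
    h.velocity_continuous.comp_continuous (f := fun x => (t, x)) (by fun_prop)
      fun x => ⟨ht, mem_univ _⟩
  have hκ : 0 ≤ (γ - 1) / 2 := by linarith
  obtain ⟨ct, cx, hc⟩ := exists_isC1Field
    (fun t ht => continuous_const.mul ((hρc t ht).rpow_const fun _ => Or.inr hκ))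
    h.sound_C0_H3 h.sound_C1_H2
  obtain ⟨ut, ux, hu⟩ := exists_isC1Field_vector fun i => exists_isC1Field
    (fun t ht => (EuclideanSpace.proj (𝕜 := ℝ) i).continuous.comp (huc t ht))
    (h.velocity_C0_H3 i) (h.velocity_C1_H2 i)
  exact ⟨ct, cx, ut, ux, IsClassicalSolution.of_weak hA hγ h.density_nonneg hc hu h.mass h.momentum⟩

/-! ### Divergence and weights -/

lemma dv_eq_trace (L : E3 →L[ℝ] E3) : dv L = LinearMap.trace ℝ E3 (L : E3 →ₗ[ℝ] E3) := by
  rw [LinearMap.trace_eq_sum_inner _ (EuclideanSpace.basisFun (Fin 3) ℝ)]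
  refine Finset.sum_congr rfl fun i _ => ?_
  simp [EuclideanSpace.inner_single_left]

lemma dv_conj (R : E3 ≃ₗᵢ[ℝ] E3) (L : E3 →L[ℝ] E3) :
    dv ((R.symm.toContinuousLinearEquiv : E3 →L[ℝ] E3) ∘L L ∘L
      (R.toContinuousLinearEquiv : E3 →L[ℝ] E3)) = dv L := by
  rw [dv_eq_trace, dv_eq_trace]
  exact LinearMap.trace_conj' (L : E3 →ₗ[ℝ] E3) R.symm.toLinearEquiv

lemma dv_add (L L' : E3 →L[ℝ] E3) : dv (L + L') = dv L + dv L' := by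
  simp [dv, Finset.sum_add_distrib]

lemma dv_sub (L L' : E3 →L[ℝ] E3) : dv (L - L') = dv L - dv L' := by
  simp [dv, Finset.sum_sub_distrib]

lemma dv_smul (a : ℝ) (L : E3 →L[ℝ] E3) : dv (a • L) = a * dv L := by
  simp [dv, Finset.mul_sum]

lemma dv_smulRight (f : E3 →L[ℝ] ℝ) (v : E3) : dv (f.smulRight v) = f v := by
  rw [← sum_apply_single f v]
  simp only [dv, ContinuousLinearMap.smulRight_apply, PiLp.smul_apply, smul_eq_mul]
  exact Finset.sum_congr rfl fun i _ => mul_comm _ _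

lemma dv_id : dv (ContinuousLinearMap.id ℝ E3) = 3 := by
  simp [dv]

lemma abs_coord_le (v : E3) (i : Fin 3) : |v i| ≤ ‖v‖ := by
  simpa using PiLp.norm_apply_le v i

lemma abs_dv_le (L : E3 →L[ℝ] E3) : |dv L| ≤ 3 * ‖L‖ := by
  have h : ∀ i : Fin 3, |L (EuclideanSpace.single i 1) i| ≤ ‖L‖ := fun i =>
    (abs_coord_le _ i).trans ((L.le_opNorm _).trans (by simp))
  calc |dv L| ≤ ∑ i : Fin 3, |L (EuclideanSpace.single i 1) i| := Finset.abs_sum_le_sum_abs _ _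
    _ ≤ ∑ _i : Fin 3, ‖L‖ := Finset.sum_le_sum fun i _ => h i
    _ = 3 * ‖L‖ := by simp

lemma continuous_dv : Continuous dv := by
  unfold dv; fun_prop

/-- The divergence theorem for integrable fields with integrable derivative. -/
lemma integral_dv_eq_zero {Z : E3 → E3} {DZ : E3 → (E3 →L[ℝ] E3)}
    (hZ : ∀ x, HasFDerivAt Z (DZ x) x) (hi : Integrable Z) (hDi : Integrable DZ) :
    Integrable (fun x => dv (DZ x)) ∧ ∫ x, dv (DZ x) = 0 := by
  have hcomp : ∀ i : Fin 3, Integrable fun x => DZ x (EuclideanSpace.single i 1) i := fun i =>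
    ((EuclideanSpace.proj (𝕜 := ℝ) i).comp
      (ContinuousLinearMap.apply ℝ E3 (EuclideanSpace.single i (1 : ℝ)))).integrable_comp hDi
  have hZi : ∀ i : Fin 3, Integrable fun x => Z x i := fun i =>
    (EuclideanSpace.proj (𝕜 := ℝ) i).integrable_comp hi
  refine ⟨integrable_finsetSum _ fun i _ => hcomp i, ?_⟩
  simp only [dv]
  rw [integral_finsetSum _ fun i _ => hcomp i]
  refine Finset.sum_eq_zero fun i _ => ?_
  -- Integration by parts against the constant `1`: integrability replaces any boundary condition at
  -- infinity.
  have h := integral_bilinear_hasFDerivAt_right_eq_neg_left_of_integrable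
    (μ := (volume : Measure E3)) (B := ContinuousLinearMap.mul ℝ ℝ)
    (f := fun x => Z x i) (f' := fun x => (EuclideanSpace.proj (𝕜 := ℝ) i).comp (DZ x))
    (g := fun _ => (1 : ℝ)) (g' := fun _ => 0) (v := EuclideanSpace.single i 1)
    (by simpa using hcomp i) (by simp) (by simpa using hZi i)
    (fun x _ => (EuclideanSpace.proj (𝕜 := ℝ) i).hasFDerivAt.comp x (hZ x))
    (fun x _ => hasFDerivAt_const _ _)
  simpa using h.symm

/-- An algebraically decaying weight. -/
def decay (x : E3) : ℝ := ((1 + ‖x‖ ^ 2) ^ 4)⁻¹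

/-- The derivative of `decay`. -/
def decayDeriv (x : E3) : E3 →L[ℝ] ℝ := (-8 * ((1 + ‖x‖ ^ 2) ^ 5)⁻¹) • innerSL ℝ x

lemma decay_pos (x : E3) : 0 < decay x := by unfold decay; positivity

lemma continuous_decay : Continuous decay := by
  unfold decay
  exact Continuous.inv₀ (by fun_prop) (fun x => by positivity)

lemma hasFDerivAt_decay (x : E3) : HasFDerivAt decay (decayDeriv x) x := by
  have h1 : HasFDerivAt (fun x : E3 => 1 + ‖x‖ ^ 2) (2 • innerSL ℝ x) x :=
    ((hasStrictFDerivAt_norm_sq x).hasFDerivAt).const_add 1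
  have hp : (1 + ‖x‖ ^ 2 : ℝ) ≠ 0 := by positivity
  have h2 : HasDerivAt (fun s : ℝ => (s ^ 4)⁻¹) (-4 * ((1 + ‖x‖ ^ 2) ^ 5)⁻¹) (1 + ‖x‖ ^ 2) := by
    have := ((hasDerivAt_pow 4 (1 + ‖x‖ ^ 2 : ℝ)).inv (by positivity))
    convert! this using 1
    field_simp
    norm_num
  have h3 := h2.comp_hasFDerivAt x h1
  unfold decayDeriv
  convert! h3 using 1
  ext v
  simp
  ring

/-- A weight with `|∇ψ| ≤ 8ψ` lets the flux terms that hit the weight be absorbed by the energy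
itself. -/
lemma abs_decayDeriv_le (x v : E3) : |decayDeriv x v| ≤ 8 * decay x * ‖v‖ := by
  have h1 : |inner ℝ x v| ≤ ‖x‖ * ‖v‖ := abs_real_inner_le_norm x v
  have h2 : ‖x‖ ≤ 1 + ‖x‖ ^ 2 := by nlinarith [sq_nonneg (‖x‖ - 1)]
  have h3 : |decayDeriv x v| = 8 * ((1 + ‖x‖ ^ 2) ^ 5)⁻¹ * |inner ℝ x v| := by
    have hp : 0 ≤ 8 * ((1 + ‖x‖ ^ 2) ^ 5)⁻¹ := by positivity
    simp only [decayDeriv, smul_apply, innerSL_apply_apply, smul_eq_mul]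
    rw [neg_mul, neg_mul, abs_neg, abs_mul, abs_of_nonneg hp]
  rw [h3, decay, show ((1 + ‖x‖ ^ 2) ^ 4)⁻¹ = ((1 + ‖x‖ ^ 2) ^ 5)⁻¹ * (1 + ‖x‖ ^ 2) by
    field_simp]
  calc 8 * ((1 + ‖x‖ ^ 2) ^ 5)⁻¹ * |inner ℝ x v|
      ≤ 8 * ((1 + ‖x‖ ^ 2) ^ 5)⁻¹ * ((1 + ‖x‖ ^ 2) * ‖v‖) := by
        gcongr
        exact h1.trans (by gcongr)
    _ = _ := by ring

lemma norm_decayDeriv_le (x : E3) : ‖decayDeriv x‖ ≤ 8 * decay x :=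
  ContinuousLinearMap.opNorm_le_bound _ (by have := decay_pos x; positivity)
    fun v => abs_decayDeriv_le x v

/-- A rotation moves `x` by an amount proportional to `|x|`, so the error in the energy estimate
grows cubically; the weight decays like `|x|⁻⁸` to compensate. -/
lemma integrable_decay_mul : Integrable fun x : E3 => (1 + ‖x‖) ^ 3 * decay x := by
  have h := integrable_rpow_neg_one_add_norm_sq (E := E3) (μ := volume) (r := 4) (by simp; norm_num)
  refine (h.const_mul 4).mono'
    (((by fun_prop : Continuous fun x : E3 => (1 + ‖x‖) ^ 3).mul
      continuous_decay).aestronglyMeasurable)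
    (Eventually.of_forall fun x => ?_)
  have hd := decay_pos x
  rw [Real.norm_of_nonneg (by positivity),
    show (-(4 : ℝ) / 2) = -(2 : ℕ) by norm_num, Real.rpow_neg (by positivity), Real.rpow_natCast,
    decay, ← div_eq_mul_inv, div_le_iff₀ (by positivity)]
  have e : 4 * ((1 + ‖x‖ ^ 2) ^ 2)⁻¹ * (1 + ‖x‖ ^ 2) ^ 4 = 4 * (1 + ‖x‖ ^ 2) ^ 2 := by
    field_simp
  rw [e]
  have hx := norm_nonneg x
  have h1 : (1 + ‖x‖) ^ 2 ≤ 2 * (1 + ‖x‖ ^ 2) := by nlinarith [sq_nonneg (‖x‖ - 1)]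
  calc (1 + ‖x‖) ^ 3 ≤ (1 + ‖x‖) ^ 4 := pow_le_pow_right₀ (by linarith) (by norm_num)
    _ = ((1 + ‖x‖) ^ 2) ^ 2 := by ring
    _ ≤ (2 * (1 + ‖x‖ ^ 2)) ^ 2 := by gcongr
    _ = _ := by ring

lemma integrable_decay : Integrable decay := by
  refine integrable_decay_mul.mono' continuous_decay.aestronglyMeasurable
    (Eventually.of_forall fun x => ?_)
  rw [Real.norm_of_nonneg (decay_pos x).le]
  refine le_mul_of_one_le_left (decay_pos x).le (one_le_pow₀ ?_)
  linarith [norm_nonneg x]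

/-- A Gronwall inequality. -/
lemma gronwall_le {f f' : ℝ → ℝ} {b K D : ℝ} (hf : ContinuousOn f (Icc 0 b))
    (hd : ∀ t ∈ Ioo 0 b, HasDerivAt f (f' t) t) (hle : ∀ t ∈ Ioo 0 b, f' t ≤ K * (f t + D))
    (h0 : f 0 = 0) {t : ℝ} (ht : t ∈ Icc 0 b) : f t + D ≤ D * Real.exp (K * t) := by
  have hG : AntitoneOn (fun s => (f s + D) * Real.exp (-(K * s))) (Icc 0 b) := by
    have hder : ∀ s ∈ Ioo 0 b, HasDerivAt (fun s => (f s + D) * Real.exp (-(K * s)))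
        (f' s * Real.exp (-(K * s)) + (f s + D) * (Real.exp (-(K * s)) * (-(K * 1)))) s :=
      fun s hs => ((hd s hs).add_const D).mul (((hasDerivAt_id s).const_mul K).neg.exp)
    refine antitoneOn_of_deriv_nonpos (convex_Icc 0 b)
      ((hf.add continuousOn_const).mul (by fun_prop)) ?_ ?_
    · rw [interior_Icc]
      exact fun s hs => (hder s hs).differentiableAt.differentiableWithinAt
    · rw [interior_Icc]
      intro s hs
      rw [(hder s hs).deriv]
      have := hle s hs
      have h2 := Real.exp_pos (-(K * s))
      nlinarith
  have h1 := hG ⟨le_rfl, ht.1.trans ht.2⟩ ht ht.1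
  simp only [h0, mul_zero, neg_zero, Real.exp_zero, mul_one, zero_add] at h1
  calc f t + D = (f t + D) * Real.exp (-(K * t)) * Real.exp (K * t) := by
        rw [mul_assoc, ← Real.exp_add]; simp
    _ ≤ D * Real.exp (K * t) := by gcongr

/-! ### The energy estimate for the comparison with a rotated solution -/

/-- The growth rate in the energy estimate. -/
def energyRate (κ M : ℝ) : ℝ := M * (3 * |1 - 2 * κ| + 6 * κ + 2 * κ⁻¹ + 34) + 1

/-- The summand `1` in `energyRate` serves this bound: `gronwall_le` takes the source in the form `K
* (f + D)`, and a source `D` fits once `1 ≤ K`. -/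
lemma energyRate_pos {κ M : ℝ} (hκ : 0 < κ) (hM : 1 ≤ M) : 1 ≤ energyRate κ M := by
  unfold energyRate
  have : 0 ≤ M * (3 * |1 - 2 * κ| + 6 * κ + 2 * κ⁻¹ + 34) := by positivity
  linarith

-- The system in `(c, u)` is symmetrized by the factor `κ⁻²`. The top-order terms in the time
-- derivative of the energy are then transport by `u` and `-2κ⁻¹ c³ ψ div((c-c₂)(u-u₂))`, so adding
-- the divergence of the energy flux leaves only terms quadratic in the difference. Each carries
-- `c²`, even those in which the derivative falls on the weight `c³`. Where `c > 0 = c₂` the missing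
-- velocity equation enters as the defect `B`.
set_option maxHeartbeats 1000000 in
lemma energy_pointwise {κ M ψ B : ℝ} (hκ : 0 < κ) (hM : 1 ≤ M) (hψ : 0 ≤ ψ) (hB0 : 0 ≤ B)
    {c c2 ct c2t : ℝ} {u u2 ut u2t : E3} {cx c2x Dψ : E3 →L[ℝ] ℝ} {ux u2x : E3 →L[ℝ] E3}
    (hc : 0 ≤ c) (hc2 : 0 ≤ c2)
    (hs : ct + cx u + κ * c * dv ux = 0) (hs2 : c2t + c2x u2 + κ * c2 * dv u2x = 0)
    (hv : 0 < c → ∀ v, inner ℝ (ut + ux u) v + κ⁻¹ * c * cx v = 0)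
    (hv2 : 0 < c2 → ∀ v, inner ℝ (u2t + u2x u2) v + κ⁻¹ * c2 * c2x v = 0)
    (bc : c ≤ M) (bu : ‖u‖ ≤ M) (bcx : ‖cx‖ ≤ M) (bc2x : ‖c2x‖ ≤ M) (bux : ‖ux‖ ≤ M)
    (bu2x : ‖u2x‖ ≤ M) (hDψ : ∀ v, |Dψ v| ≤ 8 * ψ * ‖v‖)
    (hB : 0 < c → c2 = 0 → 2 * c ^ 2 * (‖u - u2‖ * ‖u2t + u2x u2‖) ≤ B) :
    (2 * c * ct * ψ * (κ⁻¹ ^ 2 * (c - c2) ^ 2 + ‖u - u2‖ ^ 2)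
      + c ^ 2 * ψ * (2 * κ⁻¹ ^ 2 * (c - c2) * (ct - c2t) + 2 * inner ℝ (u - u2) (ut - u2t)))
    + ((2 * c * cx u * ψ * (κ⁻¹ ^ 2 * (c - c2) ^ 2 + ‖u - u2‖ ^ 2)
        + c ^ 2 * Dψ u * (κ⁻¹ ^ 2 * (c - c2) ^ 2 + ‖u - u2‖ ^ 2)
        + c ^ 2 * ψ * (2 * κ⁻¹ ^ 2 * (c - c2) * (cx u - c2x u)
          + 2 * inner ℝ (u - u2) (ux u - u2x u)))
      + c ^ 2 * ψ * (κ⁻¹ ^ 2 * (c - c2) ^ 2 + ‖u - u2‖ ^ 2) * dv ux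
      + 2 * κ⁻¹ * (3 * c ^ 2 * cx (u - u2) * ψ * (c - c2) + c ^ 3 * Dψ (u - u2) * (c - c2)
        + c ^ 3 * ψ * (cx (u - u2) - c2x (u - u2)) + c ^ 3 * ψ * (c - c2) * (dv ux - dv u2x)))
    ≤ energyRate κ M * (c ^ 2 * ψ * (κ⁻¹ ^ 2 * (c - c2) ^ 2 + ‖u - u2‖ ^ 2)) + ψ * B := by
  have hM0 : 0 < M := by linarith
  rcases hc.eq_or_lt with rfl | hc
  · simp only [ne_eq, OfNat.ofNat_ne_zero, not_false_eq_true, zero_pow, mul_zero, zero_mul,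
      add_zero]
    positivity
  set V := u - u2 with hV
  have hu2 : u2 = u - V := by rw [hV]; abel
  set d := c - c2 with hd
  have hc2d : c2 = c - d := by rw [hd]; ring
  set e := κ⁻¹ ^ 2 * d ^ 2 + ‖V‖ ^ 2 with he
  have hvV := hv hc V
  have e1 : inner ℝ V (ut - u2t) + inner ℝ V (ux u - u2x u)
      = inner ℝ (ut + ux u) V - inner ℝ (u2t + u2x u2) V - inner ℝ V (u2x V) := by
    rw [hu2]
    simp only [map_sub, real_inner_comm V, inner_add_right, inner_sub_right]
    ring
  -- The residual of the second velocity equation tested with `V`: zero off the vacuum of `c2`,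
  -- controlled by `B` on it.
  set S : ℝ := inner ℝ (u2t + u2x u2) V + κ⁻¹ * c2 * c2x V with hS
  have hSB : -(2 * c ^ 2 * S) ≤ B := by
    rcases hc2.eq_or_lt with h | h
    · refine le_trans ?_ (hB hc h.symm)
      rw [hS, ← h]
      rw [mul_zero, zero_mul, add_zero, ← mul_neg, mul_comm ‖V‖]
      gcongr
      exact (neg_le_abs _).trans (abs_real_inner_le_norm _ _)
    · rw [hS, hv2 h V]; simpa using hB0
  have hc2u2 : c2x u2 = c2x u - c2x V := by rw [hu2, map_sub]
  have key : (2 * c * ct * ψ * e + c ^ 2 * ψ * (2 * κ⁻¹ ^ 2 * d * (ct - c2t)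
        + 2 * inner ℝ V (ut - u2t)))
      + ((2 * c * cx u * ψ * e + c ^ 2 * Dψ u * e
        + c ^ 2 * ψ * (2 * κ⁻¹ ^ 2 * d * (cx u - c2x u) + 2 * inner ℝ V (ux u - u2x u)))
        + c ^ 2 * ψ * e * dv ux
        + 2 * κ⁻¹ * (3 * c ^ 2 * cx V * ψ * d + c ^ 3 * Dψ V * d
          + c ^ 3 * ψ * (cx V - c2x V) + c ^ 3 * ψ * d * (dv ux - dv u2x)))
      = c ^ 2 * (ψ * ((1 - 2 * κ) * dv ux * e) + Dψ u * e - ψ * (2 * κ⁻¹ * d ^ 2 * dv u2x)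
          - ψ * (2 * κ⁻¹ ^ 2 * d * c2x V) - ψ * (2 * κ⁻¹ * d * c2x V)
          - ψ * (2 * inner ℝ V (u2x V)) + ψ * (6 * κ⁻¹ * d * cx V) + 2 * κ⁻¹ * c * d * Dψ V)
        + ψ * (-(2 * c ^ 2 * S)) := by
    have hct : ct = -cx u - κ * c * dv ux := by linarith
    have hc2t : c2t = -c2x u + c2x V - κ * c2 * dv u2x := by linarith
    have h2 : inner ℝ V (ut - u2t) = inner ℝ (ut + ux u) V - inner ℝ (u2t + u2x u2) V
      - inner ℝ V (u2x V) - inner ℝ V (ux u - u2x u) := by linarith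
    have h3 : inner ℝ (ut + ux u) V = -(κ⁻¹ * c * cx V) := by linarith
    have h4 : inner ℝ (u2t + u2x u2) V = S - κ⁻¹ * c2 * c2x V := by rw [hS]; ring
    rw [h2, h3, h4, hct, hc2t, hc2d]
    field_simp
    ring
  rw [key]
  have he0 : 0 ≤ e := by positivity
  have hd2 : κ⁻¹ ^ 2 * d ^ 2 ≤ e := le_add_of_nonneg_right (sq_nonneg _)
  have hV2 : ‖V‖ ^ 2 ≤ e := le_add_of_nonneg_left (by positivity)
  have hdV : κ⁻¹ * |d| * ‖V‖ ≤ e := by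
    have : 2 * ((κ⁻¹ * |d|) * ‖V‖) ≤ e := by
      rw [he, ← sq_abs d, ← mul_pow]
      linarith only [two_mul_le_add_sq (κ⁻¹ * |d|) ‖V‖]
    have h0 : 0 ≤ (κ⁻¹ * |d|) * ‖V‖ := by positivity
    linarith only [this, h0]
  have bV : ∀ (L : E3 →L[ℝ] ℝ), ‖L‖ ≤ M → |L V| ≤ M * ‖V‖ := fun L hL =>
    (L.le_opNorm V).trans (by gcongr)
  -- The bounds `t1` to `t8` add up to `energyRate`: `3|1-2κ|`, `6κ` and `2κ⁻¹` come from `t1`,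
  -- `t3`, `t4`, and `34 = 8 + 2 + 2 + 6 + 16` from `t2`, `t5`, `t6`, `t7`, `t8`.
  have t1 : (1 - 2 * κ) * dv ux * e ≤ M * (3 * |1 - 2 * κ|) * e := by
    refine mul_le_mul_of_nonneg_right ((le_abs_self _).trans ?_) he0
    rw [abs_mul]
    have := abs_dv_le ux
    calc |1 - 2 * κ| * |dv ux| ≤ |1 - 2 * κ| * (3 * M) := by gcongr; linarith only [this, bux]
      _ = _ := by ring
  have t2 : Dψ u * e ≤ ψ * (8 * M * e) := by
    have h1 : Dψ u ≤ 8 * ψ * M := (le_abs_self _).trans ((hDψ u).trans (by gcongr))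
    calc Dψ u * e ≤ 8 * ψ * M * e := by gcongr
      _ = _ := by ring
  have t3 : -(2 * κ⁻¹ * d ^ 2 * dv u2x) ≤ M * (6 * κ) * e := by
    have h1 : -dv u2x ≤ 3 * M := (neg_le_abs _).trans ((abs_dv_le u2x).trans
      (by linarith only [bu2x]))
    calc -(2 * κ⁻¹ * d ^ 2 * dv u2x) = 2 * κ⁻¹ * d ^ 2 * (-dv u2x) := by ring
      _ ≤ 2 * κ⁻¹ * d ^ 2 * (3 * M) := by gcongr
      _ = M * (6 * κ) * (κ⁻¹ ^ 2 * d ^ 2) := by field_simp; ring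
      _ ≤ _ := by gcongr
  have tdV : ∀ (L : E3 →L[ℝ] ℝ), ‖L‖ ≤ M → |κ⁻¹ * d * L V| ≤ M * e := fun L hL => by
    rw [abs_mul, abs_mul, abs_of_pos (inv_pos.2 hκ)]
    calc κ⁻¹ * |d| * |L V| ≤ κ⁻¹ * |d| * (M * ‖V‖) := by gcongr; exact bV L hL
      _ = M * (κ⁻¹ * |d| * ‖V‖) := by ring
      _ ≤ _ := by gcongr
  have t4 : -(2 * κ⁻¹ ^ 2 * d * c2x V) ≤ M * (2 * κ⁻¹) * e := by
    have := (neg_le_abs _).trans (tdV c2x bc2x)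
    calc -(2 * κ⁻¹ ^ 2 * d * c2x V) = 2 * κ⁻¹ * (-(κ⁻¹ * d * c2x V)) := by ring
      _ ≤ 2 * κ⁻¹ * (M * e) := by gcongr
      _ = _ := by ring
  have t5 : -(2 * κ⁻¹ * d * c2x V) ≤ M * 2 * e := by
    have := (neg_le_abs _).trans (tdV c2x bc2x)
    linarith only [this]
  have t6 : -(2 * inner ℝ V (u2x V)) ≤ M * 2 * e := by
    have h1 := (neg_le_abs _).trans (abs_real_inner_le_norm V (u2x V))
    have h2 : ‖u2x V‖ ≤ M * ‖V‖ := (u2x.le_opNorm V).trans (by gcongr)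
    have h3 : ‖V‖ * ‖u2x V‖ ≤ M * e := by
      calc ‖V‖ * ‖u2x V‖ ≤ ‖V‖ * (M * ‖V‖) := by gcongr
        _ = M * ‖V‖ ^ 2 := by ring
        _ ≤ _ := by gcongr
    linarith only [h1, h3]
  have t7 : 6 * κ⁻¹ * d * cx V ≤ M * 6 * e := by
    have := (le_abs_self _).trans (tdV cx bcx)
    linarith only [this]
  have t8 : 2 * κ⁻¹ * c * d * Dψ V ≤ ψ * (16 * M * e) := by
    refine (le_abs_self _).trans ?_
    rw [show 2 * κ⁻¹ * c * d * Dψ V = (2 * κ⁻¹ * c) * (d * Dψ V) by ring, abs_mul, abs_mul d,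
      abs_of_nonneg (by positivity : 0 ≤ 2 * κ⁻¹ * c)]
    calc 2 * κ⁻¹ * c * (|d| * |Dψ V|) ≤ 2 * κ⁻¹ * M * (|d| * (8 * ψ * ‖V‖)) := by
          gcongr; exact hDψ V
      _ = ψ * (16 * M * (κ⁻¹ * |d| * ‖V‖)) := by ring
      _ ≤ _ := by gcongr
  have t9 : ψ * (-(2 * c ^ 2 * S)) ≤ ψ * B := by gcongr
  have s1 := mul_le_mul_of_nonneg_left t1 hψ
  have s3 := mul_le_mul_of_nonneg_left t3 hψ
  have s4 := mul_le_mul_of_nonneg_left t4 hψ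
  have s5 := mul_le_mul_of_nonneg_left t5 hψ
  have s6 := mul_le_mul_of_nonneg_left t6 hψ
  have s7 := mul_le_mul_of_nonneg_left t7 hψ
  refine add_le_add ?_ t9
  have hce : 0 ≤ c ^ 2 * ψ * e := by positivity
  calc c ^ 2 * (ψ * ((1 - 2 * κ) * dv ux * e) + Dψ u * e - ψ * (2 * κ⁻¹ * d ^ 2 * dv u2x)
          - ψ * (2 * κ⁻¹ ^ 2 * d * c2x V) - ψ * (2 * κ⁻¹ * d * c2x V)
          - ψ * (2 * inner ℝ V (u2x V)) + ψ * (6 * κ⁻¹ * d * cx V) + 2 * κ⁻¹ * c * d * Dψ V)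
      ≤ c ^ 2 * (ψ * (M * (3 * |1 - 2 * κ| + 6 * κ + 2 * κ⁻¹ + 34) * e)) := by
        gcongr
        linarith only [s1, s3, s4, s5, s6, s7, t2, t8]
    _ ≤ energyRate κ M * (c ^ 2 * ψ * e) := by
        unfold energyRate
        linarith only [hce]

/-! ### Time-dependent functions dominated by a weight -/

/-- `|f(t, x)| ≤ C g(x)` for `t ∈ [0, b]`. -/
def Dom {V : Type*} [NormedAddCommGroup V] (b : ℝ) (g : E3 → ℝ) (f : ℝ → E3 → V) : Prop :=
  ∃ C : ℝ, 0 ≤ C ∧ ∀ t ∈ Icc 0 b, ∀ x, ‖f t x‖ ≤ C * g x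

namespace Dom

variable {V W Y : Type*} [NormedAddCommGroup V] [NormedAddCommGroup W] [NormedAddCommGroup Y]
  {b : ℝ} {g : E3 → ℝ} {f f' : ℝ → E3 → V} {k : ℝ → E3 → W} {h : ℝ → E3 → Y}

lemma of_bound {M : ℝ} (hf : ∀ t ∈ Icc 0 b, ∀ x, ‖f t x‖ ≤ M) : Dom b (fun _ => 1) f :=
  ⟨max M 0, le_max_right _ _, fun t ht x => by
    rw [mul_one]; exact (hf t ht x).trans (le_max_left _ _)⟩

lemma const (v : V) : Dom b (fun _ => 1) (fun _ _ => v) := of_bound (M := ‖v‖) fun _ _ _ => le_rfl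

lemma add (h1 : Dom b g f) (h2 : Dom b g f') : Dom b g (fun t x => f t x + f' t x) := by
  obtain ⟨C, hC, h1⟩ := h1
  obtain ⟨C', hC', h2⟩ := h2
  refine ⟨C + C', by positivity, fun t ht x => ?_⟩
  rw [add_mul]
  exact norm_add_le_of_le (h1 t ht x) (h2 t ht x)

lemma sub (h1 : Dom b g f) (h2 : Dom b g f') : Dom b g (fun t x => f t x - f' t x) := by
  obtain ⟨C, hC, h1⟩ := h1
  obtain ⟨C', hC', h2⟩ := h2
  refine ⟨C + C', by positivity, fun t ht x => ?_⟩
  rw [add_mul]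
  exact norm_sub_le_of_le (h1 t ht x) (h2 t ht x)

lemma bilin_right (hg : ∀ x, 0 ≤ g x) (h1 : Dom b g f) (h2 : Dom b (fun _ => 1) k)
    (hle : ∀ t x, ‖h t x‖ ≤ ‖f t x‖ * ‖k t x‖) : Dom b g h := by
  obtain ⟨C, hC, h1⟩ := h1
  obtain ⟨C', hC', h2⟩ := h2
  refine ⟨C * C', by positivity, fun t ht x => (hle t x).trans ?_⟩
  have h3 := h2 t ht x
  rw [mul_one] at h3
  calc ‖f t x‖ * ‖k t x‖ ≤ (C * g x) * C' :=
        mul_le_mul (h1 t ht x) h3 (norm_nonneg _) (mul_nonneg hC (hg x))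
    _ = _ := by ring

lemma bilin_left (hg : ∀ x, 0 ≤ g x) (h1 : Dom b (fun _ => 1) f) (h2 : Dom b g k)
    (hle : ∀ t x, ‖h t x‖ ≤ ‖f t x‖ * ‖k t x‖) : Dom b g h :=
  bilin_right hg h2 h1 fun t x => by rw [mul_comm]; exact hle t x

variable {a a' : ℝ → E3 → ℝ}

lemma mul (hg : ∀ x, 0 ≤ g x) (h1 : Dom b g a) (h2 : Dom b (fun _ => 1) a') :
    Dom b g (fun t x => a t x * a' t x) :=
  bilin_right hg h1 h2 fun _ _ => norm_mul_le _ _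

lemma mul' (hg : ∀ x, 0 ≤ g x) (h1 : Dom b (fun _ => 1) a) (h2 : Dom b g a') :
    Dom b g (fun t x => a t x * a' t x) :=
  bilin_left hg h1 h2 fun _ _ => norm_mul_le _ _

lemma mul_bdd (h1 : Dom b (fun _ => 1) a) (h2 : Dom b (fun _ => 1) a') :
    Dom b (fun _ => 1) (fun t x => a t x * a' t x) := mul (fun _ => zero_le_one) h1 h2

lemma pow_bdd (h1 : Dom b (fun _ => 1) a) (n : ℕ) : Dom b (fun _ => 1) (fun t x => a t x ^ n) := by
  obtain ⟨C, hC, h1⟩ := h1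
  refine ⟨C ^ n, by positivity, fun t ht x => ?_⟩
  have := h1 t ht x
  rw [mul_one] at this ⊢
  rw [norm_pow]
  gcongr

lemma const_mul (r : ℝ) (h1 : Dom b g a) : Dom b g (fun t x => r * a t x) := by
  obtain ⟨C, hC, h1⟩ := h1
  refine ⟨|r| * C, by positivity, fun t ht x => ?_⟩
  rw [norm_mul, Real.norm_eq_abs, mul_assoc]
  exact mul_le_mul_of_nonneg_left (h1 t ht x) (abs_nonneg r)

lemma weight {w : E3 → V} {C : ℝ} (hC : 0 ≤ C) (hw : ∀ x, ‖w x‖ ≤ C * g x) :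
    Dom b g (fun _ x => w x) := ⟨C, hC, fun _ _ x => hw x⟩

lemma integrable {t : ℝ} [MeasurableSpace V] [BorelSpace V] [SecondCountableTopology V]
    (h1 : Dom b g f) (ht : t ∈ Icc 0 b)
    (hg : Integrable g) (hf : Continuous (f t)) : Integrable (f t) := by
  obtain ⟨C, hC, h1⟩ := h1
  exact (hg.const_mul C).mono' hf.aestronglyMeasurable (Eventually.of_forall fun x => h1 t ht x)

variable [NormedSpace ℝ V] [NormedSpace ℝ W]

lemma smul (hg : ∀ x, 0 ≤ g x) (h1 : Dom b g a) (h2 : Dom b (fun _ => 1) f) :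
    Dom b g (fun t x => a t x • f t x) :=
  bilin_right hg h1 h2 fun _ _ => norm_smul_le _ _

lemma smul_bdd (h1 : Dom b (fun _ => 1) a) (h2 : Dom b (fun _ => 1) f) :
    Dom b (fun _ => 1) (fun t x => a t x • f t x) := smul (fun _ => zero_le_one) h1 h2

lemma smul' (hg : ∀ x, 0 ≤ g x) (h1 : Dom b (fun _ => 1) a) (h2 : Dom b g f) :
    Dom b g (fun t x => a t x • f t x) :=
  bilin_left hg h1 h2 fun _ _ => norm_smul_le _ _

lemma comp_clm {Y : Type*} [NormedAddCommGroup Y] [NormedSpace ℝ Y]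
    {L : ℝ → E3 → (V →L[ℝ] W)} {N : ℝ → E3 → (Y →L[ℝ] V)} (hg : ∀ x, 0 ≤ g x) (h1 : Dom b g L)
    (h2 : Dom b (fun _ => 1) N) : Dom b g (fun t x => (L t x).comp (N t x)) :=
  bilin_right hg h1 h2 fun _ _ => ContinuousLinearMap.opNorm_comp_le _ _

lemma smulRight {L : ℝ → E3 → (W →L[ℝ] ℝ)} (hg : ∀ x, 0 ≤ g x) (h1 : Dom b g L)
    (h2 : Dom b (fun _ => 1) f) : Dom b g (fun t x => (L t x).smulRight (f t x)) :=
  bilin_right hg h1 h2 fun _ _ => (ContinuousLinearMap.norm_smulRight_apply _ _).le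

lemma dv {L : ℝ → E3 → (E3 →L[ℝ] E3)} (h1 : Dom b g L) :
    Dom b g (fun t x => EulerVacuum.dv (L t x)) := by
  obtain ⟨C, hC, h1⟩ := h1
  refine ⟨3 * C, by positivity, fun t ht x => (abs_dv_le _).trans ?_⟩
  linarith [h1 t ht x]

lemma inner {v w : ℝ → E3 → E3} (hg : ∀ x, 0 ≤ g x) (h1 : Dom b g v)
    (h2 : Dom b (fun _ => 1) w) : Dom b g (fun t x => Inner.inner ℝ (v t x) (w t x)) :=
  bilin_right hg h1 h2 fun _ _ => norm_inner_le_norm _ _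

lemma inner_bdd {v w : ℝ → E3 → E3} (h1 : Dom b (fun _ => 1) v)
    (h2 : Dom b (fun _ => 1) w) : Dom b (fun _ => 1) (fun t x => Inner.inner ℝ (v t x) (w t x)) :=
  inner (fun _ => zero_le_one) h1 h2

lemma norm_sq {v : ℝ → E3 → E3} (h1 : Dom b (fun _ => 1) v) :
    Dom b (fun _ => 1) (fun t x => ‖v t x‖ ^ 2) := by
  simpa only [real_inner_self_eq_norm_sq] using inner_bdd h1 h1

lemma innerSL {v : ℝ → E3 → E3} (h1 : Dom b g v) :
    Dom b g (fun t x => _root_.innerSL ℝ (v t x)) := by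
  obtain ⟨C, hC, h1⟩ := h1
  refine ⟨C, hC, fun t ht x => ?_⟩
  rw [innerSL_apply_norm]; exact h1 t ht x

end Dom

/-- Differentiation under the integral sign. -/
lemma integral_time_calculus {b : ℝ} {g : E3 → ℝ} (hg : Integrable g) {q qt : ℝ → E3 → ℝ}
    (hq : ∀ t ∈ Icc 0 b, Continuous (q t)) (hqt : ∀ t ∈ Ioo 0 b, Continuous (qt t))
    (hqc : ∀ x, ContinuousOn (fun t => q t x) (Icc 0 b)) (h1 : Dom b g q) (h2 : Dom b g qt)
    (hd : ∀ t ∈ Ioo 0 b, ∀ x, HasDerivAt (fun τ => q τ x) (qt t x) t) :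
    ContinuousOn (fun t => ∫ x, q t x) (Icc 0 b) ∧ ∀ t ∈ Ioo 0 b, Integrable (qt t) ∧
      HasDerivAt (fun τ => ∫ x, q τ x) (∫ x, qt t x) t := by
  have hI := fun t ht => h1.integrable ht hg (hq t ht)
  obtain ⟨C, hC, h1⟩ := h1
  obtain ⟨C', hC', h2⟩ := h2
  refine ⟨?_, fun t ht => ?_⟩
  · exact continuousOn_of_dominated (fun t ht => (hq t ht).aestronglyMeasurable)
      (fun t ht => Eventually.of_forall fun x => h1 t ht x) (hg.const_mul C)
      (Eventually.of_forall fun x => hqc x)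
  · have hn : Ioo 0 b ∈ 𝓝 t := Ioo_mem_nhds ht.1 ht.2
    refine hasDerivAt_integral_of_dominated_loc_of_deriv_le hn ?_ (hI t (Ioo_subset_Icc_self ht))
      (hqt t ht).aestronglyMeasurable
      (Eventually.of_forall fun x s hs => h2 s (Ioo_subset_Icc_self hs) x) (hg.const_mul C')
      (Eventually.of_forall fun x s hs => hd s hs x)
    filter_upwards [hn] with s hs
    exact (hq s (Ioo_subset_Icc_self hs)).aestronglyMeasurable

/-- The divergence theorem for fields dominated by an integrable weight. -/
lemma integral_dv_eq_zero_of_dom {b t : ℝ} (ht : t ∈ Icc 0 b) {g : E3 → ℝ} (hg : Integrable g)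
    {Z : ℝ → E3 → E3} {DZ : ℝ → E3 → (E3 →L[ℝ] E3)} (hZ : ∀ x, HasFDerivAt (Z t) (DZ t x) x)
    (h1 : Dom b g Z) (h2 : Dom b g DZ) :
    Integrable (fun x => dv (DZ t x)) ∧ ∫ x, dv (DZ t x) = 0 := by
  have hDZ : DZ t = fderiv ℝ (Z t) := funext fun x => (hZ x).fderiv.symm
  have hcont : Continuous (Z t) :=
    continuous_iff_continuousAt.2 fun x => (hZ x).continuousAt
  refine integral_dv_eq_zero hZ (h1.integrable ht hg hcont) ?_
  obtain ⟨C, hC, h2⟩ := h2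
  refine (hg.const_mul C).mono' ?_ (Eventually.of_forall fun x => h2 t ht x)
  rw [hDZ]
  exact (measurable_fderiv ℝ (Z t)).aestronglyMeasurable

lemma IsC1Field.continuous {V : Type*} [NormedAddCommGroup V] [NormedSpace ℝ V]
    {T : EReal} {f ft : ℝ → E3 → V} {fx : ℝ → E3 → (E3 →L[ℝ] V)} (h : IsC1Field T f ft fx)
    {t : ℝ} (ht : t ∈ timeInterval T) :
    Continuous (f t) ∧ Continuous (ft t) ∧ Continuous (fx t) := by
  refine ⟨?_, ?_, ?_⟩
  · exact h.cont.comp_continuous (f := fun x => (t, x)) (by fun_prop) fun x => ⟨ht, mem_univ _⟩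
  · exact h.cont_time.comp_continuous (f := fun x => (t, x)) (by fun_prop) fun x => ⟨ht, mem_univ _⟩
  · exact h.cont_space.comp_continuous (f := fun x => (t, x)) (by fun_prop)
      fun x => ⟨ht, mem_univ _⟩

lemma IsC1Field.continuousOn_time {V : Type*} [NormedAddCommGroup V] [NormedSpace ℝ V]
    {T : EReal} {f ft : ℝ → E3 → V} {fx : ℝ → E3 → (E3 →L[ℝ] V)} (h : IsC1Field T f ft fx)
    (x : E3) : ContinuousOn (fun t => f t x) (timeInterval T) :=
  h.cont.comp (f := fun t => (t, x)) (by fun_prop) fun t ht => ⟨ht, mem_univ _⟩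

/-! ### Relative energy of two solutions with the same data -/

section Energy

variable {κ : ℝ} {T : EReal} {c ct c2 c2t : ℝ → E3 → ℝ} {cx c2x : ℝ → E3 → (E3 →L[ℝ] ℝ)}
  {u ut u2 u2t : ℝ → E3 → E3} {ux u2x : ℝ → E3 → (E3 →L[ℝ] E3)}

/-- The relative energy density of two solutions. -/
def relEnergy (κ : ℝ) (c c2 : ℝ → E3 → ℝ) (u u2 : ℝ → E3 → E3) (t : ℝ) (x : E3) : ℝ :=
  κ⁻¹ ^ 2 * (c t x - c2 t x) ^ 2 + ‖u t x - u2 t x‖ ^ 2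

/-- `energy_pointwise` integrated over space, where the divergence drops out, followed by Gronwall
from zero initial energy. Two solutions may differ only through the defect `D`, which measures the
region where the first is fluid and the second is vacuum. -/
lemma energy_le (hκ : 0 < κ) {M b : ℝ} (hM : 1 ≤ M) (hb : b ∈ timeInterval T)
    (h : IsClassicalSolution κ T c ct cx u ut ux)
    (h2 : IsClassicalSolution κ T c2 c2t c2x u2 u2t u2x)
    (bc : ∀ t ∈ Icc 0 b, ∀ x, ‖c t x‖ ≤ M ∧ ‖ct t x‖ ≤ M ∧ ‖cx t x‖ ≤ M)
    (bu : ∀ t ∈ Icc 0 b, ∀ x, ‖u t x‖ ≤ M ∧ ‖ut t x‖ ≤ M ∧ ‖ux t x‖ ≤ M)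
    (bc2 : ∀ t ∈ Icc 0 b, ∀ x, ‖c2 t x‖ ≤ M ∧ ‖c2t t x‖ ≤ M ∧ ‖c2x t x‖ ≤ M)
    (bu2 : ∀ t ∈ Icc 0 b, ∀ x, ‖u2 t x‖ ≤ M ∧ ‖u2t t x‖ ≤ M ∧ ‖u2x t x‖ ≤ M)
    (hinit : ∀ x, c 0 x = c2 0 x ∧ u 0 x = u2 0 x) {D : ℝ} (hD : 0 ≤ D)
    (hB : ∀ t ∈ Icc 0 b, ∀ x, 0 < c t x → c2 t x = 0 →
      2 * c t x ^ 2 * (‖u t x - u2 t x‖ * ‖u2t t x + u2x t x (u2 t x)‖) ≤ D * (1 + ‖x‖) ^ 3) :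
    ∀ t ∈ Icc 0 b, Integrable (fun x => decay x * (c t x ^ 2 * relEnergy κ c c2 u u2 t x)) ∧
      ∫ x, decay x * (c t x ^ 2 * relEnergy κ c c2 u u2 t x)
      ≤ D * (∫ x : E3, (1 + ‖x‖) ^ 3 * decay x) * Real.exp (energyRate κ M * b) := by
  have hsub := Icc_subset_timeInterval hb
  have hd0 : ∀ x : E3, 0 ≤ decay x := fun x => (decay_pos x).le
  have Dc : Dom b (fun _ => 1) c := Dom.of_bound fun t ht x => (bc t ht x).1
  have Dct : Dom b (fun _ => 1) ct := Dom.of_bound fun t ht x => (bc t ht x).2.1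
  have Dcx : Dom b (fun _ => 1) cx := Dom.of_bound fun t ht x => (bc t ht x).2.2
  have Du : Dom b (fun _ => 1) u := Dom.of_bound fun t ht x => (bu t ht x).1
  have Dut : Dom b (fun _ => 1) ut := Dom.of_bound fun t ht x => (bu t ht x).2.1
  have Dux : Dom b (fun _ => 1) ux := Dom.of_bound fun t ht x => (bu t ht x).2.2
  have Dc2 : Dom b (fun _ => 1) c2 := Dom.of_bound fun t ht x => (bc2 t ht x).1
  have Dc2t : Dom b (fun _ => 1) c2t := Dom.of_bound fun t ht x => (bc2 t ht x).2.1
  have Dc2x : Dom b (fun _ => 1) c2x := Dom.of_bound fun t ht x => (bc2 t ht x).2.2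
  have Du2 : Dom b (fun _ => 1) u2 := Dom.of_bound fun t ht x => (bu2 t ht x).1
  have Du2t : Dom b (fun _ => 1) u2t := Dom.of_bound fun t ht x => (bu2 t ht x).2.1
  have Du2x : Dom b (fun _ => 1) u2x := Dom.of_bound fun t ht x => (bu2 t ht x).2.2
  have Dψ : Dom b decay (fun _ x => decay x) :=
    Dom.weight (C := 1) zero_le_one fun x => by
      rw [one_mul, Real.norm_of_nonneg (hd0 x)]
  have Dψx : Dom b decay (fun _ x => decayDeriv x) :=
    Dom.weight (C := 8) (by norm_num) norm_decayDeriv_le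
  have Dd := Dc.sub Dc2
  have DV := Du.sub Du2
  have De : Dom b (fun _ => 1) (relEnergy κ c c2 u u2) :=
    ((Dom.pow_bdd Dd 2).const_mul (κ⁻¹ ^ 2)).add DV.norm_sq
  set q : ℝ → E3 → ℝ := fun t x => decay x * (c t x ^ 2 * relEnergy κ c c2 u u2 t x) with hq
  set et : ℝ → E3 → ℝ := fun t x => 2 * κ⁻¹ ^ 2 * ((c t x - c2 t x) * (ct t x - c2t t x))
      + 2 * inner ℝ (u t x - u2 t x) (ut t x - u2t t x) with het
  set ex : ℝ → E3 → (E3 →L[ℝ] ℝ) := fun t x =>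
      (2 * κ⁻¹ ^ 2 * (c t x - c2 t x)) • (cx t x - c2x t x)
      + (2 : ℝ) • (innerSL ℝ (u t x - u2 t x)).comp (ux t x - u2x t x) with hex
  have Det : Dom b (fun _ => 1) et :=
    ((Dom.mul_bdd Dd (Dct.sub Dc2t)).const_mul _).add
      ((Dom.inner_bdd DV (Dut.sub Du2t)).const_mul 2)
  have h1 : ∀ x : E3, (0 : ℝ) ≤ (fun _ => 1 : E3 → ℝ) x := fun _ => zero_le_one
  have Dex : Dom b (fun _ => 1) ex :=
    (Dom.smul_bdd (Dd.const_mul _) (Dcx.sub Dc2x)).add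
      (Dom.smul_bdd (Dom.const 2) (Dom.comp_clm h1 DV.innerSL (Dux.sub Du2x)))
  set qt : ℝ → E3 → ℝ := fun t x => decay x *
    (2 * (c t x * ct t x) * relEnergy κ c c2 u u2 t x + c t x ^ 2 * et t x) with hqt
  have Dq : Dom b decay q := Dψ.mul hd0 ((Dc.pow_bdd 2).mul_bdd De)
  have Dqt : Dom b decay qt :=
    Dψ.mul hd0 ((((Dc.mul_bdd Dct).const_mul 2).mul_bdd De).add ((Dc.pow_bdd 2).mul_bdd Det))
  have hcd := continuous_decay
  have cont := fun t (ht : t ∈ Icc 0 b) =>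
    (⟨h.sound_field.continuous (hsub ht), h.velocity_field.continuous (hsub ht),
      h2.sound_field.continuous (hsub ht), h2.velocity_field.continuous (hsub ht)⟩ :
      (Continuous (c t) ∧ Continuous (ct t) ∧ Continuous (cx t)) ∧
      (Continuous (u t) ∧ Continuous (ut t) ∧ Continuous (ux t)) ∧
      (Continuous (c2 t) ∧ Continuous (c2t t) ∧ Continuous (c2x t)) ∧
      (Continuous (u2 t) ∧ Continuous (u2t t) ∧ Continuous (u2x t)))
  have hcq : ∀ t ∈ Icc 0 b, Continuous (q t) := by
    intro t ht
    obtain ⟨⟨_, _, _⟩, ⟨_, _, _⟩, ⟨_, _, _⟩, ⟨_, _, _⟩⟩ := cont t ht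
    simp only [hq, relEnergy]
    fun_prop
  have hcqt : ∀ t ∈ Ioo 0 b, Continuous (qt t) := by
    intro t ht
    obtain ⟨⟨_, _, _⟩, ⟨_, _, _⟩, ⟨_, _, _⟩, ⟨_, _, _⟩⟩ := cont t (Ioo_subset_Icc_self ht)
    simp only [hqt, relEnergy, het]
    fun_prop
  have hqc : ∀ x, ContinuousOn (fun t => q t x) (Icc 0 b) := by
    intro x
    have a1 := (h.sound_field.continuousOn_time x).mono hsub
    have a2 := (h2.sound_field.continuousOn_time x).mono hsub
    have a3 := (h.velocity_field.continuousOn_time x).mono hsub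
    have a4 := (h2.velocity_field.continuousOn_time x).mono hsub
    simp only [hq, relEnergy]
    fun_prop
  have hder : ∀ t ∈ Ioo 0 b, ∀ x, HasDerivAt (fun τ => q τ x) (qt t x) t := by
    intro t ht x
    have htT := hsub (Ioo_subset_Icc_self ht)
    have a1 := h.sound_field.deriv_time t htT ht.1 x
    have a2 := h2.sound_field.deriv_time t htT ht.1 x
    have a3 := h.velocity_field.deriv_time t htT ht.1 x
    have a4 := h2.velocity_field.deriv_time t htT ht.1 x
    have := ((a1.pow 2).mul ((((a1.sub a2).pow 2).const_mul (κ⁻¹ ^ 2)).add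
      (a3.sub a4).norm_sq)).const_mul (decay x)
    convert! this using 1
    simp only [hqt, het, relEnergy]
    simp
    left
    ring
  obtain ⟨hE, hE'⟩ := integral_time_calculus integrable_decay hcq hcqt hqc Dq Dqt hder
  set qx : ℝ → E3 → (E3 →L[ℝ] ℝ) := fun t x =>
    (decay x * (c t x ^ 2)) • ex t x + (relEnergy κ c c2 u u2 t x) •
      (decay x • (2 * c t x) • cx t x + (c t x ^ 2) • decayDeriv x) with hqx
  set r : ℝ → E3 → ℝ := fun t x => decay x * (c t x ^ 3 * (c t x - c2 t x)) with hr
  set rx : ℝ → E3 → (E3 →L[ℝ] ℝ) := fun t x =>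
    (decay x * c t x ^ 3) • (cx t x - c2x t x) + (c t x - c2 t x) •
      (decay x • (3 * c t x ^ 2) • cx t x + (c t x ^ 3) • decayDeriv x) with hrx
  have dex : ∀ t ∈ Icc 0 b, ∀ x, HasFDerivAt (relEnergy κ c c2 u u2 t) (ex t x) x := by
    intro t ht x
    have a1 := h.sound_field.deriv_space t (hsub ht) x
    have a2 := h2.sound_field.deriv_space t (hsub ht) x
    have a3 := h.velocity_field.deriv_space t (hsub ht) x
    have a4 := h2.velocity_field.deriv_space t (hsub ht) x
    have := (((a1.sub a2).pow 2).const_mul (κ⁻¹ ^ 2)).add (a3.sub a4).norm_sq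
    convert! this using 1
    ext v
    simp [hex]
    ring
  have dpow : ∀ n : ℕ, ∀ t ∈ Icc 0 b, ∀ x, HasFDerivAt (fun x => decay x * c t x ^ (n + 1))
      (decay x • ((n + 1 : ℕ) * c t x ^ n) • cx t x + (c t x ^ (n + 1)) • decayDeriv x) x := by
    intro n t ht x
    have a1 := h.sound_field.deriv_space t (hsub ht) x
    have := (hasFDerivAt_decay x).mul (a1.pow (n + 1))
    convert! this using 1
    ext v
    simp
  have dqx : ∀ t ∈ Icc 0 b, ∀ x, HasFDerivAt (q t) (qx t x) x := by
    intro t ht x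
    have := (dpow 1 t ht x).mul (dex t ht x)
    convert! this using 1
    · ext y; simp only [hq, Pi.mul_apply]; ring
    · ext v; simp [hqx]
  have drx : ∀ t ∈ Icc 0 b, ∀ x, HasFDerivAt (r t) (rx t x) x := by
    intro t ht x
    have a1 := h.sound_field.deriv_space t (hsub ht) x
    have a2 := h2.sound_field.deriv_space t (hsub ht) x
    have := (dpow 2 t ht x).mul (a1.sub a2)
    convert! this using 1
    ext y; simp only [hr, Pi.mul_apply, Pi.sub_apply]; ring
  have Dqx : Dom b decay qx :=
    ((Dψ.mul hd0 (Dc.pow_bdd 2)).smul hd0 Dex).add (De.smul' hd0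
      ((Dψ.smul hd0 ((Dc.const_mul 2).smul_bdd Dcx)).add ((Dc.pow_bdd 2).smul' hd0 Dψx)))
  have Dr : Dom b decay r := Dψ.mul hd0 ((Dc.pow_bdd 3).mul_bdd Dd)
  have Drx : Dom b decay rx :=
    ((Dψ.mul hd0 (Dc.pow_bdd 3)).smul hd0 (Dcx.sub Dc2x)).add (Dd.smul' hd0
      ((Dψ.smul hd0 (((Dc.pow_bdd 2).const_mul 3).smul_bdd Dcx)).add
        ((Dc.pow_bdd 3).smul' hd0 Dψx)))
  -- The energy flux: transport by `u`, plus the acoustic flux `2κ⁻¹ ψ c³ (c-c₂)(u-u₂)`, which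
  -- cancels the derivatives of the differences.
  set Z : ℝ → E3 → E3 := fun t x => q t x • u t x + (2 * κ⁻¹ * r t x) • (u t x - u2 t x) with hZ
  set DZ : ℝ → E3 → (E3 →L[ℝ] E3) := fun t x =>
    (q t x • ux t x + (qx t x).smulRight (u t x)) + ((2 * κ⁻¹ * r t x) • (ux t x - u2x t x)
      + ((2 * κ⁻¹) • rx t x).smulRight (u t x - u2 t x)) with hDZ
  have dZ : ∀ t ∈ Icc 0 b, ∀ x, HasFDerivAt (Z t) (DZ t x) x := by
    intro t ht x
    have a3 := h.velocity_field.deriv_space t (hsub ht) x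
    have a4 := h2.velocity_field.deriv_space t (hsub ht) x
    exact ((dqx t ht x).smul a3).add (((drx t ht x).const_mul (2 * κ⁻¹)).smul (a3.sub a4))
  have DomZ : Dom b decay Z := (Dq.smul hd0 Du).add ((Dr.const_mul _).smul hd0 DV)
  have DomDZ : Dom b decay DZ :=
    ((Dq.smul hd0 Dux).add (Dqx.smulRight hd0 Du)).add
      (((Dr.const_mul _).smul hd0 (Dux.sub Du2x)).add
        ((Dom.smul' hd0 (Dom.const (2 * κ⁻¹)) Drx).smulRight hd0 DV))
  have hdiff : ∀ t ∈ Ioo 0 b, ∫ x, qt t x ≤ energyRate κ M *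
      ((∫ x, q t x) + D * ∫ x : E3, (1 + ‖x‖) ^ 3 * decay x) := by
    intro t ht
    have htI := Ioo_subset_Icc_self ht
    have htT := hsub htI
    obtain ⟨i1, i2⟩ := integral_dv_eq_zero_of_dom htI integrable_decay (dZ t htI) DomZ DomDZ
    have iq := Dq.integrable htI integrable_decay (hcq t htI)
    have hK := energyRate_pos hκ hM
    have hpt : ∀ x, qt t x + dv (DZ t x) ≤
        energyRate κ M * q t x + D * ((1 + ‖x‖) ^ 3 * decay x) := by
      intro x
      have := energy_pointwise hκ hM (hd0 x) (by positivity : 0 ≤ D * (1 + ‖x‖) ^ 3)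
        (h.nonneg t htT x) (h2.nonneg t htT x) (h.sound t htT ht.1 x) (h2.sound t htT ht.1 x)
        (h.velocity t htT ht.1 x) (h2.velocity t htT ht.1 x) ((le_abs_self _).trans (bc t htI x).1)
        (bu t htI x).1 (bc t htI x).2.2 (bc2 t htI x).2.2 (bu t htI x).2.2 (bu2 t htI x).2.2
        (abs_decayDeriv_le x) (hB t htI x)
      simp only [hDZ, dv_add, dv_sub, dv_smul, dv_smulRight]
      simp only [hqt, hqx, hrx, hex, het, hq, hr, relEnergy, add_apply, smul_apply, sub_apply,
        smul_eq_mul, ContinuousLinearMap.comp_apply, innerSL_apply_apply]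
      linarith only [this]
    have iB : Integrable fun x : E3 => D * ((1 + ‖x‖) ^ 3 * decay x) :=
      integrable_decay_mul.const_mul D
    have hint := integral_mono ((hE' t ht).1.add i1) ((iq.const_mul (energyRate κ M)).add iB) hpt
    simp only [Pi.add_apply] at hint
    rw [integral_add (hE' t ht).1 i1, i2, add_zero, integral_add (iq.const_mul _) iB,
      integral_const_mul, integral_const_mul] at hint
    refine hint.trans ?_
    have hI0 : 0 ≤ ∫ x : E3, (1 + ‖x‖) ^ 3 * decay x :=
      integral_nonneg fun x => mul_nonneg (by positivity) (hd0 x)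
    rw [mul_add]
    exact add_le_add_right (le_mul_of_one_le_left (mul_nonneg hD hI0) hK) _
  intro t ht
  refine ⟨Dq.integrable ht integrable_decay (hcq t ht), ?_⟩
  have hI0 : 0 ≤ ∫ x : E3, (1 + ‖x‖) ^ 3 * decay x :=
      integral_nonneg fun x => mul_nonneg (by positivity) (hd0 x)
  have hgr := gronwall_le hE (fun s hs => (hE' s hs).2) hdiff (by
    refine integral_eq_zero_of_ae (Eventually.of_forall fun x => ?_)
    simp [hq, relEnergy, (hinit x).1, (hinit x).2]) ht
  have hexp : Real.exp (energyRate κ M * t) ≤ Real.exp (energyRate κ M * b) := by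
    have := energyRate_pos hκ hM
    gcongr
    exact ht.2
  have h0 : 0 ≤ D * ∫ x : E3, (1 + ‖x‖) ^ 3 * decay x := by positivity
  calc ∫ x, q t x ≤ (∫ x, q t x) + D * ∫ x : E3, (1 + ‖x‖) ^ 3 * decay x := by linarith
    _ ≤ _ := hgr
    _ ≤ _ := by gcongr

end Energy

/-! ### Rotations -/

lemma IsC1Field.comp_isometry {V : Type*} [NormedAddCommGroup V] [NormedSpace ℝ V]
    {T : EReal} {f ft : ℝ → E3 → V} {fx : ℝ → E3 → (E3 →L[ℝ] V)} (h : IsC1Field T f ft fx)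
    (R : E3 ≃ₗᵢ[ℝ] E3) :
    IsC1Field T (fun t x => f t (R x)) (fun t x => ft t (R x))
      (fun t x => (fx t (R x)).comp (R.toContinuousLinearEquiv : E3 →L[ℝ] E3)) := by
  have hmap : MapsTo (fun z : ℝ × E3 => (z.1, R z.2)) (timeInterval T ×ˢ univ)
      (timeInterval T ×ˢ univ) := fun z hz => ⟨hz.1, mem_univ _⟩
  have hcont : ContinuousOn (fun z : ℝ × E3 => (z.1, R z.2)) (timeInterval T ×ˢ univ) := by
    fun_prop
  refine ⟨fun t ht h0 x => h.deriv_time t ht h0 (R x), fun t ht x => ?_, h.cont.comp hcont hmap,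
    h.cont_time.comp hcont hmap, (h.cont_space.comp hcont hmap).clm_comp continuousOn_const,
    fun T' hT' => ?_⟩
  · exact (h.deriv_space t ht (R x)).comp x
      (R.toContinuousLinearEquiv : E3 →L[ℝ] E3).hasFDerivAt
  · obtain ⟨M, hM⟩ := h.bound T' hT'
    refine ⟨M, fun t ht x => ⟨(hM t ht _).1, (hM t ht _).2.1, ?_⟩⟩
    refine (ContinuousLinearMap.opNorm_comp_le _ _).trans ?_
    calc _ ≤ ‖fx t (R x)‖ * 1 := by
          gcongr
          exact R.toLinearIsometry.norm_toContinuousLinearMap_le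
      _ ≤ M := by rw [mul_one]; exact (hM t ht _).2.2

lemma IsC1Field.clm_comp {V W : Type*} [NormedAddCommGroup V] [NormedSpace ℝ V]
    [NormedAddCommGroup W] [NormedSpace ℝ W]
    {T : EReal} {f ft : ℝ → E3 → V} {fx : ℝ → E3 → (E3 →L[ℝ] V)} (h : IsC1Field T f ft fx)
    (A : V →L[ℝ] W) :
    IsC1Field T (fun t x => A (f t x)) (fun t x => A (ft t x)) (fun t x => A.comp (fx t x)) := by
  refine ⟨fun t ht h0 x => A.hasFDerivAt.comp_hasDerivAt t (h.deriv_time t ht h0 x),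
    fun t ht x => A.hasFDerivAt.comp x (h.deriv_space t ht x),
    A.continuous.comp_continuousOn h.cont, A.continuous.comp_continuousOn h.cont_time,
    continuousOn_const.clm_comp h.cont_space, fun T' hT' => ?_⟩
  obtain ⟨M, hM⟩ := h.bound T' hT'
  refine ⟨‖A‖ * M, fun t ht x => ⟨?_, ?_, ?_⟩⟩
  · exact (A.le_opNorm _).trans (by gcongr; exact (hM t ht x).1)
  · exact (A.le_opNorm _).trans (by gcongr; exact (hM t ht x).2.1)
  · exact (A.opNorm_comp_le _).trans (by gcongr; exact (hM t ht x).2.2)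

section Rotation

variable {κ : ℝ} {T : EReal} {c ct : ℝ → E3 → ℝ} {cx : ℝ → E3 → (E3 →L[ℝ] ℝ)}
  {u ut : ℝ → E3 → E3} {ux : ℝ → E3 → (E3 →L[ℝ] E3)}

/-- The rotated solution. -/
lemma IsClassicalSolution.rotate (h : IsClassicalSolution κ T c ct cx u ut ux)
    (R : E3 ≃ₗᵢ[ℝ] E3) :
    IsClassicalSolution κ T (fun t x => c t (R x)) (fun t x => ct t (R x))
      (fun t x => (cx t (R x)).comp (R.toContinuousLinearEquiv : E3 →L[ℝ] E3))
      (fun t x => R.symm (u t (R x))) (fun t x => R.symm (ut t (R x)))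
      (fun t x => (R.symm.toContinuousLinearEquiv : E3 →L[ℝ] E3) ∘L (ux t (R x)) ∘L
        (R.toContinuousLinearEquiv : E3 →L[ℝ] E3)) := by
  refine ⟨h.sound_field.comp_isometry R, (h.velocity_field.comp_isometry R).clm_comp
    (R.symm.toContinuousLinearEquiv : E3 →L[ℝ] E3), fun t ht x => h.nonneg t ht (R x), ?_, ?_⟩
  · intro t ht h0 x
    rw [dv_conj]
    simpa using h.sound t ht h0 (R x)
  · intro t ht h0 x hx v
    have := h.velocity t ht h0 (R x) hx (R v)
    rw [← this]
    congr 1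
    rw [← R.symm.inner_map_map (ut t (R x) + ux t (R x) (u t (R x))) (R v)]
    simp

/-- A `C¹` function with bounded derivative is Lipschitz. -/
lemma norm_sub_le_of_hasFDerivAt {V : Type*} [NormedAddCommGroup V] [NormedSpace ℝ V]
    {f : E3 → V} {f' : E3 → (E3 →L[ℝ] V)} {M : ℝ} (hf : ∀ x, HasFDerivAt f (f' x) x)
    (hM : ∀ x, ‖f' x‖ ≤ M) (x y : E3) : ‖f x - f y‖ ≤ M * ‖x - y‖ :=
  convex_univ.norm_image_sub_le_of_norm_hasFDerivWithin_le
    (fun z _ => (hf z).hasFDerivWithinAt) (fun z _ => hM z) (mem_univ y) (mem_univ x)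

/-- A solution with radial data stays close to its small rotations. -/
lemma rotated_energy_le (hκ : 0 < κ) (h : IsClassicalSolution κ T c ct cx u ut ux) {b : ℝ}
    (hb : b ∈ timeInterval T)
    (hinit : ∀ (R : E3 ≃ₗᵢ[ℝ] E3) x, c 0 (R x) = c 0 x ∧ u 0 (R x) = R (u 0 x)) :
    ∃ C : ℝ, ∀ (R : E3 ≃ₗᵢ[ℝ] E3) (ε : ℝ), 0 ≤ ε → (∀ x, ‖R x - x‖ ≤ ε * ‖x‖) →
      ∀ t ∈ Icc 0 b, Integrable (fun x => decay x * (c t x ^ 2 *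
        relEnergy κ c (fun t x => c t (R x)) u (fun t x => R.symm (u t (R x))) t x)) ∧
      ∫ x, decay x * (c t x ^ 2 * relEnergy κ c (fun t x => c t (R x))
        u (fun t x => R.symm (u t (R x))) t x) ≤ C * ε ^ 3 := by
  obtain ⟨M1, hM1⟩ := h.sound_field.bound b hb
  obtain ⟨M2, hM2⟩ := h.velocity_field.bound b hb
  set M := max 1 (max M1 M2) with hMdef
  have hM : 1 ≤ M := le_max_left _ _
  have hM0 : 0 ≤ M := zero_le_one.trans hM
  have l1 : M1 ≤ M := (le_max_left _ _).trans (le_max_right _ _)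
  have l2 : M2 ≤ M := (le_max_right _ _).trans (le_max_right _ _)
  have bc : ∀ t ∈ Icc 0 b, ∀ x, ‖c t x‖ ≤ M ∧ ‖ct t x‖ ≤ M ∧ ‖cx t x‖ ≤ M := fun t ht x =>
    ⟨(hM1 t ht x).1.trans l1, (hM1 t ht x).2.1.trans l1, (hM1 t ht x).2.2.trans l1⟩
  have bu : ∀ t ∈ Icc 0 b, ∀ x, ‖u t x‖ ≤ M ∧ ‖ut t x‖ ≤ M ∧ ‖ux t x‖ ≤ M := fun t ht x =>
    ⟨(hM2 t ht x).1.trans l2, (hM2 t ht x).2.1.trans l2, (hM2 t ht x).2.2.trans l2⟩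
  -- The factor `4M⁵` collects `2(Mε|x|)²` from the squared sound speed, `Mε(1+|x|)` from the
  -- velocity difference and `2M²` from the acceleration.
  refine ⟨4 * M ^ 5 * (∫ x : E3, (1 + ‖x‖) ^ 3 * decay x) * Real.exp (energyRate κ M * b),
    fun R ε hε hR t ht => ?_⟩
  have nR : ‖(R.toContinuousLinearEquiv : E3 →L[ℝ] E3)‖ ≤ 1 :=
    R.toLinearIsometry.norm_toContinuousLinearMap_le
  have nR' : ‖(R.symm.toContinuousLinearEquiv : E3 →L[ℝ] E3)‖ ≤ 1 :=
    R.symm.toLinearIsometry.norm_toContinuousLinearMap_le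
  have ncomp : ∀ {V : Type} [NormedAddCommGroup V] [NormedSpace ℝ V] (L : E3 →L[ℝ] V), ‖L‖ ≤ M →
      ‖L.comp (R.toContinuousLinearEquiv : E3 →L[ℝ] E3)‖ ≤ M := fun L hL =>
    (L.opNorm_comp_le _).trans ((mul_le_mul hL nR (norm_nonneg _) hM0).trans (mul_one M).le)
  have hsub := Icc_subset_timeInterval hb
  have bc2 : ∀ t ∈ Icc 0 b, ∀ x, ‖c t (R x)‖ ≤ M ∧ ‖ct t (R x)‖ ≤ M ∧
      ‖(cx t (R x)).comp (R.toContinuousLinearEquiv : E3 →L[ℝ] E3)‖ ≤ M := fun t ht x =>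
    ⟨(bc t ht _).1, (bc t ht _).2.1, ncomp _ (bc t ht _).2.2⟩
  have bu2 : ∀ t ∈ Icc 0 b, ∀ x, ‖R.symm (u t (R x))‖ ≤ M ∧ ‖R.symm (ut t (R x))‖ ≤ M ∧
      ‖(R.symm.toContinuousLinearEquiv : E3 →L[ℝ] E3) ∘L (ux t (R x)) ∘L
        (R.toContinuousLinearEquiv : E3 →L[ℝ] E3)‖ ≤ M := fun t ht x => by
    refine ⟨?_, ?_, ?_⟩
    · rw [R.symm.norm_map]; exact (bu t ht _).1
    · rw [R.symm.norm_map]; exact (bu t ht _).2.1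
    · refine (ContinuousLinearMap.opNorm_comp_le _ _).trans ?_
      exact (mul_le_mul nR' (ncomp _ (bu t ht _).2.2) (norm_nonneg _) zero_le_one).trans
        (one_mul M).le
  have key := energy_le hκ hM hb h (h.rotate R) bc bu bc2 bu2 (fun x => by
      have := hinit R x
      simp [this.1, this.2]) (D := 4 * M ^ 5 * ε ^ 3) (by positivity) ?_ t ht
  · refine ⟨key.1, key.2.trans (le_of_eq (by ring))⟩
  intro s hs x hcpos hc2
  -- Since `c` vanishes at `R x`, at distance at most `ε|x|`, the Lipschitz bound makes it small at
  -- `x`. Its square and the velocity difference together give `ε³`; the weight `c²` is what lifts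
  -- this above the critical order `ε²`.
  have e1 : c s x ≤ M * (ε * ‖x‖) := by
    have h1 := norm_sub_le_of_hasFDerivAt (h.sound_field.deriv_space s (hsub hs))
      (fun y => (bc s hs y).2.2) x (R x)
    rw [hc2, sub_zero, norm_sub_rev x] at h1
    exact (le_abs_self _).trans (h1.trans (by gcongr; exact hR x))
  have e2 : ‖u s x - R.symm (u s (R x))‖ ≤ M * ε * (1 + ‖x‖) := by
    have h1 := norm_sub_le_of_hasFDerivAt (h.velocity_field.deriv_space s (hsub hs))
      (fun y => (bu s hs y).2.2) x (R x)
    rw [norm_sub_rev x] at h1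
    have h2 : ‖u s (R x) - R.symm (u s (R x))‖ ≤ ε * M := by
      rw [← R.norm_map, map_sub, R.apply_symm_apply]
      exact (hR _).trans (by gcongr; exact (bu s hs _).1)
    calc ‖u s x - R.symm (u s (R x))‖
        = ‖(u s x - u s (R x)) + (u s (R x) - R.symm (u s (R x)))‖ := by congr 1; abel
      _ ≤ M * (ε * ‖x‖) + ε * M := norm_add_le_of_le (h1.trans (by gcongr; exact hR x)) h2
      _ = _ := by ring
  have e3 : ‖R.symm (ut s (R x)) + ((R.symm.toContinuousLinearEquiv : E3 →L[ℝ] E3) ∘L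
      (ux s (R x)) ∘L (R.toContinuousLinearEquiv : E3 →L[ℝ] E3)) (R.symm (u s (R x)))‖
      ≤ 2 * M ^ 2 := by
    obtain ⟨b1, b2, b3⟩ := bu2 s hs x
    refine (norm_add_le_of_le b2 ((ContinuousLinearMap.le_opNorm _ _).trans
      (mul_le_mul b3 b1 (norm_nonneg _) hM0))).trans ?_
    nlinarith
  have hx := norm_nonneg x
  calc 2 * c s x ^ 2 * (‖u s x - R.symm (u s (R x))‖ * _)
      ≤ 2 * (M * (ε * ‖x‖)) ^ 2 * ((M * ε * (1 + ‖x‖)) * (2 * M ^ 2)) := by gcongr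
    _ = 4 * M ^ 5 * ε ^ 3 * (‖x‖ ^ 2 * (1 + ‖x‖)) := by ring
    _ ≤ 4 * M ^ 5 * ε ^ 3 * (1 + ‖x‖) ^ 3 := by
        gcongr
        rw [pow_succ (1 + ‖x‖) 2]
        gcongr
        linarith

/-- The rotation by the angle `θ` in the plane of `p` and `q`. -/
def rotMap (p q : E3) (θ : ℝ) : E3 →ₗ[ℝ] E3 :=
  LinearMap.id + (Real.cos θ - 1) • ((innerₛₗ ℝ p).smulRight p + (innerₛₗ ℝ q).smulRight q)
    + Real.sin θ • ((innerₛₗ ℝ p).smulRight q - (innerₛₗ ℝ q).smulRight p)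

lemma rotMap_apply (p q : E3) (θ : ℝ) (x : E3) : rotMap p q θ x =
    x + (Real.cos θ - 1) • (inner ℝ p x • p + inner ℝ q x • q)
      + Real.sin θ • (inner ℝ p x • q - inner ℝ q x • p) := by
  simp [rotMap]

lemma norm_rotMap {p q : E3} (hp : ‖p‖ = 1) (hq : ‖q‖ = 1) (hpq : inner ℝ p q = 0) (θ : ℝ)
    (x : E3) : ‖rotMap p q θ x‖ = ‖x‖ := by
  rw [← sq_eq_sq₀ (norm_nonneg _) (norm_nonneg _), ← real_inner_self_eq_norm_sq,
    ← real_inner_self_eq_norm_sq, rotMap_apply]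
  have hpp : inner ℝ p p = 1 := by rw [real_inner_self_eq_norm_sq, hp]; norm_num
  have hqq : inner ℝ q q = 1 := by rw [real_inner_self_eq_norm_sq, hq]; norm_num
  have hqp : inner ℝ q p = 0 := by rw [real_inner_comm]; exact hpq
  have hxp : inner ℝ x p = inner ℝ p x := real_inner_comm _ _
  have hxq : inner ℝ x q = inner ℝ q x := real_inner_comm _ _
  simp only [inner_add_left, inner_add_right, inner_sub_left, inner_sub_right, real_inner_smul_left,
    real_inner_smul_right, hpp, hqq, hpq, hqp, hxp, hxq]
  have := Real.sin_sq_add_cos_sq θ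
  linear_combination (inner ℝ p x ^ 2 + inner ℝ q x ^ 2) * this

/-- `rotMap` as a linear isometry. -/
def rotIso {p q : E3} (hp : ‖p‖ = 1) (hq : ‖q‖ = 1) (hpq : inner ℝ p q = 0) (θ : ℝ) :
    E3 ≃ₗᵢ[ℝ] E3 :=
  LinearIsometry.toLinearIsometryEquiv ⟨rotMap p q θ, norm_rotMap hp hq hpq θ⟩ rfl

lemma norm_rotMap_sub_le {p q : E3} (hp : ‖p‖ = 1) (hq : ‖q‖ = 1) (θ : ℝ) (x : E3) :
    ‖rotMap p q θ x - x‖ ≤ 4 * |θ| * ‖x‖ := by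
  have hpx : |inner ℝ p x| ≤ ‖x‖ := by simpa [hp] using abs_real_inner_le_norm p x
  have hqx : |inner ℝ q x| ≤ ‖x‖ := by simpa [hq] using abs_real_inner_le_norm q x
  have h1 : ‖inner ℝ p x • p + inner ℝ q x • q‖ ≤ 2 * ‖x‖ := by
    refine (norm_add_le _ _).trans ?_
    rw [norm_smul, norm_smul, hp, hq, Real.norm_eq_abs, Real.norm_eq_abs]
    linarith
  have h2 : ‖inner ℝ p x • q - inner ℝ q x • p‖ ≤ 2 * ‖x‖ := by
    refine (norm_sub_le _ _).trans ?_
    rw [norm_smul, norm_smul, hp, hq, Real.norm_eq_abs, Real.norm_eq_abs]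
    linarith
  have h3 : |Real.sin θ| ≤ |θ| := Real.abs_sin_le_abs
  have h4 : |Real.cos θ - 1| ≤ |θ| := by
    simpa using Real.abs_cos_sub_cos_le θ 0
  rw [rotMap_apply, show x + (Real.cos θ - 1) • (inner ℝ p x • p + inner ℝ q x • q)
      + Real.sin θ • (inner ℝ p x • q - inner ℝ q x • p) - x
      = (Real.cos θ - 1) • (inner ℝ p x • p + inner ℝ q x • q)
      + Real.sin θ • (inner ℝ p x • q - inner ℝ q x • p) by abel]
  refine (norm_add_le _ _).trans ?_
  rw [norm_smul, norm_smul, Real.norm_eq_abs, Real.norm_eq_abs]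
  calc _ ≤ |θ| * (2 * ‖x‖) + |θ| * (2 * ‖x‖) := by gcongr
    _ = _ := by ring

lemma hasDerivAt_rotMap (p q x : E3) :
    HasDerivAt (fun θ => rotMap p q θ x) (inner ℝ p x • q - inner ℝ q x • p) 0 := by
  have h1 := ((Real.hasDerivAt_cos 0).sub_const 1).smul_const (inner ℝ p x • p + inner ℝ q x • q)
  have h2 := (Real.hasDerivAt_sin 0).smul_const (inner ℝ p x • q - inner ℝ q x • p)
  have h3 := (h1.const_add x).add h2
  convert! h3 using 1
  simp

end Rotation

/-! ### Radial velocity off vacuum and persistence of the central vacuum -/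

section Symmetry

variable {κ : ℝ} {T : EReal} {c ct : ℝ → E3 → ℝ} {cx : ℝ → E3 → (E3 →L[ℝ] ℝ)}
  {u ut : ℝ → E3 → E3} {ux : ℝ → E3 → (E3 →L[ℝ] E3)}

/-- The velocity of a solution with radial data is equivariant under infinitesimal rotations away
from the vacuum. -/
lemma IsClassicalSolution.deriv_rotation (hκ : 0 < κ) (h : IsClassicalSolution κ T c ct cx u ut ux)
    (hinit : ∀ (R : E3 ≃ₗᵢ[ℝ] E3) x, c 0 (R x) = c 0 x ∧ u 0 (R x) = R (u 0 x))
    {p q : E3} (hp : ‖p‖ = 1) (hq : ‖q‖ = 1) (hpq : inner ℝ p q = 0) {t : ℝ}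
    (ht : t ∈ timeInterval T) {x : E3} (hx : 0 < c t x) :
    ux t x (inner ℝ p x • q - inner ℝ q x • p) = inner ℝ p (u t x) • q - inner ℝ q (u t x) • p := by
  set J : E3 → E3 := fun x => inner ℝ p x • q - inner ℝ q x • p with hJ
  have hJc : Continuous J := by fun_prop
  obtain ⟨C, hC⟩ := rotated_energy_le hκ h ht hinit
  set θ : ℕ → ℝ := fun n => 1 / ((n : ℝ) + 1) with hθ
  have hθ0 : ∀ n, 0 < θ n := fun n => by positivity
  have hθt : Tendsto θ atTop (𝓝 0) := tendsto_one_div_add_atTop_nhds_zero_nat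
  have hθt' : Tendsto θ atTop (𝓝[≠] 0) :=
    tendsto_nhdsWithin_iff.2 ⟨hθt, Eventually.of_forall fun n => (hθ0 n).ne'⟩
  set R : ℕ → (E3 ≃ₗᵢ[ℝ] E3) := fun n => rotIso hp hq hpq (θ n) with hR
  have htI : t ∈ Icc 0 t := ⟨ht.1, le_rfl⟩
  have hcc := (h.sound_field.continuous ht).1
  have huc := (h.velocity_field.continuous ht).1
  have huxc := (h.velocity_field.continuous ht).2.2
  set φ : ℕ → E3 → ℝ := fun n x =>
    decay x * (c t x ^ 2 * ‖(θ n)⁻¹ • (R n (u t x) - u t (R n x))‖ ^ 2) with hφ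
  have hφ0 : ∀ n x, 0 ≤ φ n x := fun n x => by
    have := decay_pos x
    positivity
  have hφc : ∀ n, Continuous (φ n) := fun n => by
    have h1 : Continuous fun x => R n (u t x) - u t (R n x) :=
      ((R n).continuous.comp huc).sub (huc.comp (R n).continuous)
    have h2 : Continuous fun x => ‖(θ n)⁻¹ • (R n (u t x) - u t (R n x))‖ ^ 2 :=
      (h1.const_smul (θ n)⁻¹).norm.pow 2
    exact continuous_decay.mul ((hcc.pow 2).mul h2)
  have hφlim : ∀ x, Tendsto (fun n => φ n x) atTop
      (𝓝 (decay x * (c t x ^ 2 * ‖J (u t x) - ux t x (J x)‖ ^ 2))) := by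
    intro x
    have h0 : rotMap p q 0 x = x := by simp [rotMap_apply]
    have h0u : rotMap p q 0 (u t x) = u t x := by simp [rotMap_apply]
    have hd1 := hasDerivAt_rotMap p q (u t x)
    have hd2 : HasDerivAt (fun s => u t (rotMap p q s x)) (ux t x (J x)) 0 := by
      have := h.velocity_field.deriv_space t ht x
      rw [← h0] at this
      have h3 := this.comp_hasDerivAt (0 : ℝ) (hasDerivAt_rotMap p q x)
      rw [h0] at h3
      exact h3
    have h4 := ((hd1.sub hd2).tendsto_slope_zero).comp hθt'
    have h5 : Tendsto (fun n => (θ n)⁻¹ • (R n (u t x) - u t (R n x))) atTop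
        (𝓝 (J (u t x) - ux t x (J x))) := by
      refine h4.congr fun n => ?_
      simp only [Function.comp_apply, Pi.sub_apply, zero_add, h0, h0u, sub_self, sub_zero]
      rfl
    exact ((h5.norm.pow 2).const_mul _).const_mul _
  -- A rotation by `θ` displaces points by at most `4θ|x|`, so the energy is at most `C(4θ)³`; after
  -- division by `θ²` the bound `64Cθ` still tends to `0`.
  have hφint : ∀ n, ∫⁻ x, ENNReal.ofReal (φ n x) ≤ ENNReal.ofReal (C * 64 * θ n) := by
    intro n
    obtain ⟨hi, hle⟩ := hC (R n) (4 * θ n) (by have := hθ0 n; positivity)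
      (fun x => by
        have := norm_rotMap_sub_le hp hq (θ n) x
        rwa [abs_of_pos (hθ0 n)] at this) t htI
    have hpt : ∀ x, φ n x ≤ (θ n)⁻¹ ^ 2 * (decay x * (c t x ^ 2 *
        relEnergy κ c (fun t x => c t (R n x)) u (fun t x => (R n).symm (u t (R n x))) t x)) := by
      intro x
      have e : ‖R n (u t x) - u t (R n x)‖ = ‖u t x - (R n).symm (u t (R n x))‖ := by
        rw [← (R n).norm_map (u t x - (R n).symm (u t (R n x))), map_sub,
          LinearIsometryEquiv.apply_symm_apply]
      have hdx := decay_pos x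
      simp only [hφ, relEnergy, norm_smul, mul_pow, norm_inv, Real.norm_eq_abs, inv_pow, sq_abs]
      rw [e]
      have h6 : 0 ≤ (θ n ^ 2)⁻¹ * (decay x * (c t x ^ 2 *
        ((κ ^ 2)⁻¹ * (c t x - c t (R n x)) ^ 2))) := by positivity
      linarith
    calc ∫⁻ x, ENNReal.ofReal (φ n x) ≤ ∫⁻ x, ENNReal.ofReal ((θ n)⁻¹ ^ 2 * (decay x * (c t x ^ 2 *
          relEnergy κ c (fun t x => c t (R n x)) u (fun t x => (R n).symm (u t (R n x))) t x))) :=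
          lintegral_mono fun x => ENNReal.ofReal_le_ofReal (hpt x)
      _ = ENNReal.ofReal (∫ x, (θ n)⁻¹ ^ 2 * (decay x * (c t x ^ 2 *
          relEnergy κ c (fun t x => c t (R n x)) u (fun t x => (R n).symm (u t (R n x))) t x))) :=
          (ofReal_integral_eq_lintegral_ofReal (hi.const_mul _)
            (Eventually.of_forall fun x => (hφ0 n x).trans (hpt x))).symm
      _ ≤ ENNReal.ofReal (C * 64 * θ n) := by
          refine ENNReal.ofReal_le_ofReal ?_
          rw [integral_const_mul]
          have h7 := hθ0 n
          calc _ ≤ (θ n)⁻¹ ^ 2 * (C * (4 * θ n) ^ 3) := by gcongr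
            _ = C * 64 * θ n := by field_simp; ring
  -- Fatou's lemma passes from the difference quotients to the infinitesimal rotation; continuity
  -- then removes the null set.
  have hlim0 : ∫⁻ x, ENNReal.ofReal
      (decay x * (c t x ^ 2 * ‖J (u t x) - ux t x (J x)‖ ^ 2)) ≤ 0 := by
    calc _ = ∫⁻ x, liminf (fun n => ENNReal.ofReal (φ n x)) atTop := by
          refine lintegral_congr fun x => ?_
          exact ((ENNReal.continuous_ofReal.tendsto _).comp (hφlim x)).liminf_eq.symm
      _ ≤ liminf (fun n => ∫⁻ x, ENNReal.ofReal (φ n x)) atTop :=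
          lintegral_liminf_le fun n => (hφc n).measurable.ennreal_ofReal
      _ ≤ liminf (fun n => ENNReal.ofReal (C * 64 * θ n)) atTop :=
          liminf_le_liminf (Eventually.of_forall hφint)
      _ = 0 := by
          have h8 : Tendsto (fun n => ENNReal.ofReal (C * 64 * θ n)) atTop (𝓝 0) := by
            have := (ENNReal.continuous_ofReal.tendsto _).comp (hθt.const_mul (C * 64))
            simpa [Function.comp_def] using this
          exact h8.liminf_eq
  have hcont : Continuous fun x => decay x * (c t x ^ 2 * ‖J (u t x) - ux t x (J x)‖ ^ 2) :=
    continuous_decay.mul ((hcc.pow 2).mul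
      (((hJc.comp huc).sub (huxc.clm_apply hJc)).norm.pow 2))
  have hae := (lintegral_eq_zero_iff hcont.measurable.ennreal_ofReal).1 (le_antisymm hlim0 bot_le)
  have hzero : (fun x => decay x * (c t x ^ 2 * ‖J (u t x) - ux t x (J x)‖ ^ 2)) = fun _ => 0 := by
    refine (Continuous.ae_eq_iff_eq volume hcont continuous_const).1 ?_
    filter_upwards [hae] with y hy
    have hdy := decay_pos y
    exact le_antisymm (ENNReal.ofReal_eq_zero.1 hy) (by positivity)
  have h9 := congr_fun hzero x
  have hdx := decay_pos x
  simp only [mul_eq_zero, hdx.ne', pow_eq_zero_iff, ne_eq, OfNat.ofNat_ne_zero, not_false_eq_true,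
    hx.ne', false_or, norm_eq_zero] at h9
  exact (sub_eq_zero.1 h9).symm

/-- The velocity of a solution with radial data is radial away from the vacuum. -/
lemma IsClassicalSolution.coord_mul_comm (hκ : 0 < κ) (h : IsClassicalSolution κ T c ct cx u ut ux)
    (hinit : ∀ (R : E3 ≃ₗᵢ[ℝ] E3) x, c 0 (R x) = c 0 x ∧ u 0 (R x) = R (u 0 x))
    {t : ℝ} (ht : t ∈ timeInterval T) {x : E3} (hx : 0 < c t x) (i j : Fin 3) :
    x i * u t x j = x j * u t x i := by
  have key : ∀ i j : Fin 3, i ≠ j →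
      x i • ux t x (EuclideanSpace.single j 1) - x j • ux t x (EuclideanSpace.single i 1)
      = u t x i • EuclideanSpace.single j (1 : ℝ) - u t x j • EuclideanSpace.single i (1 : ℝ) := by
    intro i j hij
    have := h.deriv_rotation hκ hinit (p := EuclideanSpace.single i 1)
      (q := EuclideanSpace.single j 1) (by simp) (by simp)
      (by simp [EuclideanSpace.inner_single_left, hij]) ht hx
    simpa [EuclideanSpace.inner_single_left] using this
  set L := fun i : Fin 3 => ux t x (EuclideanSpace.single i 1)
  -- The `k`-th components of the three equivariance identities, weighted by `x k`, `x i`, `x j`,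
  -- have a sum in which every derivative of `u` cancels. What is left is one component of `x × u =
  -- 0`.
  have cyc : ∀ i j k : Fin 3, i ≠ j → j ≠ k → k ≠ i → x i * u t x j = x j * u t x i := by
    intro i j k hij hjk hki
    have e1 := congr_fun (congr_arg (fun v : E3 => (v : Fin 3 → ℝ)) (key i j hij)) k
    have e2 := congr_fun (congr_arg (fun v : E3 => (v : Fin 3 → ℝ)) (key j k hjk)) k
    have e3 := congr_fun (congr_arg (fun v : E3 => (v : Fin 3 → ℝ)) (key k i hki)) k
    simp [hki, hjk.symm] at e1 e2 e3
    linear_combination -x k * e1 - x i * e2 - x j * e3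
  have h01 := cyc 0 1 2 (by decide) (by decide) (by decide)
  have h12 := cyc 1 2 0 (by decide) (by decide) (by decide)
  have h20 := cyc 2 0 1 (by decide) (by decide) (by decide)
  fin_cases i <;> fin_cases j <;> simp <;> linarith

/-- By Lagrange's identity the two sides differ by `|x × u|²`. This form of collinearity needs no
division by `|x|` and is what the Hessian estimate consumes. -/
lemma IsClassicalSolution.inner_sq_eq (hκ : 0 < κ) (h : IsClassicalSolution κ T c ct cx u ut ux)
    (hinit : ∀ (R : E3 ≃ₗᵢ[ℝ] E3) x, c 0 (R x) = c 0 x ∧ u 0 (R x) = R (u 0 x))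
    {t : ℝ} (ht : t ∈ timeInterval T) {x : E3} (hx : 0 < c t x) :
    inner ℝ x (u t x) ^ 2 = ‖x‖ ^ 2 * ‖u t x‖ ^ 2 := by
  have h01 := h.coord_mul_comm hκ hinit ht hx 0 1
  have h12 := h.coord_mul_comm hκ hinit ht hx 1 2
  have h20 := h.coord_mul_comm hκ hinit ht hx 2 0
  simp only [EuclideanSpace.norm_sq_eq, PiLp.inner_apply, Fin.sum_univ_three, RCLike.inner_apply,
    conj_trivial, Real.norm_eq_abs, sq_abs]
  linear_combination (-(x 0 * u t x 1 - x 1 * u t x 0)) * h01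
    - (x 1 * u t x 2 - x 2 * u t x 1) * h12 - (x 2 * u t x 0 - x 0 * u t x 2) * h20

/-- The origin is fixed by every rotation, so infinitesimal equivariance there says that each
generator of rotations annihilates `u`. -/
lemma IsClassicalSolution.velocity_zero (hκ : 0 < κ) (h : IsClassicalSolution κ T c ct cx u ut ux)
    (hinit : ∀ (R : E3 ≃ₗᵢ[ℝ] E3) x, c 0 (R x) = c 0 x ∧ u 0 (R x) = R (u 0 x))
    {t : ℝ} (ht : t ∈ timeInterval T) (hx : 0 < c t 0) : u t 0 = 0 := by
  have key : ∀ i j : Fin 3, i ≠ j → u t 0 i = 0 := by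
    intro i j hij
    have := h.deriv_rotation hκ hinit (p := EuclideanSpace.single i 1)
      (q := EuclideanSpace.single j 1) (by simp) (by simp)
      (by simp [EuclideanSpace.inner_single_left, hij]) ht hx
    have e := congr_fun (congr_arg (fun v : E3 => (v : Fin 3 → ℝ)) this) j
    simpa [EuclideanSpace.inner_single_left, hij.symm] using e.symm
  ext i
  fin_cases i
  · exact key 0 1 (by decide)
  · exact key 1 2 (by decide)
  · exact key 2 0 (by decide)

/-- A vacuum at the centre of a solution with radial data persists. -/
lemma IsClassicalSolution.vacuum_persists (hκ : 0 < κ)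
    (h : IsClassicalSolution κ T c ct cx u ut ux)
    (hinit : ∀ (R : E3 ≃ₗᵢ[ℝ] E3) x, c 0 (R x) = c 0 x ∧ u 0 (R x) = R (u 0 x))
    (h0 : c 0 0 = 0) {t : ℝ} (ht : t ∈ timeInterval T) : c t 0 = 0 := by
  obtain ⟨M, hM⟩ := h.velocity_field.bound t ht
  have hsub := Icc_subset_timeInterval ht
  have hd : ∀ s ∈ Ioo 0 t, HasDerivAt (fun s => c s 0) (ct s 0) s := fun s hs =>
    h.sound_field.deriv_time s (hsub (Ioo_subset_Icc_self hs)) hs.1 0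
  have hle : ∀ s ∈ Ioo 0 t, ct s 0 ≤ 3 * κ * M * (c s 0 + 0) := by
    intro s hs
    have hsT := hsub (Ioo_subset_Icc_self hs)
    have hc0 := h.nonneg s hsT 0
    -- The convective term vanishes for one of two reasons: in vacuum the gradient is zero at a
    -- minimum, off vacuum the velocity is zero by symmetry. A linear ODE for `c` at the centre
    -- remains.
    have hcu : cx s 0 (u s 0) = 0 := by
      rcases hc0.eq_or_lt with h1 | h1
      · have hmin : IsLocalMin (c s) 0 := Eventually.of_forall fun y => by
          rw [← h1]; exact h.nonneg s hsT y
        rw [hmin.hasFDerivAt_eq_zero (h.sound_field.deriv_space s hsT 0)]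
        rfl
      · rw [h.velocity_zero hκ hinit hsT h1, map_zero]
    have he := h.sound s hsT hs.1 0
    rw [hcu, add_zero] at he
    have hdv : -dv (ux s 0) ≤ 3 * M := (neg_le_abs _).trans ((abs_dv_le _).trans (by
      have := (hM s (Ioo_subset_Icc_self hs) 0).2.2
      linarith))
    have hkc : 0 ≤ κ * c s 0 := by positivity
    nlinarith [mul_le_mul_of_nonneg_left hdv hkc]
  have := gronwall_le ((h.sound_field.continuousOn_time 0).mono hsub) hd hle h0
    (t := t) ⟨ht.1, le_rfl⟩
  exact le_antisymm (by linarith) (h.nonneg t ht 0)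

end Symmetry

/-! ### The weight `e^{-r}/r` and its regularizations -/

section Weight

lemma integrable_norm_rpow_mul_exp {a : ℝ} (ha : -3 < a) :
    Integrable fun x : E3 => ‖x‖ ^ a * Real.exp (-(‖x‖ / 2)) := by
  refine (integrable_fun_norm_addHaar (volume : Measure E3)
    (f := fun r => r ^ a * Real.exp (-(r / 2)))).2 ?_
  have h := integrableOn_rpow_mul_exp_neg_mul_rpow (s := a + 2) (p := 1) (b := 1 / 2)
    (by linarith) one_pos (by norm_num)
  refine h.congr_fun (fun r hr => ?_) measurableSet_Ioi
  have hr : 0 < r := hr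
  simp only [finrank_euclideanSpace, Fintype.card_fin, smul_eq_mul, Real.rpow_one]
  rw [Real.rpow_add hr, show (3 - 1 : ℕ) = 2 from rfl, Real.rpow_two]
  ring_nf

lemma integrable_exp_half : Integrable fun x : E3 => Real.exp (-(‖x‖ / 2)) := by
  simpa using integrable_norm_rpow_mul_exp (a := 0) (by norm_num)

lemma integrable_exp_half_div_sq :
    Integrable fun x : E3 => Real.exp (-(‖x‖ / 2)) / ‖x‖ ^ 2 := by
  refine (integrable_norm_rpow_mul_exp (a := -(2 : ℕ)) (by norm_num)).congr
    (Eventually.of_forall fun x => ?_)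
  change ‖x‖ ^ (-((2 : ℕ) : ℝ)) * Real.exp (-(‖x‖ / 2)) = _
  rw [Real.rpow_neg (norm_nonneg _), Real.rpow_natCast, ← div_eq_inv_mul]

/-- The regularized radius `√(|x|² + δ²)`. -/
def rad (δ : ℝ) (x : E3) : ℝ := √(‖x‖ ^ 2 + δ ^ 2)

/-- The weight `e^{-s}/s`, `s = rad δ x`. -/
def wt (δ : ℝ) (x : E3) : ℝ := Real.exp (-rad δ x) / rad δ x

/-- The gradient of `wt δ` is `-wtK δ x • x`. -/
def wtK (δ : ℝ) (x : E3) : ℝ := (1 + rad δ x) * Real.exp (-rad δ x) / rad δ x ^ 3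

/-- The gradient of `wtK δ` is `-wtQ δ x • x`. -/
def wtQ (δ : ℝ) (x : E3) : ℝ :=
  (rad δ x ^ 2 + 3 * rad δ x + 3) * Real.exp (-rad δ x) / rad δ x ^ 5

/-- The derivative of the field `-wtK δ x • x`. -/
def wtHess (δ : ℝ) (x : E3) : E3 →L[ℝ] E3 :=
  wtQ δ x • (innerSL ℝ x).smulRight x - wtK δ x • ContinuousLinearMap.id ℝ E3

lemma rad_sq (δ : ℝ) (x : E3) : rad δ x ^ 2 = ‖x‖ ^ 2 + δ ^ 2 := Real.sq_sqrt (by positivity)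

lemma rad_zero (x : E3) : rad 0 x = ‖x‖ := by simp [rad]

lemma rad_nonneg (δ : ℝ) (x : E3) : 0 ≤ rad δ x := Real.sqrt_nonneg _

lemma norm_le_rad (δ : ℝ) (x : E3) : ‖x‖ ≤ rad δ x :=
  Real.le_sqrt_of_sq_le (by nlinarith [sq_nonneg δ])

lemma le_rad (δ : ℝ) (x : E3) : δ ≤ rad δ x :=
  Real.le_sqrt_of_sq_le (by nlinarith [sq_nonneg ‖x‖])

lemma rad_pos {δ : ℝ} (hδ : 0 < δ) (x : E3) : 0 < rad δ x := hδ.trans_le (le_rad δ x)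

lemma rad_pos' (δ : ℝ) {x : E3} (hx : x ≠ 0) : 0 < rad δ x :=
  (norm_pos_iff.2 hx).trans_le (norm_le_rad δ x)

lemma continuous_rad (δ : ℝ) : Continuous (rad δ) := by unfold rad; fun_prop

lemma tendsto_rad {δ : ℕ → ℝ} (hδ : Tendsto δ atTop (𝓝 0)) (x : E3) :
    Tendsto (fun n => rad (δ n) x) atTop (𝓝 ‖x‖) := by
  have h : Continuous fun d : ℝ => rad d x := by unfold rad; fun_prop
  simpa [Function.comp_def, rad_zero] using (h.tendsto 0).comp hδ

lemma wt_nonneg (δ : ℝ) (x : E3) : 0 ≤ wt δ x := by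
  have := rad_nonneg δ x
  unfold wt; positivity

lemma wtK_nonneg (δ : ℝ) (x : E3) : 0 ≤ wtK δ x := by
  have := rad_nonneg δ x
  unfold wtK; positivity

lemma wtQ_nonneg (δ : ℝ) (x : E3) : 0 ≤ wtQ δ x := by
  have := rad_nonneg δ x
  unfold wtQ; positivity

lemma tendsto_wt {δ : ℕ → ℝ} (hδ : Tendsto δ atTop (𝓝 0)) {x : E3} (hx : x ≠ 0) :
    Tendsto (fun n => wt (δ n) x) atTop (𝓝 (wt 0 x)) := by
  have h := tendsto_rad hδ x
  rw [← rad_zero] at h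
  exact ((Real.continuous_exp.tendsto _).comp h.neg).div h (rad_pos' 0 hx).ne'

lemma tendsto_wtK {δ : ℕ → ℝ} (hδ : Tendsto δ atTop (𝓝 0)) {x : E3} (hx : x ≠ 0) :
    Tendsto (fun n => wtK (δ n) x) atTop (𝓝 (wtK 0 x)) := by
  have h := tendsto_rad hδ x
  rw [← rad_zero] at h
  exact ((h.const_add 1).mul ((Real.continuous_exp.tendsto _).comp h.neg)).div (h.pow 3)
    (pow_pos (rad_pos' 0 hx) 3).ne'

lemma tendsto_wtQ {δ : ℕ → ℝ} (hδ : Tendsto δ atTop (𝓝 0)) {x : E3} (hx : x ≠ 0) :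
    Tendsto (fun n => wtQ (δ n) x) atTop (𝓝 (wtQ 0 x)) := by
  have h := tendsto_rad hδ x
  rw [← rad_zero] at h
  exact ((((h.pow 2).add (h.const_mul 3)).add_const 3).mul
    ((Real.continuous_exp.tendsto _).comp h.neg)).div (h.pow 5) (pow_pos (rad_pos' 0 hx) 5).ne'

lemma measurable_rad (δ : ℝ) : Measurable (rad δ) := (continuous_rad δ).measurable

lemma measurable_wt (δ : ℝ) : Measurable (wt δ) := by
  have := measurable_rad δ
  unfold wt; fun_prop

lemma measurable_wtQ (δ : ℝ) : Measurable (wtQ δ) := by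
  have := measurable_rad δ
  unfold wtQ; fun_prop

section Bounds

lemma one_add_mul_exp_neg_le (s : ℝ) :
    (1 + s) * Real.exp (-s) ≤ 2 * Real.exp (-(s / 2)) := by
  have h : Real.exp (-s) = Real.exp (-(s / 2)) * Real.exp (-(s / 2)) := by
    rw [← Real.exp_add]; ring_nf
  have h2 : Real.exp (-(s / 2)) * Real.exp (s / 2) = 1 := by rw [← Real.exp_add]; simp
  have h3 := Real.add_one_le_exp (s / 2)
  have h4 : (1 + s) * Real.exp (-(s / 2)) ≤ 2 := by
    nlinarith [Real.exp_pos (-(s / 2)), mul_le_mul_of_nonneg_left h3 (Real.exp_pos (-(s / 2))).le]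
  rw [h]
  nlinarith [mul_le_mul_of_nonneg_right h4 (Real.exp_pos (-(s / 2))).le]

lemma quadratic_mul_exp_neg_le {s : ℝ} (hs : 0 ≤ s) :
    (s ^ 2 + 3 * s + 3) * Real.exp (-s) ≤ 12 * Real.exp (-(s / 2)) := by
  have h : Real.exp (-s) = Real.exp (-(s / 2)) * Real.exp (-(s / 2)) := by
    rw [← Real.exp_add]; ring_nf
  have h2 : Real.exp (-(s / 2)) * Real.exp (s / 2) = 1 := by rw [← Real.exp_add]; simp
  have h3 := Real.quadratic_le_exp_of_nonneg (x := s / 2) (by linarith)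
  have h4 : (s ^ 2 + 3 * s + 3) * Real.exp (-(s / 2)) ≤ 12 := by
    calc (s ^ 2 + 3 * s + 3) * Real.exp (-(s / 2))
        ≤ 12 * Real.exp (s / 2) * Real.exp (-(s / 2)) := by
          gcongr
          nlinarith
      _ = 12 := by linear_combination 12 * h2
  rw [h]
  nlinarith [mul_le_mul_of_nonneg_right h4 (Real.exp_pos (-(s / 2))).le]

lemma exp_neg_rad_half_le (δ : ℝ) (x : E3) :
    Real.exp (-(rad δ x / 2)) ≤ Real.exp (-(‖x‖ / 2)) := by
  have := norm_le_rad δ x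
  gcongr

/-- `e^{-s}/s` is decreasing and smoothing only enlarges the radius; `wt 0` thus dominates all `wt
δ` in the limit `δ → 0`. -/
lemma wt_le_wt_zero (δ : ℝ) {x : E3} (hx : x ≠ 0) : wt δ x ≤ wt 0 x := by
  have h := norm_le_rad δ x
  have h0 : 0 < ‖x‖ := norm_pos_iff.2 hx
  unfold wt
  rw [rad_zero]
  gcongr

lemma wtK_mul_norm_le (δ : ℝ) (x : E3) :
    wtK δ x * ‖x‖ ≤ 2 * (Real.exp (-(‖x‖ / 2)) / ‖x‖ ^ 2) := by
  rcases eq_or_ne x 0 with rfl | hx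
  · simp
  have h := norm_le_rad δ x
  have h0 : 0 < ‖x‖ := norm_pos_iff.2 hx
  have hs := rad_pos' δ hx
  calc wtK δ x * ‖x‖ ≤ wtK δ x * rad δ x := by
        have := wtK_nonneg δ x
        gcongr
    _ = (1 + rad δ x) * Real.exp (-rad δ x) / rad δ x ^ 2 := by
        unfold wtK; field_simp
    _ ≤ (2 * Real.exp (-(‖x‖ / 2))) / ‖x‖ ^ 2 := by
        have := (one_add_mul_exp_neg_le (rad δ x)).trans
          (mul_le_mul_of_nonneg_left (exp_neg_rad_half_le δ x) zero_le_two)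
        gcongr
    _ = _ := by ring

/-- Uniform in `δ`, but `|x|⁻³` just fails to be integrable at the origin, as it must for an
approximate point mass. The vacuum at the centre supplies the missing power. -/
lemma sq_mul_wtQ_le (δ : ℝ) {x : E3} (hx : x ≠ 0) :
    δ ^ 2 * wtQ δ x ≤ 12 * (Real.exp (-(‖x‖ / 2)) / ‖x‖ ^ 3) := by
  have h := norm_le_rad δ x
  have h0 : 0 < ‖x‖ := norm_pos_iff.2 hx
  have hs := rad_pos' δ hx
  have hδ : δ ^ 2 ≤ rad δ x ^ 2 := by rw [rad_sq]; nlinarith [sq_nonneg ‖x‖]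
  calc δ ^ 2 * wtQ δ x ≤ rad δ x ^ 2 * wtQ δ x := by
        have := wtQ_nonneg δ x
        gcongr
    _ = (rad δ x ^ 2 + 3 * rad δ x + 3) * Real.exp (-rad δ x) / rad δ x ^ 3 := by
        unfold wtQ; field_simp
    _ ≤ (12 * Real.exp (-(‖x‖ / 2))) / ‖x‖ ^ 3 := by
        have := (quadratic_mul_exp_neg_le hs.le).trans
          (mul_le_mul_of_nonneg_left (exp_neg_rad_half_le δ x) (by norm_num))
        gcongr
    _ = _ := by ring

/-- This bound and those after it degenerate as `δ → 0`; they only justify differentiation and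
integration by parts at a fixed `δ`. -/
lemma wt_le {δ : ℝ} (hδ : 0 < δ) (x : E3) : wt δ x ≤ δ⁻¹ * Real.exp (-(‖x‖ / 2)) := by
  have h := norm_le_rad δ x
  have h1 := le_rad δ x
  have h2 := norm_nonneg x
  rw [wt, inv_mul_eq_div]
  gcongr
  linarith

lemma wtK_le {δ : ℝ} (hδ : 0 < δ) (x : E3) : wtK δ x ≤ 2 / δ ^ 3 * Real.exp (-(‖x‖ / 2)) := by
  have hs := rad_pos hδ x
  have h1 := le_rad δ x
  have := (one_add_mul_exp_neg_le (rad δ x)).trans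
    (mul_le_mul_of_nonneg_left (exp_neg_rad_half_le δ x) zero_le_two)
  rw [wtK, div_mul_eq_mul_div]
  gcongr

lemma wtQ_mul_rad_sq_le {δ : ℝ} (hδ : 0 < δ) (x : E3) :
    wtQ δ x * rad δ x ^ 2 ≤ 12 / δ ^ 3 * Real.exp (-(‖x‖ / 2)) := by
  have hs := rad_pos hδ x
  have h1 := le_rad δ x
  have := (quadratic_mul_exp_neg_le hs.le).trans
    (mul_le_mul_of_nonneg_left (exp_neg_rad_half_le δ x) (by norm_num : (0 : ℝ) ≤ 12))
  rw [div_mul_eq_mul_div, show wtQ δ x * rad δ x ^ 2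
    = (rad δ x ^ 2 + 3 * rad δ x + 3) * Real.exp (-rad δ x) / rad δ x ^ 3 by
      unfold wtQ; field_simp]
  gcongr

lemma wtK_mul_norm_le' {δ : ℝ} (hδ : 0 < δ) (x : E3) :
    wtK δ x * ‖x‖ ≤ 2 / δ ^ 2 * Real.exp (-(‖x‖ / 2)) := by
  have hs := rad_pos hδ x
  have h1 := le_rad δ x
  have := (one_add_mul_exp_neg_le (rad δ x)).trans
    (mul_le_mul_of_nonneg_left (exp_neg_rad_half_le δ x) zero_le_two)
  calc wtK δ x * ‖x‖ ≤ wtK δ x * rad δ x := by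
        have := wtK_nonneg δ x
        have := norm_le_rad δ x
        gcongr
    _ = (1 + rad δ x) * Real.exp (-rad δ x) / rad δ x ^ 2 := by
        unfold wtK; field_simp
    _ ≤ (2 * Real.exp (-(‖x‖ / 2))) / δ ^ 2 := by gcongr
    _ = _ := by ring

lemma norm_wtHess_le {δ : ℝ} (hδ : 0 < δ) (x : E3) :
    ‖wtHess δ x‖ ≤ 14 / δ ^ 3 * Real.exp (-(‖x‖ / 2)) := by
  have hQ := wtQ_nonneg δ x
  have hK := wtK_nonneg δ x
  have h := norm_le_rad δ x
  have h0 := norm_nonneg x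
  calc ‖wtHess δ x‖ ≤ wtQ δ x * (‖x‖ * ‖x‖) + wtK δ x * 1 := by
        refine (norm_sub_le _ _).trans (add_le_add ?_ ?_)
        · rw [norm_smul, Real.norm_of_nonneg hQ, ContinuousLinearMap.norm_smulRight_apply,
            innerSL_apply_norm]
        · rw [norm_smul, Real.norm_of_nonneg hK]
          gcongr
          exact ContinuousLinearMap.norm_id_le
    _ ≤ wtQ δ x * rad δ x ^ 2 + wtK δ x := by
        rw [mul_one, ← sq]
        gcongr
    _ ≤ 12 / δ ^ 3 * Real.exp (-(‖x‖ / 2)) + 2 / δ ^ 3 * Real.exp (-(‖x‖ / 2)) :=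
        add_le_add (wtQ_mul_rad_sq_le hδ x) (wtK_le hδ x)
    _ = _ := by ring

end Bounds

section Derivatives

lemma hasFDerivAt_comp_rad {δ : ℝ} (hδ : 0 < δ) {φ : ℝ → ℝ} {φ' : ℝ} {x : E3}
    (h : HasDerivAt φ (φ' * rad δ x) (rad δ x)) :
    HasFDerivAt (fun x => φ (rad δ x)) (φ' • innerSL ℝ x) x := by
  have hs := rad_pos hδ x
  have h1 : HasFDerivAt (fun x : E3 => ‖x‖ ^ 2 + δ ^ 2) (2 • innerSL ℝ x) x :=
    ((hasStrictFDerivAt_norm_sq x).hasFDerivAt).add_const _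
  have h2 : HasFDerivAt (rad δ) _ x := h1.sqrt (by positivity)
  have h3 := h.comp_hasFDerivAt x h2
  convert! h3 using 1
  ext v
  change _ = (φ' * rad δ x) • ((1 / (2 * rad δ x)) • (2 • innerSL ℝ x)) v
  simp
  field_simp

lemma hasFDerivAt_wt {δ : ℝ} (hδ : 0 < δ) (x : E3) :
    HasFDerivAt (wt δ) (-wtK δ x • innerSL ℝ x) x := by
  have hs := rad_pos hδ x
  refine hasFDerivAt_comp_rad hδ (φ := fun s => Real.exp (-s) / s) ?_
  have h := ((hasDerivAt_neg (rad δ x)).exp).div (hasDerivAt_id (rad δ x)) hs.ne'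
  convert! h using 1
  simp only [id, wtK]
  field_simp
  ring

lemma hasFDerivAt_wtK {δ : ℝ} (hδ : 0 < δ) (x : E3) :
    HasFDerivAt (wtK δ) (-wtQ δ x • innerSL ℝ x) x := by
  have hs := rad_pos hδ x
  refine hasFDerivAt_comp_rad hδ (φ := fun s => (1 + s) * Real.exp (-s) / s ^ 3) ?_
  have h := (((hasDerivAt_id (rad δ x)).const_add 1).mul
    ((hasDerivAt_neg (rad δ x)).exp)).div (hasDerivAt_pow 3 (rad δ x)) (pow_pos hs 3).ne'
  convert! h using 1
  simp only [id, wtQ, Pi.mul_apply]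
  field_simp
  ring

lemma hasFDerivAt_wtGrad {δ : ℝ} (hδ : 0 < δ) (x : E3) :
    HasFDerivAt (fun x => -wtK δ x • x) (wtHess δ x) x := by
  have h := ((hasFDerivAt_wtK hδ x).neg).smul (hasFDerivAt_id x)
  convert! h using 1
  ext1 v
  simp [wtHess, smul_smul]
  abel

lemma continuous_wtK {δ : ℝ} (hδ : 0 < δ) : Continuous (wtK δ) :=
  continuous_iff_continuousAt.2 fun x => (hasFDerivAt_wtK hδ x).continuousAt

lemma continuous_wt {δ : ℝ} (hδ : 0 < δ) : Continuous (wt δ) :=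
  continuous_iff_continuousAt.2 fun x => (hasFDerivAt_wt hδ x).continuousAt

/-- The smoothed form of `Δ(e^{-r}/r) = e^{-r}/r - 4πδ₀`: the term `δ² wtQ` plays the role of the
point mass. -/
lemma dv_wtHess {δ : ℝ} (hδ : 0 < δ) (x : E3) : dv (wtHess δ x) = wt δ x - δ ^ 2 * wtQ δ x := by
  have hs := rad_pos hδ x
  have h2 : ‖x‖ ^ 2 = rad δ x ^ 2 - δ ^ 2 := by rw [rad_sq]; ring
  rw [wtHess, dv_sub, dv_smul, dv_smul, dv_id, dv_smulRight, innerSL_apply_apply,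
    real_inner_self_eq_norm_sq, h2, wt, wtK, wtQ]
  field_simp
  ring

/-- For a vector parallel to `x` the Hessian of the weight is almost nonnegative. -/
lemma inner_wtHess_ge {δ : ℝ} (hδ : 0 < δ) {x v : E3} (h : inner ℝ x v ^ 2 = ‖x‖ ^ 2 * ‖v‖ ^ 2) :
    -(δ ^ 2 * wtQ δ x) * ‖v‖ ^ 2 ≤ inner ℝ (wtHess δ x v) v := by
  have hs := rad_pos hδ x
  have h2 : ‖x‖ ^ 2 = rad δ x ^ 2 - δ ^ 2 := by rw [rad_sq]; ring
  have e : inner ℝ (wtHess δ x v) v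
      = (wtQ δ x * rad δ x ^ 2 - wtK δ x) * ‖v‖ ^ 2 - (δ ^ 2 * wtQ δ x) * ‖v‖ ^ 2 := by
    simp only [wtHess, sub_apply, smul_apply, ContinuousLinearMap.smulRight_apply,
      innerSL_apply_apply, ContinuousLinearMap.id_apply, inner_sub_left, real_inner_smul_left,
      real_inner_self_eq_norm_sq]
    linear_combination wtQ δ x * h + wtQ δ x * ‖v‖ ^ 2 * h2
  -- This is the second derivative of `s ↦ e^{-s}/s` at `s = rad δ x`, positive by convexity.
  have h3 : 0 ≤ wtQ δ x * rad δ x ^ 2 - wtK δ x := by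
    have : wtQ δ x * rad δ x ^ 2 - wtK δ x
        = (rad δ x ^ 2 + 2 * rad δ x + 2) * Real.exp (-rad δ x) / rad δ x ^ 3 := by
      unfold wtQ wtK; field_simp; ring
    rw [this]; positivity
  rw [e]
  nlinarith [mul_nonneg h3 (sq_nonneg ‖v‖)]

end Derivatives

lemma integrable_wt_zero : Integrable (wt 0) := by
  refine (integrable_norm_rpow_mul_exp (a := -1) (by norm_num)).mono'
    (measurable_wt 0).aestronglyMeasurable (Eventually.of_forall fun x => ?_)
  have := norm_nonneg x
  rw [Real.norm_of_nonneg (wt_nonneg 0 x), wt, rad_zero, Real.rpow_neg_one, inv_mul_eq_div]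
  gcongr
  linarith

/-- In polar coordinates this is `4π Γ(2)`. It is the normalization in Jensen's inequality and the
source of the `4π` in `riccatiConst`. -/
lemma integral_wt_zero : ∫ x, wt 0 x = 4 * Real.pi := by
  have h := integral_fun_norm_addHaar (volume : Measure E3) (fun r => Real.exp (-r) / r)
  simp only [wt, rad_zero]
  rw [h]
  have h1 : ∫ y in Ioi (0 : ℝ), y ^ (Module.finrank ℝ E3 - 1) • (Real.exp (-y) / y) = 1 := by
    have h2 : ∫ y in Ioi (0 : ℝ), y ^ (Module.finrank ℝ E3 - 1) • (Real.exp (-y) / y)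
        = Real.Gamma 2 := by
      rw [Real.Gamma_eq_integral two_pos]
      refine setIntegral_congr_fun measurableSet_Ioi fun y hy => ?_
      have hy : 0 < y := hy
      simp only [finrank_euclideanSpace, Fintype.card_fin, smul_eq_mul]
      norm_num
      field_simp
    rw [h2, Real.Gamma_two]
  have hv : (volume : Measure E3).real (Metric.ball 0 1) = Real.pi * (4 / 3) := by
    rw [Measure.real, EuclideanSpace.volume_ball_fin_three]
    simp
    rw [ENNReal.toReal_ofReal (by positivity)]
    ring
  rw [h1, hv]
  simp
  ring

end Weight

/-! ### Regularized density -/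

section RegDensity

/-- A `C¹` regularization of `c ↦ c ^ κ⁻¹`. -/
def regDensity (κ η c : ℝ) : ℝ := c ^ (κ⁻¹ + 2) / (c ^ 2 + η ^ 2)

/-- The derivative of `regDensity κ η`. -/
def regDensityDeriv (κ η c : ℝ) : ℝ :=
  ((κ⁻¹ + 2) * c ^ (κ⁻¹ + 1) * (c ^ 2 + η ^ 2) - c ^ (κ⁻¹ + 2) * (2 * c)) / (c ^ 2 + η ^ 2) ^ 2

variable {κ η : ℝ}

/-- The exponent `κ⁻¹` may be below `1`, so `c ^ κ⁻¹` may fail to be differentiable at vacuum; the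
two extra powers in the numerator repair this for every `κ > 0`. -/
lemma hasDerivAt_regDensity (hκ : 0 < κ) (hη : 0 < η) (c : ℝ) :
    HasDerivAt (regDensity κ η) (regDensityDeriv κ η c) c := by
  have hm : 0 < κ⁻¹ := inv_pos.2 hκ
  have h1 := Real.hasDerivAt_rpow_const (x := c) (p := κ⁻¹ + 2) (Or.inr (by linarith))
  have h2 := (hasDerivAt_pow 2 c).add_const (η ^ 2)
  have h3 := h1.div h2 (by positivity)
  convert! h3 using 1
  rw [regDensityDeriv, show κ⁻¹ + 2 - 1 = κ⁻¹ + 1 by ring]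
  norm_num

lemma continuous_regDensity (hκ : 0 < κ) (hη : 0 < η) : Continuous (regDensity κ η) :=
  continuous_iff_continuousAt.2 fun c => (hasDerivAt_regDensity hκ hη c).continuousAt

lemma continuous_regDensityDeriv (hκ : 0 < κ) (hη : 0 < η) :
    Continuous (regDensityDeriv κ η) := by
  have hm : 0 < κ⁻¹ := inv_pos.2 hκ
  have h1 : Continuous fun c : ℝ => c ^ (κ⁻¹ + 1) :=
    Real.continuous_rpow_const (by linarith)
  have h2 : Continuous fun c : ℝ => c ^ (κ⁻¹ + 2) :=
    Real.continuous_rpow_const (by linarith)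
  unfold regDensityDeriv
  exact Continuous.div (by fun_prop) (by fun_prop) fun c => by positivity

lemma rpow_inv_add_two (hκ : 0 < κ) {c : ℝ} (hc : 0 ≤ c) : c ^ (κ⁻¹ + 2) = c ^ κ⁻¹ * c ^ 2 := by
  have hm : 0 < κ⁻¹ := inv_pos.2 hκ
  exact_mod_cast Real.rpow_add_natCast' (n := 2) hc (by push_cast; linarith)

lemma rpow_inv_add_one (hκ : 0 < κ) {c : ℝ} (hc : 0 ≤ c) : c ^ (κ⁻¹ + 1) = c ^ κ⁻¹ * c := by
  have hm : 0 < κ⁻¹ := inv_pos.2 hκ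
  exact Real.rpow_add_one' hc (by linarith)

lemma regDensity_zero (hκ : 0 < κ) : regDensity κ η 0 = 0 := by
  simp [regDensity, rpow_inv_add_two hκ le_rfl]

lemma regDensity_nonneg {c : ℝ} (hc : 0 ≤ c) : 0 ≤ regDensity κ η c := by
  unfold regDensity; positivity

lemma sub_regDensity (hκ : 0 < κ) (hη : 0 < η) {c : ℝ} (hc : 0 ≤ c) :
    c ^ κ⁻¹ - regDensity κ η c = c ^ κ⁻¹ * (η ^ 2 / (c ^ 2 + η ^ 2)) := by
  rw [regDensity, rpow_inv_add_two hκ hc]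
  field_simp
  ring

lemma regDensity_le (hκ : 0 < κ) (hη : 0 < η) {c : ℝ} (hc : 0 ≤ c) :
    regDensity κ η c ≤ c ^ κ⁻¹ := by
  have := sub_regDensity hκ hη hc
  have h2 : 0 ≤ c ^ κ⁻¹ * (η ^ 2 / (c ^ 2 + η ^ 2)) := by positivity
  linarith

/-- The left side vanishes for the true density by Euler's identity for the power `κ⁻¹`, which is
how the sound speed equation encodes conservation of mass. The regularization violates it by no more
than a multiple of its own error. -/
lemma abs_regDensity_sub_le (hκ : 0 < κ) (hη : 0 < η) {c : ℝ} (hc : 0 ≤ c) :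
    |regDensity κ η c - κ * c * regDensityDeriv κ η c|
      ≤ 2 * κ * (c ^ κ⁻¹ - regDensity κ η c) := by
  have e : regDensity κ η c - κ * c * regDensityDeriv κ η c
      = -(2 * κ * (c ^ κ⁻¹ * (η ^ 2 / (c ^ 2 + η ^ 2))) * (c ^ 2 / (c ^ 2 + η ^ 2))) := by
    rw [regDensity, regDensityDeriv, rpow_inv_add_two hκ hc, rpow_inv_add_one hκ hc]
    field_simp
    ring
  rw [e, sub_regDensity hκ hη hc, abs_neg, abs_of_nonneg (by positivity)]
  refine mul_le_of_le_one_right (by positivity) ?_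
  rw [div_le_one (by positivity)]
  nlinarith [sq_nonneg η]

lemma sub_regDensity_le (hκ : 0 < κ) (hη : 0 < η) {c M : ℝ} (hc : 0 ≤ c) (hM : c ≤ M) :
    c ^ κ⁻¹ - regDensity κ η c ≤ √η ^ κ⁻¹ + M ^ κ⁻¹ * η := by
  have hm : 0 < κ⁻¹ := inv_pos.2 hκ
  have hM0 : 0 ≤ M := hc.trans hM
  rw [sub_regDensity hκ hη hc]
  -- Below the threshold `√η` the density itself is small; above it the factor `η²/(c²+η²)` is at
  -- most `η`.
  rcases le_total c (√η) with h | h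
  · have h1 : c ^ κ⁻¹ ≤ √η ^ κ⁻¹ := Real.rpow_le_rpow hc h hm.le
    have h2 : η ^ 2 / (c ^ 2 + η ^ 2) ≤ 1 := by
      rw [div_le_one (by positivity)]
      nlinarith [sq_nonneg c]
    have h3 : 0 ≤ M ^ κ⁻¹ * η := by positivity
    have h4 : c ^ κ⁻¹ * (η ^ 2 / (c ^ 2 + η ^ 2)) ≤ c ^ κ⁻¹ :=
      mul_le_of_le_one_right (by positivity) h2
    linarith
  · have h1 : η ≤ c ^ 2 := (Real.sqrt_le_left hc).1 h
    have h2 : η ^ 2 / (c ^ 2 + η ^ 2) ≤ η := by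
      rw [div_le_iff₀ (by positivity)]
      nlinarith [sq_nonneg η, mul_le_mul_of_nonneg_left h1 hη.le, pow_pos hη 3]
    have h3 : 0 ≤ √η ^ κ⁻¹ := by positivity
    have h4 : c ^ κ⁻¹ * (η ^ 2 / (c ^ 2 + η ^ 2)) ≤ M ^ κ⁻¹ * η := by gcongr
    linarith

lemma tendsto_regDensity (hκ : 0 < κ) {η : ℕ → ℝ} (hη : Tendsto η atTop (𝓝 0)) {c : ℝ}
    (hc : 0 ≤ c) : Tendsto (fun n => regDensity κ (η n) c) atTop (𝓝 (c ^ κ⁻¹)) := by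
  rcases hc.eq_or_lt with rfl | hc
  · simp only [regDensity_zero hκ, Real.zero_rpow (inv_pos.2 hκ).ne']
    exact tendsto_const_nhds
  · have h : Tendsto (fun n => c ^ (κ⁻¹ + 2) / (c ^ 2 + η n ^ 2)) atTop
        (𝓝 (c ^ (κ⁻¹ + 2) / (c ^ 2 + 0 ^ 2))) :=
      tendsto_const_nhds.div ((hη.pow 2).const_add _) (by positivity)
    convert! h using 2
    rw [rpow_inv_add_two hκ hc.le]
    field_simp
    simp

/-- The pressure divided by the density normalization, as a function of the sound speed. -/
def soundPressure (κ c : ℝ) : ℝ := c ^ (κ⁻¹ + 2) / (2 * κ + 1)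

lemma soundPressure_eq (hκ : 0 < κ) {c : ℝ} (hc : 0 ≤ c) :
    soundPressure κ c = c ^ κ⁻¹ * c ^ 2 / (2 * κ + 1) := by
  rw [soundPressure, rpow_inv_add_two hκ hc]

lemma hasDerivAt_soundPressure (hκ : 0 < κ) (c : ℝ) :
    HasDerivAt (soundPressure κ) (κ⁻¹ * c ^ (κ⁻¹ + 1)) c := by
  have hm : 0 < κ⁻¹ := inv_pos.2 hκ
  have h1 := (Real.hasDerivAt_rpow_const (x := c) (p := κ⁻¹ + 2) (Or.inr (by linarith))).div_const
    (2 * κ + 1)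
  convert! h1 using 1
  rw [show κ⁻¹ + 2 - 1 = κ⁻¹ + 1 by ring]
  field_simp
  ring

lemma continuous_soundPressure (hκ : 0 < κ) : Continuous (soundPressure κ) :=
  continuous_iff_continuousAt.2 fun c => (hasDerivAt_soundPressure hκ c).continuousAt

end RegDensity

lemma Dom.comp_continuous {b : ℝ} {c : ℝ → E3 → ℝ} (h : Dom b (fun _ => 1) c) {φ : ℝ → ℝ}
    (hφ : Continuous φ) : Dom b (fun _ => 1) (fun t x => φ (c t x)) := by
  obtain ⟨C, -, h⟩ := h
  obtain ⟨B, hB⟩ := (isCompact_Icc (a := -C) (b := C)).exists_bound_of_continuousOn hφ.continuousOn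
  refine Dom.of_bound (M := B) fun t ht x => hB _ ?_
  have := h t ht x
  rw [mul_one, Real.norm_eq_abs] at this
  exact abs_le.1 this

/-! ### Time derivative of the regularized weighted mass -/

section Functional

variable {κ : ℝ} {T : EReal} {c ct : ℝ → E3 → ℝ} {cx : ℝ → E3 → (E3 →L[ℝ] ℝ)}
  {u ut : ℝ → E3 → E3} {ux : ℝ → E3 → (E3 →L[ℝ] E3)}

/-- The regularized weighted mass. -/
def regMass (κ δ : ℝ) (c : ℝ → E3 → ℝ) (t : ℝ) : ℝ := ∫ x, regDensity κ δ (c t x) * wt δ x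

/-- The regularized weighted momentum. -/
def regFlux (κ δ : ℝ) (c : ℝ → E3 → ℝ) (u : ℝ → E3 → E3) (t : ℝ) : ℝ :=
  ∫ x, regDensity κ δ (c t x) * inner ℝ (-wtK δ x • x) (u t x)

lemma norm_wtGrad (δ : ℝ) (x : E3) : ‖-wtK δ x • x‖ = wtK δ x * ‖x‖ := by
  rw [norm_smul, norm_neg, Real.norm_of_nonneg (wtK_nonneg δ x)]

/-- With `β = regDensity κ δ`, the sound speed equation gives `β(c)_t + div(β(c) u) = (β - κ c β')
div u`. Pairing with `wt δ` and moving the divergence onto the weight produces the flux and this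
defect. -/
lemma hasDerivAt_regMass (hκ : 0 < κ) {δ : ℝ} (hδ : 0 < δ)
    (h : IsClassicalSolution κ T c ct cx u ut ux) {b : ℝ} (hb : b ∈ timeInterval T) :
    ContinuousOn (regMass κ δ c) (Icc 0 b) ∧ ∀ t ∈ Ioo 0 b,
      Integrable (fun x => (regDensity κ δ (c t x) - κ * c t x * regDensityDeriv κ δ (c t x))
        * dv (ux t x) * wt δ x) ∧
      HasDerivAt (regMass κ δ c) (regFlux κ δ c u t
        + ∫ x, (regDensity κ δ (c t x) - κ * c t x * regDensityDeriv κ δ (c t x))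
          * dv (ux t x) * wt δ x) t := by
  have hsub := Icc_subset_timeInterval hb
  obtain ⟨M1, hM1⟩ := h.sound_field.bound b hb
  obtain ⟨M2, hM2⟩ := h.velocity_field.bound b hb
  set g : E3 → ℝ := fun x => Real.exp (-(‖x‖ / 2)) with hgdef
  have hg0 : ∀ x, 0 ≤ g x := fun x => (Real.exp_pos _).le
  have hg : Integrable g := integrable_exp_half
  have dc : Dom b (fun _ => 1) c := Dom.of_bound fun t ht x => (hM1 t ht x).1
  have dct : Dom b (fun _ => 1) ct := Dom.of_bound fun t ht x => (hM1 t ht x).2.1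
  have dcx : Dom b (fun _ => 1) cx := Dom.of_bound fun t ht x => (hM1 t ht x).2.2
  have du : Dom b (fun _ => 1) u := Dom.of_bound fun t ht x => (hM2 t ht x).1
  have dux : Dom b (fun _ => 1) ux := Dom.of_bound fun t ht x => (hM2 t ht x).2.2
  have dB := dc.comp_continuous (continuous_regDensity hκ hδ)
  have dB' := dc.comp_continuous (continuous_regDensityDeriv hκ hδ)
  have dW : Dom b g (fun _ x => wt δ x) := Dom.weight (C := δ⁻¹) (by positivity) fun x => by
    rw [Real.norm_of_nonneg (wt_nonneg δ x)]; exact wt_le hδ x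
  have dN : Dom b g (fun _ x => -wtK δ x • x) := Dom.weight (C := 2 / δ ^ 2) (by positivity)
    fun x => by rw [norm_wtGrad]; exact wtK_mul_norm_le' hδ x
  have hcB := continuous_regDensity hκ hδ
  have hcB' := continuous_regDensityDeriv hκ hδ
  have hcW := continuous_wt hδ
  obtain ⟨h1, h2⟩ := integral_time_calculus hg
    (q := fun t x => regDensity κ δ (c t x) * wt δ x)
    (qt := fun t x => regDensityDeriv κ δ (c t x) * ct t x * wt δ x)
    (fun t ht => (hcB.comp (h.sound_field.continuous (hsub ht)).1).mul hcW)
    (fun t ht => ((hcB'.comp (h.sound_field.continuous (hsub (Ioo_subset_Icc_self ht))).1).mul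
      (h.sound_field.continuous (hsub (Ioo_subset_Icc_self ht))).2.1).mul hcW)
    (fun x => (hcB.comp_continuousOn ((h.sound_field.continuousOn_time x).mono hsub)).mul
      continuousOn_const)
    (dB.mul' hg0 dW) ((dB'.mul_bdd dct).mul' hg0 dW)
    (fun t ht x => by
      have hd := h.sound_field.deriv_time t (hsub (Ioo_subset_Icc_self ht)) ht.1 x
      exact ((hasDerivAt_regDensity hκ hδ _).comp t hd).mul_const _)
  refine ⟨h1, fun t ht => ?_⟩
  have htI := Ioo_subset_Icc_self ht
  have htT := hsub htI
  obtain ⟨h3, h4⟩ := h2 t ht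
  have hcc := (h.sound_field.continuous htT).1
  have huc := (h.velocity_field.continuous htT).1
  have huxc := (h.velocity_field.continuous htT).2.2
  have dflux : Dom b g fun t x => regDensity κ δ (c t x) * inner ℝ (-wtK δ x • x) (u t x) :=
    dB.mul' hg0 (Dom.inner hg0 dN du)
  have iflux := dflux.integrable htI hg ((hcB.comp hcc).mul
    (((continuous_wtK hδ).neg.smul continuous_id).inner huc))
  have drem : Dom b g fun t x =>
      (regDensity κ δ (c t x) - κ * c t x * regDensityDeriv κ δ (c t x)) * dv (ux t x) * wt δ x :=
    ((dB.sub ((dc.const_mul κ).mul_bdd dB')).mul_bdd dux.dv).mul' hg0 dW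
  have irem := drem.integrable htI hg (((((hcB.comp hcc).sub
    ((hcc.const_mul κ).mul (hcB'.comp hcc))).mul (continuous_dv.comp huxc))).mul hcW)
  refine ⟨irem, ?_⟩
  obtain ⟨h5, h6⟩ := integral_dv_eq_zero_of_dom htI hg
    (Z := fun t x => (regDensity κ δ (c t x) * wt δ x) • u t x)
    (DZ := fun t x => (regDensity κ δ (c t x) * wt δ x) • ux t x
      + (regDensity κ δ (c t x) • (-wtK δ x • innerSL ℝ x)
        + wt δ x • (regDensityDeriv κ δ (c t x) • cx t x)).smulRight (u t x))
    (fun x => (((hasDerivAt_regDensity hκ hδ _).comp_hasFDerivAt x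
      (h.sound_field.deriv_space t htT x)).mul (hasFDerivAt_wt hδ x)).smul
      (h.velocity_field.deriv_space t htT x))
    ((dB.mul' hg0 dW).smul hg0 du)
    (((dB.mul' hg0 dW).smul hg0 dux).add
      (Dom.smulRight hg0 ((Dom.smul' hg0 dB (by
        have := Dom.innerSL dN
        simpa only [map_smul] using this)).add
        (Dom.smul hg0 dW (dB'.smul_bdd dcx))) du))
  have key : ∫ x, regDensityDeriv κ δ (c t x) * ct t x * wt δ x = regFlux κ δ c u t
      + ∫ x, (regDensity κ δ (c t x) - κ * c t x * regDensityDeriv κ δ (c t x))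
          * dv (ux t x) * wt δ x := by
    rw [regFlux, ← integral_add iflux irem,
      ← add_zero (∫ x, regDensityDeriv κ δ (c t x) * ct t x * wt δ x), ← h6, ← integral_add h3 h5]
    refine integral_congr_ae (Eventually.of_forall fun x => ?_)
    have hs := h.sound t htT ht.1 x
    simp only [dv_add, dv_smul, dv_smulRight, add_apply, smul_apply, smul_eq_mul,
      innerSL_apply_apply, real_inner_smul_left]
    linear_combination (regDensityDeriv κ δ (c t x) * wt δ x) * hs
  rw [← key]
  exact h4

end Functional

/-! ### Lower bound for the derivative of the regularized weighted momentum -/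

section Flux

/-- The size of the density regularization. -/
def regSize (κ M δ : ℝ) : ℝ := √δ ^ κ⁻¹ + M ^ κ⁻¹ * δ

/-- A bound, uniform in time, for the error in the momentum balance of the regularized problem. -/
def fluxErr (κ M δ : ℝ) (x : E3) : ℝ :=
  regSize κ M δ * (2 * (6 * κ + κ⁻¹) * M ^ 2) * (Real.exp (-(‖x‖ / 2)) / ‖x‖ ^ 2)
    + 2 * M ^ 2 * ((M * ‖x‖) ^ κ⁻¹ * (δ ^ 2 * wtQ δ x))
    + M ^ κ⁻¹ * M ^ 2 * (wt 0 x - wt δ x)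

lemma regSize_nonneg {κ M δ : ℝ} (hM : 0 ≤ M) (hδ : 0 ≤ δ) : 0 ≤ regSize κ M δ := by
  unfold regSize; positivity

/-- The majorant does not depend on `δ` and is integrable because `κ⁻¹ - 3 > -3`. The factor
`(M|x|)^{κ⁻¹}` stands for a density that vanishes at the centre. -/
lemma norm_rpow_mul_sq_mul_wtQ_le {κ M : ℝ} (hκ : 0 < κ) (hM : 0 ≤ M) (δ : ℝ) (x : E3) :
    ‖(M * ‖x‖) ^ κ⁻¹ * (δ ^ 2 * wtQ δ x)‖
      ≤ 12 * M ^ κ⁻¹ * (‖x‖ ^ (κ⁻¹ - 3) * Real.exp (-(‖x‖ / 2))) := by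
  have hQ := wtQ_nonneg δ x
  have hm : 0 < κ⁻¹ := inv_pos.2 hκ
  rw [Real.norm_of_nonneg (by positivity)]
  rcases eq_or_ne x 0 with rfl | hx
  · simp [Real.zero_rpow hm.ne']
    positivity
  have hx0 : 0 < ‖x‖ := norm_pos_iff.2 hx
  have h := sq_mul_wtQ_le δ hx
  rw [Real.mul_rpow hM hx0.le, Real.rpow_sub hx0,
    show (3 : ℝ) = ((3 : ℕ) : ℝ) by norm_num, Real.rpow_natCast]
  calc M ^ κ⁻¹ * ‖x‖ ^ κ⁻¹ * (δ ^ 2 * wtQ δ x)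
      ≤ M ^ κ⁻¹ * ‖x‖ ^ κ⁻¹ * (12 * (Real.exp (-(‖x‖ / 2)) / ‖x‖ ^ 3)) := by gcongr
    _ = _ := by ring

lemma integrable_rpow_mul_sq_mul_wtQ {κ M : ℝ} (hκ : 0 < κ) (hM : 0 ≤ M) (δ : ℝ) :
    Integrable fun x : E3 => (M * ‖x‖) ^ κ⁻¹ * (δ ^ 2 * wtQ δ x) := by
  have hm : 0 < κ⁻¹ := inv_pos.2 hκ
  refine ((integrable_norm_rpow_mul_exp (a := κ⁻¹ - 3) (by linarith)).const_mul
    (12 * M ^ κ⁻¹)).mono' ?_ (Eventually.of_forall (norm_rpow_mul_sq_mul_wtQ_le hκ hM δ))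
  have h1 := measurable_wtQ δ
  have h2 : Measurable fun x : E3 => (M * ‖x‖) ^ κ⁻¹ := by fun_prop
  exact (h2.mul (h1.const_mul _)).aestronglyMeasurable

lemma ae_ne_zero : ∀ᵐ x : E3, x ≠ 0 := by
  simp [ae_iff]

lemma integrable_wt (δ : ℝ) : Integrable (wt δ) := by
  refine integrable_wt_zero.mono' (measurable_wt δ).aestronglyMeasurable ?_
  filter_upwards [ae_ne_zero] with x hx
  rw [Real.norm_of_nonneg (wt_nonneg δ x)]
  exact wt_le_wt_zero δ hx

lemma integrable_fluxErr {κ M : ℝ} (hκ : 0 < κ) (hM : 0 ≤ M) (δ : ℝ) :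
    Integrable (fluxErr κ M δ) :=
  ((integrable_exp_half_div_sq.const_mul _).add
    ((integrable_rpow_mul_sq_mul_wtQ hκ hM δ).const_mul _)).add
    ((integrable_wt_zero.sub (integrable_wt δ)).const_mul _)

variable {κ : ℝ} {T : EReal} {c ct : ℝ → E3 → ℝ} {cx : ℝ → E3 → (E3 →L[ℝ] ℝ)}
  {u ut : ℝ → E3 → E3} {ux : ℝ → E3 → (E3 →L[ℝ] E3)}

/-- The velocity equation turns the acceleration into a pressure gradient, which cancels the
gradient of `soundPressure` up to the density regularization. Collinearity of `x` and `v` leaves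
only a `δ² wtQ` loss from the Hessian, and the Laplacian of the weight yields the pressure term with
a second such loss. In vacuum `regDensity` vanishes, so neither `hcol` nor `hvel` is needed there.
-/
lemma flux_pointwise (hκ : 0 < κ) {δ M : ℝ} (hδ : 0 < δ) {x v vt : E3} {a : ℝ}
    {ax : E3 →L[ℝ] ℝ} {vx : E3 →L[ℝ] E3} (hx : x ≠ 0) (ha : 0 ≤ a) (haM : a ≤ M)
    (hax : ‖ax‖ ≤ M) (hv : ‖v‖ ≤ M) (hvx : ‖vx‖ ≤ M) (hvac : a ≤ M * ‖x‖)
    (hcol : 0 < a → inner ℝ x v ^ 2 = ‖x‖ ^ 2 * ‖v‖ ^ 2)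
    (hvel : 0 < a → ∀ z, inner ℝ (vt + vx v) z + κ⁻¹ * a * ax z = 0) :
    soundPressure κ a * wt 0 x - fluxErr κ M δ x ≤
      (regDensity κ δ a - κ * a * regDensityDeriv κ δ a) * inner ℝ (-wtK δ x • x) v * dv vx
      + regDensity κ δ a * (inner ℝ (wtHess δ x v) v + inner ℝ (-wtK δ x • x) (vt + vx v))
      + κ⁻¹ * a ^ (κ⁻¹ + 1) * ax (-wtK δ x • x)
      + soundPressure κ a * dv (wtHess δ x) := by
  have hM : 0 ≤ M := ha.trans haM
  set N : E3 := -wtK δ x • x with hN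
  have hm : 0 < κ⁻¹ := inv_pos.2 hκ
  have hNn : ‖N‖ ≤ 2 * (Real.exp (-(‖x‖ / 2)) / ‖x‖ ^ 2) := by
    rw [hN, norm_wtGrad]; exact wtK_mul_norm_le δ x
  set Y := Real.exp (-(‖x‖ / 2)) / ‖x‖ ^ 2 with hY
  have hY0 : 0 ≤ Y := by positivity
  set E := regSize κ M δ with hE
  have hE0 : 0 ≤ E := regSize_nonneg hM hδ.le
  set d := a ^ κ⁻¹ with hd
  have hd0 : 0 ≤ d := by positivity
  have hsize : d - regDensity κ δ a ≤ E := sub_regDensity_le hκ hδ ha haM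
  have hreg0 : 0 ≤ regDensity κ δ a := regDensity_nonneg ha
  have hreg : regDensity κ δ a ≤ d := regDensity_le hκ hδ ha
  have hrem := abs_regDensity_sub_le hκ hδ ha
  have hdvac : d ≤ (M * ‖x‖) ^ κ⁻¹ := Real.rpow_le_rpow ha hvac hm.le
  have hdM : d ≤ M ^ κ⁻¹ := Real.rpow_le_rpow ha haM hm.le
  set S := δ ^ 2 * wtQ δ x with hS
  have hS0 : 0 ≤ S := by have := wtQ_nonneg δ x; positivity
  have hp : soundPressure κ a ≤ M ^ 2 * d := by
    rw [soundPressure_eq hκ ha, div_le_iff₀ (by positivity)]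
    have : d * a ^ 2 ≤ d * M ^ 2 := by gcongr
    nlinarith [mul_nonneg hκ.le (mul_nonneg hd0 (sq_nonneg M))]
  have hp0 : 0 ≤ soundPressure κ a := by unfold soundPressure; positivity
  have hW := wt_le_wt_zero δ hx
  have t1 : -(E * (12 * κ * M ^ 2) * Y)
      ≤ (regDensity κ δ a - κ * a * regDensityDeriv κ δ a) * inner ℝ N v * dv vx := by
    have hdv : |dv vx| ≤ 3 * M := (abs_dv_le _).trans (by linarith)
    have hin : |inner ℝ N v| ≤ 2 * Y * M := (abs_real_inner_le_norm _ _).trans (by gcongr)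
    have h3 : |regDensity κ δ a - κ * a * regDensityDeriv κ δ a| ≤ 2 * κ * E :=
      hrem.trans (by gcongr)
    refine neg_le_of_abs_le ?_
    rw [abs_mul, abs_mul]
    calc _ ≤ 2 * κ * E * (2 * Y * M) * (3 * M) := by gcongr
      _ = _ := by ring
  have t2 : -(M ^ 2 * ((M * ‖x‖) ^ κ⁻¹ * S)) - regDensity κ δ a * κ⁻¹ * a * ax N
      ≤ regDensity κ δ a * (inner ℝ (wtHess δ x v) v + inner ℝ N (vt + vx v)) := by
    rcases ha.eq_or_lt with h0 | h0
    · rw [← h0, regDensity_zero hκ]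
      simp only [zero_mul, sub_zero, neg_nonpos]
      positivity
    · have h1 := inner_wtHess_ge hδ (hcol h0)
      have h2 := hvel h0 N
      rw [real_inner_comm] at h2
      have h3 : regDensity κ δ a * (S * ‖v‖ ^ 2) ≤ M ^ 2 * ((M * ‖x‖) ^ κ⁻¹ * S) := by
        calc regDensity κ δ a * (S * ‖v‖ ^ 2) ≤ (M * ‖x‖) ^ κ⁻¹ * (S * M ^ 2) := by
              gcongr
              exact hreg.trans hdvac
          _ = _ := by ring
      have h4 := mul_le_mul_of_nonneg_left h1 hreg0
      have h5 : regDensity κ δ a * inner ℝ N (vt + vx v)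
          = -(regDensity κ δ a * κ⁻¹ * a * ax N) := by
        linear_combination regDensity κ δ a * h2
      rw [mul_add, h5]
      linarith
  have t3 : -(E * (2 * κ⁻¹ * M ^ 2) * Y)
      ≤ κ⁻¹ * a ^ (κ⁻¹ + 1) * ax N - regDensity κ δ a * κ⁻¹ * a * ax N := by
    rw [rpow_inv_add_one hκ ha]
    have h1 : |ax N| ≤ M * (2 * Y) := (ax.le_opNorm N).trans (by gcongr)
    have h2 : 0 ≤ d - regDensity κ δ a := by linarith
    have e : κ⁻¹ * (d * a) * ax N - regDensity κ δ a * κ⁻¹ * a * ax N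
        = (d - regDensity κ δ a) * κ⁻¹ * a * ax N := by ring
    rw [e]
    refine neg_le_of_abs_le ?_
    rw [abs_mul, abs_of_nonneg (by positivity)]
    calc _ ≤ E * κ⁻¹ * M * (M * (2 * Y)) := by gcongr
      _ = _ := by ring
  have t4 : soundPressure κ a * wt 0 x - M ^ 2 * ((M * ‖x‖) ^ κ⁻¹ * S)
      - M ^ κ⁻¹ * M ^ 2 * (wt 0 x - wt δ x) ≤ soundPressure κ a * dv (wtHess δ x) := by
    rw [dv_wtHess hδ, ← hS]
    have h1 : soundPressure κ a * S ≤ M ^ 2 * ((M * ‖x‖) ^ κ⁻¹ * S) := by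
      calc soundPressure κ a * S ≤ M ^ 2 * (M * ‖x‖) ^ κ⁻¹ * S :=
            mul_le_mul_of_nonneg_right (hp.trans (by gcongr)) hS0
        _ = _ := by ring
    have h2 : soundPressure κ a * (wt 0 x - wt δ x) ≤ M ^ κ⁻¹ * M ^ 2 * (wt 0 x - wt δ x) := by
      have : 0 ≤ wt 0 x - wt δ x := by linarith
      gcongr
      exact hp.trans (by rw [mul_comm]; gcongr)
    linarith
  have e : fluxErr κ M δ x = E * (12 * κ * M ^ 2) * Y + E * (2 * κ⁻¹ * M ^ 2) * Y
      + 2 * (M ^ 2 * ((M * ‖x‖) ^ κ⁻¹ * S)) + M ^ κ⁻¹ * M ^ 2 * (wt 0 x - wt δ x) := by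
    rw [fluxErr]; ring
  rw [e]
  linarith

lemma le_mul_norm_of_eq_zero {f : E3 → ℝ} {fx : E3 → (E3 →L[ℝ] ℝ)} {M : ℝ}
    (hf : ∀ x, HasFDerivAt f (fx x) x) (hM : ∀ x, ‖fx x‖ ≤ M) (h0 : f 0 = 0) (x : E3) :
    f x ≤ M * ‖x‖ := by
  have := norm_sub_le_of_hasFDerivAt hf hM x 0
  rw [h0, sub_zero, sub_zero] at this
  exact (le_abs_self _).trans this

/-- Adding the divergence of `β (N·u) u + P N`, with `N` the gradient of the weight and `P` the
pressure, does not change the integral and brings the integrand into the form bounded by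
`flux_pointwise`. -/
lemma hasDerivAt_regFlux (hκ : 0 < κ) {δ : ℝ} (hδ : 0 < δ)
    (h : IsClassicalSolution κ T c ct cx u ut ux) {b M : ℝ} (hb : b ∈ timeInterval T)
    (hM1 : ∀ t ∈ Icc 0 b, ∀ x, ‖c t x‖ ≤ M ∧ ‖ct t x‖ ≤ M ∧ ‖cx t x‖ ≤ M)
    (hM2 : ∀ t ∈ Icc 0 b, ∀ x, ‖u t x‖ ≤ M ∧ ‖ut t x‖ ≤ M ∧ ‖ux t x‖ ≤ M)
    (hvac : ∀ t ∈ timeInterval T, c t 0 = 0)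
    (hcol : ∀ t ∈ timeInterval T, ∀ x, 0 < c t x →
      inner ℝ x (u t x) ^ 2 = ‖x‖ ^ 2 * ‖u t x‖ ^ 2) :
    ContinuousOn (regFlux κ δ c u) (Icc 0 b) ∧ ∀ t ∈ Ioo 0 b, ∃ G' : ℝ,
      HasDerivAt (regFlux κ δ c u) G' t ∧
      (∫ x, soundPressure κ (c t x) * wt 0 x) - ∫ x, fluxErr κ M δ x ≤ G' := by
  have hsub := Icc_subset_timeInterval hb
  set g : E3 → ℝ := fun x => Real.exp (-(‖x‖ / 2)) with hgdef
  have hg0 : ∀ x, 0 ≤ g x := fun x => (Real.exp_pos _).le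
  have hg : Integrable g := integrable_exp_half
  have dc : Dom b (fun _ => 1) c := Dom.of_bound fun t ht x => (hM1 t ht x).1
  have dct : Dom b (fun _ => 1) ct := Dom.of_bound fun t ht x => (hM1 t ht x).2.1
  have dcx : Dom b (fun _ => 1) cx := Dom.of_bound fun t ht x => (hM1 t ht x).2.2
  have du : Dom b (fun _ => 1) u := Dom.of_bound fun t ht x => (hM2 t ht x).1
  have dut : Dom b (fun _ => 1) ut := Dom.of_bound fun t ht x => (hM2 t ht x).2.1
  have dux : Dom b (fun _ => 1) ux := Dom.of_bound fun t ht x => (hM2 t ht x).2.2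
  have dB := dc.comp_continuous (continuous_regDensity hκ hδ)
  have dB' := dc.comp_continuous (continuous_regDensityDeriv hκ hδ)
  have dP := dc.comp_continuous (continuous_soundPressure hκ)
  have dN : Dom b g (fun _ x => -wtK δ x • x) := Dom.weight (C := 2 / δ ^ 2) (by positivity)
    fun x => by rw [norm_wtGrad]; exact wtK_mul_norm_le' hδ x
  have dH : Dom b g (fun _ x => wtHess δ x) := Dom.weight (C := 14 / δ ^ 3) (by positivity)
    fun x => norm_wtHess_le hδ x
  have hcB := continuous_regDensity hκ hδ
  have hcB' := continuous_regDensityDeriv hκ hδ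
  have hm : 0 < κ⁻¹ := inv_pos.2 hκ
  have hcP' : Continuous fun a : ℝ => κ⁻¹ * a ^ (κ⁻¹ + 1) :=
    (Real.continuous_rpow_const (by linarith)).const_mul _
  have dP' := dc.comp_continuous hcP'
  have hcN : Continuous fun x : E3 => -wtK δ x • x := (continuous_wtK hδ).neg.smul continuous_id
  obtain ⟨h1, h2⟩ := integral_time_calculus hg
    (q := fun t x => regDensity κ δ (c t x) * inner ℝ (-wtK δ x • x) (u t x))
    (qt := fun t x => regDensityDeriv κ δ (c t x) * ct t x * inner ℝ (-wtK δ x • x) (u t x)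
      + regDensity κ δ (c t x) * inner ℝ (-wtK δ x • x) (ut t x))
    (fun t ht => (hcB.comp (h.sound_field.continuous (hsub ht)).1).mul
      (hcN.inner (h.velocity_field.continuous (hsub ht)).1))
    (fun t ht => by
      have htT := hsub (Ioo_subset_Icc_self ht)
      have hcc := h.sound_field.continuous htT
      have huc := h.velocity_field.continuous htT
      exact (((hcB'.comp hcc.1).mul hcc.2.1).mul (hcN.inner huc.1)).add
        ((hcB.comp hcc.1).mul (hcN.inner huc.2.1)))
    (fun x => (hcB.comp_continuousOn ((h.sound_field.continuousOn_time x).mono hsub)).mul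
      (continuousOn_const.inner ((h.velocity_field.continuousOn_time x).mono hsub)))
    (dB.mul' hg0 (Dom.inner hg0 dN du))
    (((dB'.mul_bdd dct).mul' hg0 (Dom.inner hg0 dN du)).add
      (dB.mul' hg0 (Dom.inner hg0 dN dut)))
    (fun t ht x => by
      have hd := h.sound_field.deriv_time t (hsub (Ioo_subset_Icc_self ht)) ht.1 x
      have hdu := h.velocity_field.deriv_time t (hsub (Ioo_subset_Icc_self ht)) ht.1 x
      have hin : HasDerivAt (fun τ => inner ℝ (-wtK δ x • x) (u τ x))
          (inner ℝ (-wtK δ x • x) (ut t x)) t :=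
        (innerSL ℝ (-wtK δ x • x)).hasFDerivAt.comp_hasDerivAt t hdu
      exact ((hasDerivAt_regDensity hκ hδ _).comp t hd).mul hin)
  refine ⟨h1, fun t ht => ?_⟩
  have htI := Ioo_subset_Icc_self ht
  have htT := hsub htI
  obtain ⟨h3, h4⟩ := h2 t ht
  refine ⟨_, h4, ?_⟩
  have hcc := (h.sound_field.continuous htT).1
  obtain ⟨h5, h6⟩ := integral_dv_eq_zero_of_dom htI hg
    (Z := fun t x => (regDensity κ δ (c t x) * inner ℝ (-wtK δ x • x) (u t x)) • u t x
      + soundPressure κ (c t x) • (-wtK δ x • x))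
    (DZ := fun t x => ((regDensity κ δ (c t x) * inner ℝ (-wtK δ x • x) (u t x)) • ux t x
      + (regDensity κ δ (c t x) • ((innerSL ℝ (-wtK δ x • x)).comp (ux t x)
          + (innerSL ℝ (u t x)).comp (wtHess δ x))
        + (inner ℝ (-wtK δ x • x) (u t x)) • (regDensityDeriv κ δ (c t x) • cx t x)).smulRight
          (u t x))
      + (soundPressure κ (c t x) • wtHess δ x
        + ((κ⁻¹ * c t x ^ (κ⁻¹ + 1)) • cx t x).smulRight (-wtK δ x • x)))
    (fun x => by
      have hdc := h.sound_field.deriv_space t htT x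
      have hdu := h.velocity_field.deriv_space t htT x
      have hdN := hasFDerivAt_wtGrad hδ x
      have hin : HasFDerivAt (fun x => inner ℝ (-wtK δ x • x) (u t x))
          ((innerSL ℝ (-wtK δ x • x)).comp (ux t x) + (innerSL ℝ (u t x)).comp (wtHess δ x)) x := by
        have := hdN.inner ℝ hdu
        convert! this using 1
        ext z
        simp [real_inner_comm, real_inner_smul_left]
      exact ((((hasDerivAt_regDensity hκ hδ _).comp_hasFDerivAt x hdc).mul hin).smul hdu).add
        (((hasDerivAt_soundPressure hκ _).comp_hasFDerivAt x hdc).smul hdN))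
    (((dB.mul' hg0 (Dom.inner hg0 dN du)).smul hg0 du).add (dP.smul' hg0 dN))
    ((((dB.mul' hg0 (Dom.inner hg0 dN du)).smul hg0 dux).add (Dom.smulRight hg0
      ((dB.smul' hg0 ((Dom.comp_clm hg0 dN.innerSL dux).add
        (Dom.bilin_left hg0 du.innerSL dH fun _ _ => ContinuousLinearMap.opNorm_comp_le _ _))).add
        ((Dom.inner hg0 dN du).smul hg0 (dB'.smul_bdd dcx))) du)).add
      ((dP.smul' hg0 dH).add (Dom.bilin_left hg0 (dP'.smul_bdd dcx) dN
        fun _ _ => (ContinuousLinearMap.norm_smulRight_apply _ _).le)))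
  have iP : Integrable fun x => soundPressure κ (c t x) * wt 0 x := by
    obtain ⟨C, hC, hP⟩ := dP
    refine (integrable_wt_zero.const_mul C).mono'
      (((continuous_soundPressure hκ).comp hcc).measurable.mul
        (measurable_wt 0)).aestronglyMeasurable (Eventually.of_forall fun x => ?_)
    have := hP t htI x
    rw [mul_one] at this
    rw [norm_mul, Real.norm_of_nonneg (wt_nonneg 0 x)]
    have := wt_nonneg 0 x
    gcongr
  have hM : 0 ≤ M := (norm_nonneg _).trans (hM1 t htI 0).1
  have e0 := integral_add h3 h5
  rw [h6, add_zero] at e0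
  rw [← integral_sub iP (integrable_fluxErr hκ hM δ), ← e0]
  refine integral_mono_ae (iP.sub (integrable_fluxErr hκ hM δ)) (h3.add h5) ?_
  filter_upwards [ae_ne_zero] with x hx
  have hb1 := hM1 t htI x
  have hb2 := hM2 t htI x
  have key := flux_pointwise hκ hδ hx (h.nonneg t htT x) ((le_abs_self _).trans hb1.1) hb1.2.2
    hb2.1 hb2.2.2 (le_mul_norm_of_eq_zero (h.sound_field.deriv_space t htT)
      (fun y => (hM1 t htI y).2.2) (hvac t htT) x) (hcol t htT x) (h.velocity t htT ht.1 x)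
  have hs := h.sound t htT ht.1 x
  refine key.trans_eq ?_
  simp only [dv_add, dv_smul, dv_smulRight, add_apply, smul_apply, smul_eq_mul,
    innerSL_apply_apply, inner_add_right, ContinuousLinearMap.comp_apply]
  rw [real_inner_comm (wtHess δ x (u t x))]
  linear_combination -(regDensityDeriv κ δ (c t x) * inner ℝ (-wtK δ x • x) (u t x)) * hs

end Flux

/-! ### Removal of the regularization and the integrated virial inequality -/

section Limit

variable {κ : ℝ} {T : EReal} {c ct : ℝ → E3 → ℝ} {cx : ℝ → E3 → (E3 →L[ℝ] ℝ)}
  {u ut : ℝ → E3 → E3} {ux : ℝ → E3 → (E3 →L[ℝ] E3)}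

lemma tendsto_regSize (hκ : 0 < κ) (M : ℝ) {δ : ℕ → ℝ} (hδ : Tendsto δ atTop (𝓝 0)) :
    Tendsto (fun n => regSize κ M (δ n)) atTop (𝓝 0) := by
  have hm : 0 < κ⁻¹ := inv_pos.2 hκ
  have h : Continuous (regSize κ M) := by
    have : Continuous fun d : ℝ => √d ^ κ⁻¹ :=
      (Real.continuous_rpow_const hm.le).comp Real.continuous_sqrt
    unfold regSize
    fun_prop
  have := (h.tendsto 0).comp hδ
  simpa [Function.comp_def, regSize, Real.zero_rpow hm.ne'] using this

/-- The three parts of the error vanish for different reasons: the first carries `regSize`, the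
second is dominated through the central vacuum, and the third is the convergence of the weights. -/
lemma tendsto_integral_fluxErr (hκ : 0 < κ) {M : ℝ} (hM : 0 ≤ M) {δ : ℕ → ℝ}
    (hδ : Tendsto δ atTop (𝓝 0)) :
    Tendsto (fun n => ∫ x, fluxErr κ M (δ n) x) atTop (𝓝 0) := by
  have hm : 0 < κ⁻¹ := inv_pos.2 hκ
  have e : ∀ n, ∫ x, fluxErr κ M (δ n) x
      = regSize κ M (δ n) * (2 * (6 * κ + κ⁻¹) * M ^ 2)
          * (∫ x : E3, Real.exp (-(‖x‖ / 2)) / ‖x‖ ^ 2)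
        + 2 * M ^ 2 * (∫ x : E3, (M * ‖x‖) ^ κ⁻¹ * (δ n ^ 2 * wtQ (δ n) x))
        + M ^ κ⁻¹ * M ^ 2 * ((∫ x, wt 0 x) - ∫ x, wt (δ n) x) := fun n => by
    have i1 := integrable_exp_half_div_sq.const_mul
      (regSize κ M (δ n) * (2 * (6 * κ + κ⁻¹) * M ^ 2))
    have i2 := (integrable_rpow_mul_sq_mul_wtQ hκ hM (δ n)).const_mul (2 * M ^ 2)
    have i3 := (integrable_wt_zero.sub (integrable_wt (δ n))).const_mul (M ^ κ⁻¹ * M ^ 2)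
    simp only [Pi.sub_apply] at i3
    unfold fluxErr
    have i12 := i1.add i2
    simp only [Pi.add_def] at i12
    rw [integral_add i12 i3, integral_add i1 i2, integral_const_mul, integral_const_mul,
      integral_const_mul, integral_sub integrable_wt_zero (integrable_wt (δ n))]
  simp only [e]
  have l2 : Tendsto (fun n => ∫ x : E3, (M * ‖x‖) ^ κ⁻¹ * (δ n ^ 2 * wtQ (δ n) x)) atTop (𝓝 0) := by
    rw [← integral_zero E3 ℝ (μ := volume)]
    refine tendsto_integral_of_dominated_convergence _
      (fun n => (integrable_rpow_mul_sq_mul_wtQ hκ hM (δ n)).aestronglyMeasurable)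
      ((integrable_norm_rpow_mul_exp (a := κ⁻¹ - 3) (by linarith)).const_mul (12 * M ^ κ⁻¹))
      (fun n => Eventually.of_forall (norm_rpow_mul_sq_mul_wtQ_le hκ hM (δ n))) ?_
    filter_upwards [ae_ne_zero] with x hx
    have := ((hδ.pow 2).mul (tendsto_wtQ hδ hx)).const_mul ((M * ‖x‖) ^ κ⁻¹)
    simpa using this
  have l3 : Tendsto (fun n => ∫ x, wt (δ n) x) atTop (𝓝 (∫ x, wt 0 x)) := by
    refine tendsto_integral_of_dominated_convergence _
      (fun n => (integrable_wt (δ n)).aestronglyMeasurable) integrable_wt_zero (fun n => ?_) ?_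
    · filter_upwards [ae_ne_zero] with x hx
      rw [Real.norm_of_nonneg (wt_nonneg _ x)]
      exact wt_le_wt_zero _ hx
    · filter_upwards [ae_ne_zero] with x hx using tendsto_wt hδ hx
  have := ((((tendsto_regSize hκ M hδ).mul_const (2 * (6 * κ + κ⁻¹) * M ^ 2)).mul_const
    (∫ x : E3, Real.exp (-(‖x‖ / 2)) / ‖x‖ ^ 2)).add (l2.const_mul (2 * M ^ 2))).add
    ((l3.const_sub (∫ x, wt 0 x)).const_mul (M ^ κ⁻¹ * M ^ 2))
  simpa using this

/-- The weighted mass. -/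
def limMass (κ : ℝ) (c : ℝ → E3 → ℝ) (t : ℝ) : ℝ := ∫ x, c t x ^ κ⁻¹ * wt 0 x

/-- The weighted momentum. -/
def limFlux (κ : ℝ) (c : ℝ → E3 → ℝ) (u : ℝ → E3 → E3) (t : ℝ) : ℝ :=
  ∫ x, c t x ^ κ⁻¹ * inner ℝ (-wtK 0 x • x) (u t x)

lemma tendsto_regMass (hκ : 0 < κ) {t M : ℝ} (hc : Continuous (c t)) (h0 : ∀ x, 0 ≤ c t x)
    (hM : ∀ x, c t x ≤ M) {δ : ℕ → ℝ} (hδ0 : ∀ n, 0 < δ n) (hδ : Tendsto δ atTop (𝓝 0)) :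
    Tendsto (fun n => regMass κ (δ n) c t) atTop (𝓝 (limMass κ c t)) := by
  refine tendsto_integral_of_dominated_convergence (fun x => M ^ κ⁻¹ * wt 0 x)
    (fun n => (((continuous_regDensity hκ (hδ0 n)).comp hc).measurable.mul
      (measurable_wt _)).aestronglyMeasurable) (integrable_wt_zero.const_mul _) (fun n => ?_) ?_
  · filter_upwards [ae_ne_zero] with x hx
    rw [Real.norm_of_nonneg (mul_nonneg (regDensity_nonneg (h0 x)) (wt_nonneg _ x))]
    exact mul_le_mul ((regDensity_le hκ (hδ0 n) (h0 x)).trans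
      (Real.rpow_le_rpow (h0 x) (hM x) (inv_nonneg.2 hκ.le))) (wt_le_wt_zero _ hx) (wt_nonneg _ x)
      (Real.rpow_nonneg ((h0 x).trans (hM x)) _)
  · filter_upwards [ae_ne_zero] with x hx
    exact (tendsto_regDensity hκ hδ (h0 x)).mul (tendsto_wt hδ hx)

lemma tendsto_regFlux (hκ : 0 < κ) {t M M' : ℝ} (hc : Continuous (c t)) (hu : Continuous (u t))
    (h0 : ∀ x, 0 ≤ c t x) (hM : ∀ x, c t x ≤ M) (hM' : ∀ x, ‖u t x‖ ≤ M') {δ : ℕ → ℝ}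
    (hδ0 : ∀ n, 0 < δ n) (hδ : Tendsto δ atTop (𝓝 0)) :
    Tendsto (fun n => regFlux κ (δ n) c u t) atTop (𝓝 (limFlux κ c u t)) := by
  have hm : 0 ≤ κ⁻¹ := inv_nonneg.2 hκ.le
  refine tendsto_integral_of_dominated_convergence
    (fun x => (M ^ κ⁻¹ * (2 * M')) * (Real.exp (-(‖x‖ / 2)) / ‖x‖ ^ 2))
    (fun n => (((continuous_regDensity hκ (hδ0 n)).comp hc).mul
      (((continuous_wtK (hδ0 n)).neg.smul continuous_id).inner hu)).aestronglyMeasurable)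
    (integrable_exp_half_div_sq.const_mul _) (fun n => Eventually.of_forall fun x => ?_) ?_
  · have h1 : ‖inner ℝ (-wtK (δ n) x • x) (u t x)‖ ≤ 2 * (Real.exp (-(‖x‖ / 2)) / ‖x‖ ^ 2) * M' :=
      (norm_inner_le_norm _ _).trans (mul_le_mul ((norm_wtGrad _ x).trans_le (wtK_mul_norm_le _ x))
        (hM' x) (norm_nonneg _) (by positivity))
    have h2 : ‖regDensity κ (δ n) (c t x)‖ ≤ M ^ κ⁻¹ := by
      rw [Real.norm_of_nonneg (regDensity_nonneg (h0 x))]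
      exact (regDensity_le hκ (hδ0 n) (h0 x)).trans (Real.rpow_le_rpow (h0 x) (hM x) hm)
    rw [norm_mul]
    calc _ ≤ M ^ κ⁻¹ * (2 * (Real.exp (-(‖x‖ / 2)) / ‖x‖ ^ 2) * M') :=
          mul_le_mul h2 h1 (norm_nonneg _) (Real.rpow_nonneg ((h0 x).trans (hM x)) _)
      _ = _ := by ring
  · filter_upwards [ae_ne_zero] with x hx
    exact (tendsto_regDensity hκ hδ (h0 x)).mul
      (((tendsto_wtK hδ hx).neg.smul_const x).inner tendsto_const_nhds)

lemma le_of_hasDerivAt_nonneg {f f' : ℝ → ℝ} {b : ℝ} (hf : ContinuousOn f (Icc 0 b))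
    (hd : ∀ t ∈ Ioo 0 b, HasDerivAt f (f' t) t) (h0 : ∀ t ∈ Ioo 0 b, 0 ≤ f' t) {t : ℝ}
    (ht : t ∈ Icc 0 b) : f 0 ≤ f t := by
  refine monotoneOn_of_deriv_nonneg (convex_Icc 0 b) hf ?_ ?_ ⟨le_rfl, ht.1.trans ht.2⟩ ht ht.1
  · rw [interior_Icc]
    exact fun s hs => (hd s hs).differentiableAt.differentiableWithinAt
  · rw [interior_Icc]
    exact fun s hs => (hd s hs).deriv ▸ h0 s hs

lemma continuousOn_limMass (hκ : 0 < κ) (h : IsClassicalSolution κ T c ct cx u ut ux) {b : ℝ}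
    (hb : b ∈ timeInterval T) : ContinuousOn (limMass κ c) (Icc 0 b) := by
  have hm : 0 ≤ κ⁻¹ := inv_nonneg.2 hκ.le
  have hsub := Icc_subset_timeInterval hb
  obtain ⟨M, hM⟩ := h.sound_field.bound b hb
  have hcr : Continuous fun a : ℝ => a ^ κ⁻¹ := Real.continuous_rpow_const hm
  refine continuousOn_of_dominated (bound := fun x => M ^ κ⁻¹ * wt 0 x)
    (fun t ht => ((hcr.comp (h.sound_field.continuous (hsub ht)).1).measurable.mul
      (measurable_wt 0)).aestronglyMeasurable) (fun t ht => Eventually.of_forall fun x => ?_)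
    (integrable_wt_zero.const_mul _) (Eventually.of_forall fun x => ?_)
  · have h0 := h.nonneg t (hsub ht) x
    have h1 := wt_nonneg 0 x
    rw [Real.norm_of_nonneg (by positivity)]
    have := (le_abs_self _).trans (hM t ht x).1
    gcongr
  · exact (hcr.comp_continuousOn ((h.sound_field.continuousOn_time x).mono hsub)).mul
      continuousOn_const

lemma hasDerivAt_primitive {φ : ℝ → ℝ} (hφ : Continuous φ) (t : ℝ) :
    HasDerivAt (fun s => ∫ τ in (0 : ℝ)..s, φ τ) (φ t) t :=
  intervalIntegral.integral_hasDerivAt_right (hφ.intervalIntegrable _ _)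
    (hφ.stronglyMeasurableAtFilter _ _) hφ.continuousAt

lemma continuous_primitive {φ : ℝ → ℝ} (hφ : Continuous φ) :
    Continuous fun s => ∫ τ in (0 : ℝ)..s, φ τ :=
  continuous_iff_continuousAt.2 fun t => (hasDerivAt_primitive hφ t).continuousAt

/-- The integrated virial inequality for the weighted mass. -/
lemma limMass_ge (hκ : 0 < κ) (h : IsClassicalSolution κ T c ct cx u ut ux)
    (hvac : ∀ t ∈ timeInterval T, c t 0 = 0)
    (hcol : ∀ t ∈ timeInterval T, ∀ x, 0 < c t x →
      inner ℝ x (u t x) ^ 2 = ‖x‖ ^ 2 * ‖u t x‖ ^ 2) {b : ℝ} (hb : b ∈ timeInterval T) {φ : ℝ → ℝ}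
    (hφ : Continuous φ) (hle : ∀ t ∈ Icc 0 b, φ t ≤ ∫ x, soundPressure κ (c t x) * wt 0 x) :
    ∀ t ∈ Icc 0 b, limMass κ c 0 + limFlux κ c u 0 * t + ∫ s in (0 : ℝ)..t, ∫ τ in (0 : ℝ)..s, φ τ
      ≤ limMass κ c t := by
  intro r hr
  have hsub := Icc_subset_timeInterval hb
  obtain ⟨M1, hM1⟩ := h.sound_field.bound b hb
  obtain ⟨M2, hM2⟩ := h.velocity_field.bound b hb
  set M := max M1 M2 with hMdef
  have hM1 : ∀ t ∈ Icc 0 b, ∀ x, ‖c t x‖ ≤ M ∧ ‖ct t x‖ ≤ M ∧ ‖cx t x‖ ≤ M := fun t ht x =>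
    ⟨(hM1 t ht x).1.trans (le_max_left _ _), (hM1 t ht x).2.1.trans (le_max_left _ _),
      (hM1 t ht x).2.2.trans (le_max_left _ _)⟩
  have hM2 : ∀ t ∈ Icc 0 b, ∀ x, ‖u t x‖ ≤ M ∧ ‖ut t x‖ ≤ M ∧ ‖ux t x‖ ≤ M := fun t ht x =>
    ⟨(hM2 t ht x).1.trans (le_max_right _ _), (hM2 t ht x).2.1.trans (le_max_right _ _),
      (hM2 t ht x).2.2.trans (le_max_right _ _)⟩
  have hM : 0 ≤ M := (norm_nonneg _).trans (hM1 r hr 0).1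
  set δ : ℕ → ℝ := fun n => 1 / ((n : ℝ) + 1) with hδdef
  have hδ0 : ∀ n, 0 < δ n := fun n => by positivity
  have hδ : Tendsto δ atTop (𝓝 0) := tendsto_one_div_add_atTop_nhds_zero_nat
  set I : ℝ → ℝ := fun s => ∫ τ in (0 : ℝ)..s, φ τ with hI
  have hIc : Continuous I := continuous_primitive hφ
  set ε1 : ℕ → ℝ := fun n => regSize κ M (δ n) * (6 * κ * M) * ∫ x, wt 0 x with hε1
  set ε2 : ℕ → ℝ := fun n => ∫ x, fluxErr κ M (δ n) x with hε2
  -- The differential inequalities are integrated twice at fixed `δ`, with errors linear and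
  -- quadratic in time. Only values at the times `0` and `r` then have to converge.
  have key : ∀ n, regMass κ (δ n) c 0 + regFlux κ (δ n) c u 0 * r + (∫ s in (0 : ℝ)..r, I s)
      - ε2 n * r ^ 2 / 2 - ε1 n * r ≤ regMass κ (δ n) c r := by
    intro n
    obtain ⟨hFc, hF⟩ := hasDerivAt_regMass hκ (hδ0 n) h hb
    obtain ⟨hGc, hG⟩ := hasDerivAt_regFlux hκ (hδ0 n) h hb hM1 hM2 hvac hcol
    choose! G' hG' hGle using hG
    have hflux : ∀ s ∈ Icc 0 b, regFlux κ (δ n) c u 0 + I s - ε2 n * s ≤ regFlux κ (δ n) c u s := by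
      intro s hs
      have := le_of_hasDerivAt_nonneg (f := fun s => regFlux κ (δ n) c u s - I s + ε2 n * s)
        (f' := fun s => G' s - φ s + ε2 n * 1) (by fun_prop)
        (fun t ht => ((hG' t ht).sub (hasDerivAt_primitive hφ t)).add
          ((hasDerivAt_id t).const_mul (ε2 n)))
        (fun t ht => by
          have h1 := hGle t ht
          have h2 := hle t (Ioo_subset_Icc_self ht)
          linarith) hs
      simp only [hI, intervalIntegral.integral_same, sub_zero, mul_zero, add_zero] at this
      linarith
    have herr : ∀ t ∈ Ioo 0 b, -ε1 n ≤ ∫ x, (regDensity κ (δ n) (c t x)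
        - κ * c t x * regDensityDeriv κ (δ n) (c t x)) * dv (ux t x) * wt (δ n) x := by
      intro t ht
      have htI := Ioo_subset_Icc_self ht
      rw [hε1]
      simp only
      rw [← integral_const_mul, ← integral_neg]
      refine integral_mono_ae (integrable_wt_zero.const_mul _).neg (hF t ht).1 ?_
      filter_upwards [ae_ne_zero] with x hx
      have hc0 := h.nonneg t (hsub htI) x
      have h1 : |regDensity κ (δ n) (c t x) - κ * c t x * regDensityDeriv κ (δ n) (c t x)|
          ≤ 2 * κ * regSize κ M (δ n) :=
        (abs_regDensity_sub_le hκ (hδ0 n) hc0).trans (mul_le_mul_of_nonneg_left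
          (sub_regDensity_le hκ (hδ0 n) hc0 ((le_abs_self _).trans (hM1 t htI x).1))
          (by positivity))
      have h2 : |dv (ux t x)| ≤ 3 * M :=
        (abs_dv_le _).trans (mul_le_mul_of_nonneg_left (hM2 t htI x).2.2 (by norm_num))
      have h3 := wt_le_wt_zero (δ n) hx
      have h4 := wt_nonneg (δ n) x
      have h5 := regSize_nonneg (κ := κ) hM (hδ0 n).le
      refine neg_le_of_abs_le ?_
      rw [abs_mul, abs_mul, abs_of_nonneg h4]
      calc _ ≤ 2 * κ * regSize κ M (δ n) * (3 * M) * wt 0 x := by gcongr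
        _ = _ := by ring
    have := le_of_hasDerivAt_nonneg (f := fun s => regMass κ (δ n) c s - regFlux κ (δ n) c u 0 * s
        - (∫ τ in (0 : ℝ)..s, I τ) + ε2 n / 2 * s ^ 2 + ε1 n * s)
      (f' := fun s => (regFlux κ (δ n) c u s + ∫ x, (regDensity κ (δ n) (c s x)
        - κ * c s x * regDensityDeriv κ (δ n) (c s x)) * dv (ux s x) * wt (δ n) x)
        - regFlux κ (δ n) c u 0 * 1 - I s + ε2 n / 2 * ((2 : ℕ) * s ^ (2 - 1)) + ε1 n * 1)
      (by
        have := continuous_primitive hIc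
        fun_prop)
      (fun t ht => (((((hF t ht).2.sub ((hasDerivAt_id t).const_mul _)).sub
        (hasDerivAt_primitive hIc t)).add ((hasDerivAt_pow 2 t).const_mul _))).add
          ((hasDerivAt_id t).const_mul _))
      (fun t ht => by
        have h1 := hflux t (Ioo_subset_Icc_self ht)
        have h2 := herr t ht
        norm_num
        linarith) hr
    simp only [intervalIntegral.integral_same] at this
    linarith
  have hcb : ∀ t ∈ Icc 0 b, ∀ x, c t x ≤ M := fun t ht x => (le_abs_self _).trans (hM1 t ht x).1
  have h0I : (0 : ℝ) ∈ Icc 0 b := ⟨le_rfl, hb.1⟩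
  have l1 := tendsto_regMass hκ (h.sound_field.continuous (hsub h0I)).1 (h.nonneg 0 (hsub h0I))
    (hcb 0 h0I) hδ0 hδ
  have l2 := tendsto_regFlux hκ (h.sound_field.continuous (hsub h0I)).1
    (h.velocity_field.continuous (hsub h0I)).1 (h.nonneg 0 (hsub h0I)) (hcb 0 h0I)
    (fun x => (hM2 0 h0I x).1) hδ0 hδ
  have l3 := tendsto_regMass hκ (h.sound_field.continuous (hsub hr)).1 (h.nonneg r (hsub hr))
    (hcb r hr) hδ0 hδ
  have l4 : Tendsto ε1 atTop (𝓝 0) := by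
    simpa using ((tendsto_regSize hκ M hδ).mul_const (6 * κ * M)).mul_const (∫ x, wt 0 x)
  have l5 : Tendsto ε2 atTop (𝓝 0) := tendsto_integral_fluxErr hκ hM hδ
  have l6 := (((l1.add (l2.mul_const r)).add_const (∫ s in (0 : ℝ)..r, I s)).sub
    ((l5.mul_const (r ^ 2)).div_const 2)).sub (l4.mul_const r)
  have := le_of_tendsto_of_tendsto' l6 l3 key
  simpa using this

end Limit

/-! ### Jensen's inequality and the second order differential inequality -/

section Riccati

/-- Jensen's inequality for the weight `wt 0`. -/
lemma rpow_integral_mul_wt_le {p B : ℝ} (hp : 1 ≤ p) {d : E3 → ℝ} (hd : Continuous d)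
    (h0 : ∀ x, 0 ≤ d x) (hB : ∀ x, d x ≤ B) :
    (∫ x, d x * wt 0 x) ^ p / (4 * Real.pi) ^ (p - 1) ≤ ∫ x, d x ^ p * wt 0 x := by
  have hp0 : 0 < p := by linarith
  have hB0 : 0 ≤ B := (h0 0).trans (hB 0)
  have hint : ∀ e : E3 → ℝ, Continuous e → ∀ C : ℝ, (∀ x, ‖e x‖ ≤ C) →
      Integrable fun x => e x * wt 0 x := fun e he C hC => by
    refine (integrable_wt_zero.const_mul C).mono'
      (he.measurable.mul (measurable_wt 0)).aestronglyMeasurable (Eventually.of_forall fun x => ?_)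
    have h1 := wt_nonneg 0 x
    rw [norm_mul, Real.norm_of_nonneg h1]
    have := hC x
    gcongr
  have i1 := hint d hd B fun x => by rw [Real.norm_of_nonneg (h0 x)]; exact hB x
  have i2 := hint (fun x => d x ^ p) ((Real.continuous_rpow_const hp0.le).comp hd) (B ^ p)
    fun x => by
    have := h0 x
    rw [Real.norm_of_nonneg (by positivity)]
    exact Real.rpow_le_rpow this (hB x) hp0.le
  set f := ∫ x, d x * wt 0 x with hf
  have hf0 : 0 ≤ f := integral_nonneg fun x => mul_nonneg (h0 x) (wt_nonneg 0 x)
  rcases hf0.eq_or_lt with hz | hpos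
  · rw [← hz, Real.zero_rpow hp0.ne', zero_div]
    exact integral_nonneg fun x => mul_nonneg (Real.rpow_nonneg (h0 x) _) (wt_nonneg 0 x)
  have hpi : 0 < 4 * Real.pi := by positivity
  -- `l` is the mean of `d` for the probability measure `wt 0 / 4π`; the convex power is bounded
  -- below by its tangent line at `l`, which is Bernoulli's inequality.
  set l := f / (4 * Real.pi) with hl
  have hl0 : 0 < l := by positivity
  have hpt : ∀ x, (l ^ p * (1 - p)) * wt 0 x + (l ^ p * p / l) * (d x * wt 0 x)
      ≤ d x ^ p * wt 0 x := by
    intro x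
    have h1 := one_add_mul_self_le_rpow_one_add (s := d x / l - 1)
      (by have : 0 ≤ d x / l := div_nonneg (h0 x) hl0.le
          linarith) hp
    rw [add_sub_cancel, Real.div_rpow (h0 x) hl0.le, le_div_iff₀ (by positivity)] at h1
    have h2 := mul_le_mul_of_nonneg_right h1 (wt_nonneg 0 x)
    refine le_trans (le_of_eq ?_) h2
    field_simp
    ring
  have h3 := integral_mono ((integrable_wt_zero.const_mul (l ^ p * (1 - p))).add
    (i1.const_mul (l ^ p * p / l))) i2 hpt
  have h4 : ∫ x, ((fun x => (l ^ p * (1 - p)) * wt 0 x)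
      + fun x => (l ^ p * p / l) * (d x * wt 0 x)) x
      = l ^ p * (1 - p) * (4 * Real.pi) + l ^ p * p / l * f := by
    rw [integral_add' (integrable_wt_zero.const_mul _) (i1.const_mul _), integral_const_mul,
      integral_const_mul, integral_wt_zero]
  rw [h4] at h3
  refine le_trans (le_of_eq ?_) h3
  have h5 : f = l * (4 * Real.pi) := by rw [hl]; field_simp
  have h6 : (4 * Real.pi) ^ p = (4 * Real.pi) ^ (p - 1) * (4 * Real.pi) := by
    rw [Real.rpow_sub_one hpi.ne']; field_simp
  rw [h5, Real.mul_rpow hl0.le hpi.le, h6]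
  field_simp
  ring

/-- Blow-up for the second order differential inequality `f'' ≥ k f ^ (2κ+1)` in integrated
form. -/
lemma rpow_neg_le_of_integral_inequality {κ k C F₀ G₀ b : ℝ} (hκ : 0 < κ) (hC : 0 < C)
    (hk : C ^ 2 * (2 * κ + 2) ≤ 2 * k) (hF₀ : 0 < F₀) (hG₀ : C * F₀ ^ (κ + 1) ≤ G₀) (hb : 0 ≤ b)
    {f φ : ℝ → ℝ} (hφ : Continuous φ) (hφ0 : ∀ t, 0 ≤ φ t)
    (hφf : ∀ t ∈ Icc 0 b, k * f t ^ (2 * κ + 1) ≤ φ t)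
    (hf : ∀ t ∈ Icc 0 b, F₀ + G₀ * t + ∫ s in (0 : ℝ)..t, ∫ τ in (0 : ℝ)..s, φ τ ≤ f t) :
    0 < f b ∧ f b ^ (-κ) ≤ F₀ ^ (-κ) - κ * C * b := by
  set I : ℝ → ℝ := fun s => ∫ τ in (0 : ℝ)..s, φ τ with hI
  have hIc : Continuous I := continuous_primitive hφ
  have hI0 : ∀ s, 0 ≤ s → 0 ≤ I s := fun s hs =>
    intervalIntegral.integral_nonneg hs fun t _ => hφ0 t
  -- `f` need not be differentiable, so the argument runs on this `C²` minorant: `φ ≥ k f^{2κ+1} ≥ k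
  -- Φ^{2κ+1}` closes the inequality for `Φ`.
  set Φ : ℝ → ℝ := fun t => F₀ + G₀ * t + ∫ s in (0 : ℝ)..t, I s with hΦ
  have hG₀' : 0 < G₀ := lt_of_lt_of_le (by positivity) hG₀
  have hΦd : ∀ t, HasDerivAt Φ (G₀ + I t) t := fun t => by
    have := (((hasDerivAt_id t).const_mul G₀).const_add F₀).add (hasDerivAt_primitive hIc t)
    rw [mul_one] at this
    exact this
  have hΦpos : ∀ t, 0 ≤ t → F₀ ≤ Φ t := fun t ht => by
    have : 0 ≤ ∫ s in (0 : ℝ)..t, I s :=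
      intervalIntegral.integral_nonneg ht fun s hs => hI0 s hs.1
    have h2 : 0 ≤ G₀ * t := by positivity
    simp only [hΦ]
    linarith
  have hk0 : 0 ≤ k := by
    have : 0 ≤ C ^ 2 * (2 * κ + 2) := by positivity
    linarith
  have hΦ0 : Φ 0 = F₀ := by simp [hΦ]
  have hIz : I 0 = 0 := by simp [hI]
  have hfirst : ∀ t ∈ Icc 0 b, C * Φ t ^ (κ + 1) ≤ G₀ + I t := by
    intro t ht
    -- The energy `Φ'² - C² Φ^{2κ+2}` is nondecreasing by `hk` and nonnegative at `0` by `hG₀`;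
    -- hence the first order inequality `Φ' ≥ C Φ^{κ+1}` persists.
    have hE := le_of_hasDerivAt_nonneg (b := b)
      (f := fun t => (G₀ + I t) ^ 2 - C ^ 2 * Φ t ^ (2 * κ + 2))
      (f' := fun t => (2 : ℕ) * (G₀ + I t) ^ (2 - 1) * φ t
        - C ^ 2 * ((G₀ + I t) * (2 * κ + 2) * Φ t ^ (2 * κ + 2 - 1)))
      (by
        refine ContinuousOn.sub (by fun_prop) (continuousOn_const.mul ?_)
        exact (continuous_iff_continuousAt.2
          fun t => (hΦd t).continuousAt).continuousOn.rpow_const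
          fun t _ => Or.inr (by linarith))
      (fun t ht => (((hasDerivAt_primitive hφ t).const_add G₀).pow 2).sub
        (((hΦd t).rpow_const (Or.inl (hF₀.trans_le (hΦpos t ht.1.le)).ne')).const_mul _))
      (fun t ht => by
        have h1 := hφf t (Ioo_subset_Icc_self ht)
        have h2 := hf t (Ioo_subset_Icc_self ht)
        have h3 := hΦpos t ht.1.le
        have h4 : k * Φ t ^ (2 * κ + 1) ≤ φ t := (mul_le_mul_of_nonneg_left
          (Real.rpow_le_rpow (hF₀.le.trans h3) h2 (by linarith)) hk0).trans h1
        have h5 := hI0 t ht.1.le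
        have h6 : 0 ≤ Φ t ^ (2 * κ + 1) := Real.rpow_nonneg (by linarith) _
        have h7 := mul_le_mul_of_nonneg_right hk h6
        rw [show 2 * κ + 2 - 1 = 2 * κ + 1 by ring]
        have h8 : 0 ≤ (G₀ + I t) * (2 * φ t - C ^ 2 * (2 * κ + 2) * Φ t ^ (2 * κ + 1)) :=
          mul_nonneg (by linarith) (by linarith)
        norm_num
        linarith) ht
    simp only [hΦ0, hIz, add_zero] at hE
    have hsq : ∀ y : ℝ, 0 < y → y ^ (2 * κ + 2) = (y ^ (κ + 1)) ^ 2 := fun y hy => by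
      rw [← Real.rpow_natCast, ← Real.rpow_mul hy.le]
      congr 1
      push_cast
      ring
    have hpos := hF₀.trans_le (hΦpos t ht.1)
    rw [hsq _ hF₀, hsq _ hpos] at hE
    have h1 : (C * F₀ ^ (κ + 1)) ^ 2 ≤ G₀ ^ 2 := by gcongr
    have h2 : (C * Φ t ^ (κ + 1)) ^ 2 ≤ (G₀ + I t) ^ 2 := by
      rw [mul_pow] at h1 ⊢
      linarith
    exact (sq_le_sq₀ (by positivity) (by have := hI0 t ht.1; linarith)).1 h2
  have hbI : b ∈ Icc 0 b := ⟨hb, le_rfl⟩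
  have hH := le_of_hasDerivAt_nonneg (b := b) (f := fun t => -(Φ t ^ (-κ)) - κ * C * t)
    (f' := fun t => -((G₀ + I t) * (-κ) * Φ t ^ (-κ - 1)) - κ * C * 1)
    (by
      refine ContinuousOn.sub (ContinuousOn.neg ?_) (by fun_prop)
      exact ((continuous_iff_continuousAt.2 fun t => (hΦd t).continuousAt).continuousOn).rpow_const
        fun t ht => Or.inl (hF₀.trans_le (hΦpos t ht.1)).ne')
    (fun t ht => (((hΦd t).rpow_const (Or.inl (hF₀.trans_le (hΦpos t ht.1.le)).ne')).neg).sub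
      ((hasDerivAt_id t).const_mul _))
    (fun t ht => by
      have h1 := hfirst t (Ioo_subset_Icc_self ht)
      have hpos := hF₀.trans_le (hΦpos t ht.1.le)
      have h2 : Φ t ^ (κ + 1) * Φ t ^ (-κ - 1) = 1 := by
        rw [← Real.rpow_add hpos]; simp
      have h3 : 0 ≤ Φ t ^ (-κ - 1) := by positivity
      have h4 := mul_le_mul_of_nonneg_right h1 h3
      rw [mul_assoc, h2] at h4
      nlinarith) hbI
  have hposb := hF₀.trans_le (hΦpos b hb)
  have hfb : Φ b ≤ f b := hf b hbI
  refine ⟨hposb.trans_le hfb, ?_⟩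
  have h1 : f b ^ (-κ) ≤ Φ b ^ (-κ) := Real.rpow_le_rpow_of_nonpos hposb hfb (by linarith)
  simp only [hΦ0, mul_zero, sub_zero] at hH
  linarith

end Riccati

/-! ### Decay of the negative power of the weighted mass -/

section Blowup

variable {κ : ℝ} {T : EReal} {c ct : ℝ → E3 → ℝ} {cx : ℝ → E3 → (E3 →L[ℝ] ℝ)}
  {u ut : ℝ → E3 → E3} {ux : ℝ → E3 → (E3 →L[ℝ] E3)}

lemma soundPressure_eq_rpow (hκ : 0 < κ) {a : ℝ} (ha : 0 ≤ a) :
    soundPressure κ a = (a ^ κ⁻¹) ^ (2 * κ + 1) / (2 * κ + 1) := by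
  rw [soundPressure, ← Real.rpow_mul ha]
  congr 2
  field_simp
  ring

/-- The weighted mass of a radial solution with vacuum at the centre and strong inflow blows up in
finite time. -/
lemma IsClassicalSolution.limMass_rpow_neg_le (hκ : 0 < κ)
    (h : IsClassicalSolution κ T c ct cx u ut ux)
    (hinit : ∀ (R : E3 ≃ₗᵢ[ℝ] E3) x, c 0 (R x) = c 0 x ∧ u 0 (R x) = R (u 0 x))
    (h0 : c 0 0 = 0) {C : ℝ} (hC : 0 < C)
    (hk : C ^ 2 * (2 * κ + 2) * ((2 * κ + 1) * (4 * Real.pi) ^ (2 * κ)) ≤ 2)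
    (hmass : 0 < limMass κ c 0) (hflux : C * limMass κ c 0 ^ (κ + 1) ≤ limFlux κ c u 0)
    {b : ℝ} (hb : b ∈ timeInterval T) :
    0 < limMass κ c b ∧ limMass κ c b ^ (-κ) ≤ limMass κ c 0 ^ (-κ) - κ * C * b := by
  have hsub := Icc_subset_timeInterval hb
  have hb0 : 0 ≤ b := hb.1
  have hm : 0 ≤ κ⁻¹ := inv_nonneg.2 hκ.le
  obtain ⟨M, hM⟩ := h.sound_field.bound b hb
  have hpi : 0 < 4 * Real.pi := by positivity
  set k : ℝ := ((2 * κ + 1) * (4 * Real.pi) ^ (2 * κ))⁻¹ with hkdef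
  have hk0 : 0 < k := by positivity
  have hcont := continuousOn_limMass hκ h hb
  have hnonneg : ∀ t ∈ Icc 0 b, 0 ≤ limMass κ c t := fun t ht =>
    integral_nonneg fun x => mul_nonneg (Real.rpow_nonneg (h.nonneg t (hsub ht) x) _)
      (wt_nonneg 0 x)
  -- The projection to `[0, b]` extends the lower bound to a continuous function on the whole line,
  -- as iterated primitives require.
  set φ : ℝ → ℝ := fun t => k * limMass κ c (projIcc 0 b hb0 t) ^ (2 * κ + 1) with hφ
  have hφc : Continuous φ := by
    have h1 : Continuous fun t => limMass κ c (projIcc 0 b hb0 t) :=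
      hcont.comp_continuous (continuous_subtype_val.comp continuous_projIcc)
        fun t => (projIcc 0 b hb0 t).2
    exact (h1.rpow_const fun _ => Or.inr (by linarith)).const_mul _
  have hφ0 : ∀ t, 0 ≤ φ t := fun t =>
    mul_nonneg hk0.le (Real.rpow_nonneg (hnonneg _ (projIcc 0 b hb0 t).2) _)
  have hφeq : ∀ t ∈ Icc 0 b, φ t = k * limMass κ c t ^ (2 * κ + 1) := fun t ht => by
    simp only [hφ, projIcc_of_mem hb0 ht]
  refine rpow_neg_le_of_integral_inequality hκ hC (k := k) ?_ hmass hflux hb0 hφc hφ0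
    (fun t ht => (hφeq t ht).ge) (limMass_ge hκ h (fun t ht => h.vacuum_persists hκ hinit h0 ht)
      (fun t ht x hx => h.inner_sq_eq hκ hinit ht hx) hb hφc fun t ht => ?_)
  · rw [hkdef, ← div_eq_mul_inv, le_div_iff₀ (by positivity)]
    exact hk
  · have hc0 := h.nonneg t (hsub ht)
    have hJ := rpow_integral_mul_wt_le (p := 2 * κ + 1) (B := M ^ κ⁻¹) (by linarith)
      (d := fun x => c t x ^ κ⁻¹)
      ((Real.continuous_rpow_const hm).comp (h.sound_field.continuous (hsub ht)).1)
      (fun x => Real.rpow_nonneg (hc0 x) _)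
      (fun x => Real.rpow_le_rpow (hc0 x) ((le_abs_self _).trans (hM t ht x).1) hm)
    rw [hφeq t ht]
    have e : ∫ x, soundPressure κ (c t x) * wt 0 x
        = (∫ x, (c t x ^ κ⁻¹) ^ (2 * κ + 1) * wt 0 x) / (2 * κ + 1) := by
      rw [← integral_div]
      refine integral_congr_ae (Eventually.of_forall fun x => ?_)
      simp only
      rw [soundPressure_eq_rpow hκ (hc0 x)]
      ring
    rw [e, le_div_iff₀ (by positivity)]
    refine le_trans (le_of_eq ?_) hJ
    rw [limMass, show 2 * κ + 1 - 1 = 2 * κ by ring, hkdef]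
    field_simp

end Blowup

/-! ### Return to the density, and the blow-up time -/

section Final

variable {A γ : ℝ} {ρ₀ v₀ : ℝ → ℝ} {T : EReal} {ρ : ℝ → E3 → ℝ} {u : ℝ → E3 → E3}

lemma soundSpeed_rpow (hA : 0 < A) (hγ : 1 < γ) {r : ℝ} (hr : 0 ≤ r) :
    soundSpeed A γ r ^ ((γ - 1) / 2)⁻¹ = √(A * γ) ^ ((γ - 1) / 2)⁻¹ * r := by
  have ha : 0 < √(A * γ) := Real.sqrt_pos.2 (by positivity)
  have h := soundSpeed_eq_mul hA hγ hr
  rw [Real.div_rpow (soundSpeed_nonneg hr) ha.le, div_eq_iff (by positivity)] at h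
  rw [h, mul_comm]

lemma IsH3Solution.limMass_zero (hA : 0 < A) (hγ : 1 < γ) (h : IsH3Solution A γ ρ₀ v₀ T ρ u) :
    limMass ((γ - 1) / 2) (fun t x => soundSpeed A γ (ρ t x)) 0
      = √(A * γ) ^ ((γ - 1) / 2)⁻¹ * weightedMass ρ₀ := by
  rw [limMass, weightedMass, ← integral_const_mul]
  refine integral_congr_ae (Eventually.of_forall fun x => ?_)
  have h0 := h.density_nonneg 0 ⟨le_rfl, by exact_mod_cast h.T_pos⟩ x
  simp only
  rw [soundSpeed_rpow hA hγ h0, h.initial_density, wt, rad_zero, Real.exp_neg]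
  ring

lemma IsH3Solution.limFlux_zero (hA : 0 < A) (hγ : 1 < γ) (h : IsH3Solution A γ ρ₀ v₀ T ρ u) :
    limFlux ((γ - 1) / 2) (fun t x => soundSpeed A γ (ρ t x)) u 0
      = √(A * γ) ^ ((γ - 1) / 2)⁻¹ * weightedInflow ρ₀ v₀ := by
  rw [limFlux, weightedInflow, ← integral_neg, ← integral_const_mul]
  refine integral_congr_ae (Eventually.of_forall fun x => ?_)
  have h0 := h.density_nonneg 0 ⟨le_rfl, by exact_mod_cast h.T_pos⟩ x
  simp only
  rw [soundSpeed_rpow hA hγ h0, h.initial_density, h.initial_velocity, radialField,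
    real_inner_smul_left, real_inner_smul_right, real_inner_self_eq_norm_sq, wtK, rad_zero,
    Real.exp_neg]
  -- At the origin both sides are `0`, since division by zero gives zero.
  rcases eq_or_ne ‖x‖ 0 with hx | hx
  · simp [hx]
  · field_simp

lemma IsH3Solution.rotation_invariant (h : IsH3Solution A γ ρ₀ v₀ T ρ u) (R : E3 ≃ₗᵢ[ℝ] E3)
    (x : E3) : soundSpeed A γ (ρ 0 (R x)) = soundSpeed A γ (ρ 0 x) ∧ u 0 (R x) = R (u 0 x) := by
  simp [h.initial_density, h.initial_velocity, radialField]

lemma weightedMass_pos (hρ₀ : ∀ r, 0 ≤ r → 0 ≤ ρ₀ r)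
    (hmass : 0 < ∫⁻ x : E3, ENNReal.ofReal (ρ₀ ‖x‖))
    (hint : Integrable fun x : E3 => ρ₀ ‖x‖ / (‖x‖ * Real.exp ‖x‖)) : 0 < weightedMass ρ₀ := by
  have h0 : ∀ x : E3, 0 ≤ ρ₀ ‖x‖ / (‖x‖ * Real.exp ‖x‖) := fun x =>
    div_nonneg (hρ₀ _ (norm_nonneg x)) (by positivity)
  refine (integral_nonneg h0).lt_of_ne fun hz => hmass.ne' ?_
  have hae := (integral_eq_zero_iff_of_nonneg h0 hint).1 hz.symm
  refine (lintegral_congr_ae (g := fun _ => 0) ?_).trans lintegral_zero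
  filter_upwards [hae, ae_ne_zero] with x hx hx0
  have hn : ‖x‖ ≠ 0 := norm_ne_zero_iff.2 hx0
  simp only [Pi.zero_apply, div_eq_zero_iff, mul_eq_zero, hn, (Real.exp_pos _).ne', or_self,
    or_false] at hx
  simp [hx]

lemma riccatiConst_pos (hA : 0 < A) (hγ : 1 < γ) : 0 < riccatiConst A γ := by
  unfold riccatiConst
  have : 0 < γ + 1 := by linarith
  positivity

/-- The weighted mass of an `H³` solution at later times is controlled by the time that remains. -/
lemma IsH3Solution.limMass_rpow_neg_le (hA : 0 < A) (hγ : 1 < γ) (hρ₀ : ∀ r, 0 ≤ r → 0 ≤ ρ₀ r)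
    (hvacuum : ρ₀ 0 = 0) (hmass : 0 < ∫⁻ x : E3, ENNReal.ofReal (ρ₀ ‖x‖))
    (hinflow : riccatiConst A γ * weightedMass ρ₀ ^ ((γ + 1) / 2) ≤ weightedInflow ρ₀ v₀)
    (h : IsH3Solution A γ ρ₀ v₀ T ρ u) : 0 ≤ blowupTime A γ ρ₀ ∧ ∃ L : ℝ, 0 < L ∧
    ∀ b ∈ timeInterval T, 0 < limMass ((γ - 1) / 2) (fun t x => soundSpeed A γ (ρ t x)) b ∧
      limMass ((γ - 1) / 2) (fun t x => soundSpeed A γ (ρ t x)) b ^ (-((γ - 1) / 2))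
        ≤ L * (blowupTime A γ ρ₀ - b) := by
  obtain ⟨ct, cx, ut, ux, hs⟩ := h.exists_isClassicalSolution hA hγ
  have h0T : (0 : ℝ) ∈ timeInterval T := ⟨le_rfl, by exact_mod_cast h.T_pos⟩
  set κ := (γ - 1) / 2 with hκdef
  have hκ : 0 < κ := by simp only [hκdef]; linarith
  have hγκ : γ = 2 * κ + 1 := by simp only [hκdef]; ring
  set c : ℝ → E3 → ℝ := fun t x => soundSpeed A γ (ρ t x) with hc
  set a := √(A * γ) with hadef
  have ha : 0 < a := Real.sqrt_pos.2 (by positivity)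
  have hF := h.limMass_zero hA hγ
  have hG := h.limFlux_zero hA hγ
  rw [← hκdef, ← hadef] at hF hG
  set s := a ^ κ⁻¹ with hsdef
  have hs0 : 0 < s := by positivity
  have hm : 0 ≤ κ⁻¹ := inv_nonneg.2 hκ.le
  -- Without integrability the Bochner integral `weightedMass` would be `0` by default. It holds
  -- because `c` is bounded at time `0` and `wt 0` is integrable.
  have hint : Integrable fun x : E3 => ρ₀ ‖x‖ / (‖x‖ * Real.exp ‖x‖) := by
    obtain ⟨M, hM⟩ := hs.sound_field.bound 0 h0T
    have hcr : Continuous fun a : ℝ => a ^ κ⁻¹ := Real.continuous_rpow_const hm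
    have i1 : Integrable fun x => c 0 x ^ κ⁻¹ * wt 0 x := by
      refine (integrable_wt_zero.const_mul (M ^ κ⁻¹)).mono'
        ((hcr.comp (hs.sound_field.continuous h0T).1).measurable.mul
          (measurable_wt 0)).aestronglyMeasurable (Eventually.of_forall fun x => ?_)
      have h1 := wt_nonneg 0 x
      have h2 := hs.nonneg 0 h0T x
      rw [Real.norm_of_nonneg (by positivity)]
      have := (le_abs_self _).trans (hM 0 ⟨le_rfl, le_rfl⟩ x).1
      gcongr
    refine (i1.const_mul s⁻¹).congr (Eventually.of_forall fun x => ?_)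
    have e := soundSpeed_rpow hA hγ (h.density_nonneg 0 h0T x)
    simp only [hc]
    rw [← hκdef, ← hadef, ← hsdef] at e
    rw [e, h.initial_density, wt, rad_zero, Real.exp_neg]
    field_simp
  have hW := weightedMass_pos hρ₀ hmass hint
  set W := weightedMass ρ₀ with hWdef
  set C₀ := riccatiConst A γ with hC₀def
  have hC₀ : 0 < C₀ := riccatiConst_pos hA hγ
  -- The mass and flux built from `c` are `s` times those of the density; this rescaling makes the
  -- inflow condition homogeneous, since `s^{-κ} s^{κ+1} = s`.
  set C := C₀ * s ^ (-κ) with hC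
  have hCpos : 0 < C := by positivity
  have hsκ : s ^ κ = a := by
    rw [hsdef, ← Real.rpow_mul ha.le, inv_mul_cancel₀ hκ.ne', Real.rpow_one]
  have hvac : c 0 0 = 0 := by
    simp only [hc, h.initial_density, norm_zero, hvacuum, soundSpeed]
    rw [← hκdef, Real.zero_rpow hκ.ne', mul_zero]
  -- For this `C` the product equals `1`, so the criterion holds with a factor `2` to spare.
  have hC2 : C ^ 2 * (2 * κ + 2) * ((2 * κ + 1) * (4 * Real.pi) ^ (2 * κ)) ≤ 2 := by
    have h1 : C₀ ^ 2 = A / ((γ + 1) * (4 * Real.pi) ^ (γ - 1)) := by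
      rw [hC₀def, riccatiConst, Real.sq_sqrt]
      have : 0 < γ + 1 := by linarith
      positivity
    have h2 : a ^ 2 = A * γ := Real.sq_sqrt (by positivity)
    have hpi : 0 < (4 * Real.pi) ^ (2 * κ) := by positivity
    rw [hC, Real.rpow_neg hs0.le, hsκ, mul_pow, inv_pow, h1, h2, hγκ,
      show 2 * κ + 1 - 1 = 2 * κ by ring, show 2 * κ + 1 + 1 = 2 * κ + 2 by ring]
    have : A / ((2 * κ + 2) * (4 * Real.pi) ^ (2 * κ)) * (A * (2 * κ + 1))⁻¹ * (2 * κ + 2) *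
        ((2 * κ + 1) * (4 * Real.pi) ^ (2 * κ)) = 1 := by
      field_simp
    linarith
  have hflux : C * limMass κ c 0 ^ (κ + 1) ≤ limFlux κ c u 0 := by
    rw [hF, hG, Real.mul_rpow hs0.le hW.le, hC]
    have e : s ^ (-κ) * s ^ (κ + 1) = s := by
      rw [← Real.rpow_add hs0]; simp
    have h1 := mul_le_mul_of_nonneg_left hinflow hs0.le
    rw [show (γ + 1) / 2 = κ + 1 by rw [hγκ]; ring] at h1
    calc C₀ * s ^ (-κ) * (s ^ (κ + 1) * W ^ (κ + 1))
        = (s ^ (-κ) * s ^ (κ + 1)) * (C₀ * W ^ (κ + 1)) := by ring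
      _ ≤ _ := by rw [e]; exact h1
  have hT : blowupTime A γ ρ₀ = W ^ (-κ) / (κ * C₀) := by
    rw [blowupTime, ← hκdef, ← hWdef, ← hC₀def, show γ - 1 = 2 * κ by rw [hγκ]; ring]
    field_simp
  refine ⟨by rw [hT]; positivity, κ * C, by positivity, fun b hb => ?_⟩
  obtain ⟨h1, h2⟩ := hs.limMass_rpow_neg_le hκ h.rotation_invariant hvac hCpos hC2
    (by rw [hF]; positivity) hflux hb
  refine ⟨h1, h2.trans_eq ?_⟩
  rw [hF, Real.mul_rpow hs0.le hW.le, hT, hC]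
  field_simp

/-- A bound for the `H³` norm bounds the weighted mass. -/
lemma IsH3Solution.limMass_le (hA : 0 < A) (hγ : 1 < γ) (h : IsH3Solution A γ ρ₀ v₀ T ρ u)
    {S : ℝ≥0∞} (hS : S < ⊤) (hle : ∀ t ∈ timeInterval T, stateH3Norm A γ (ρ t) (u t) ≤ S) :
    ∃ B : ℝ, ∀ t ∈ timeInterval T,
      limMass ((γ - 1) / 2) (fun t x => soundSpeed A γ (ρ t x)) t ≤ B := by
  have hκ : 0 < (γ - 1) / 2 := by linarith
  refine ⟨(embConst * S).toReal ^ ((γ - 1) / 2)⁻¹ * ∫ x, wt 0 x, fun t ht => ?_⟩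
  obtain ⟨ct, cx, ut, ux, hs⟩ := h.exists_isClassicalSolution hA hγ
  have hcb : ∀ x, soundSpeed A γ (ρ t x) ≤ (embConst * S).toReal := fun x => by
    have h1 := enorm_le_of_memH (by norm_num) (h.sound_C0_H3.1 t ht)
      (hs.sound_field.continuous ht).1 (ae_eq_refl _) x
    have h2 : ‖soundSpeed A γ (ρ t x)‖ₑ ≤ embConst * S :=
      h1.trans (mul_le_mul_right ((le_add_right le_rfl).trans (hle t ht)) _)
    have h3 := ENNReal.toReal_mono (ENNReal.mul_lt_top embConst_lt_top hS).ne h2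
    rw [toReal_enorm] at h3
    exact (le_abs_self _).trans h3
  rw [limMass, ← integral_const_mul]
  refine integral_mono_of_nonneg (Eventually.of_forall fun x => ?_)
    (integrable_wt_zero.const_mul _) (Eventually.of_forall fun x => ?_)
  · exact mul_nonneg (Real.rpow_nonneg (hs.nonneg t ht x) _) (wt_nonneg 0 x)
  · exact mul_le_mul_of_nonneg_right
      (Real.rpow_le_rpow (hs.nonneg t ht x) (hcb x) (inv_nonneg.2 hκ.le)) (wt_nonneg 0 x)

end Final

end EulerVacuum

end

/-- Every `H³` solution on `[0, T)`, `0 < T ≤ ∞`, has `T ≤ T*` with the explicit finite time `T*`,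
and its `H³` norm cannot stay bounded up to the time `T*`. -/
theorem theorem1 (A γ : ℝ) (hA : 0 < A) (hγ : 1 < γ) (ρ₀ v₀ : ℝ → ℝ)
    (hρ₀ : ∀ r, 0 ≤ r → 0 ≤ ρ₀ r)
    (hc₀ : MemH 3 (fun x => soundSpeed A γ (ρ₀ ‖x‖)))
    (hu₀ : ∀ i : Fin 3, MemH 3 (fun x => radialField v₀ x i))
    (hvacuum : ρ₀ 0 = 0)
    (hmass : 0 < ∫⁻ x : E3, ENNReal.ofReal (ρ₀ ‖x‖))
    (hinflow : riccatiConst A γ * weightedMass ρ₀ ^ ((γ + 1) / 2) ≤ weightedInflow ρ₀ v₀)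
    (T : EReal) (ρ : ℝ → E3 → ℝ) (u : ℝ → E3 → E3) (hsol : IsH3Solution A γ ρ₀ v₀ T ρ u) :
    T ≤ (blowupTime A γ ρ₀ : EReal) ∧
      (T = (blowupTime A γ ρ₀ : EReal) →
        ⨆ t ∈ timeInterval T, stateH3Norm A γ (ρ t) (u t) = ⊤) := by
  have hκ : 0 < (γ - 1) / 2 := by linarith
  obtain ⟨hT0, L, hL, hlim⟩ := hsol.limMass_rpow_neg_le hA hγ hρ₀ hvacuum hmass hinflow
  refine ⟨?_, fun hT => ?_⟩
  -- If `T` exceeded `T*`, a strictly positive negative power of the mass would be at most `0` at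
  -- time `T*`.
  · by_contra hlt
    obtain ⟨h1, h2⟩ := hlim (blowupTime A γ ρ₀) ⟨hT0, not_le.1 hlt⟩
    rw [sub_self, mul_zero] at h2
    exact absurd (Real.rpow_pos_of_pos h1 _) (not_lt.2 h2)
  · by_contra hne
    obtain ⟨B, hB⟩ := hsol.limMass_le hA hγ (lt_top_iff_ne_top.2 hne)
      fun t ht => le_iSup₂ (f := fun t (_ : t ∈ timeInterval T) => stateH3Norm A γ (ρ t) (u t)) t ht
    have hTpos : 0 < blowupTime A γ ρ₀ := by
      have := hsol.T_pos
      rw [hT] at this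
      exact_mod_cast this
    have h0T : (0 : ℝ) ∈ timeInterval T := ⟨le_rfl, by exact_mod_cast hsol.T_pos⟩
    have hB0 : 0 < B := (hlim 0 h0T).1.trans_le (hB 0 h0T)
    set r := B ^ (-((γ - 1) / 2)) with hr
    have hr0 : 0 < r := Real.rpow_pos_of_pos hB0 _
    -- At time `T* - d` the negative power of the mass is at least `r` by the bound `B`, yet at most
    -- `L d ≤ r/2`; the first entry of the minimum keeps the time nonnegative.
    set d := min (blowupTime A γ ρ₀) (r / L / 2) with hd
    have hd0 : 0 < d := lt_min hTpos (by positivity)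
    have ht : blowupTime A γ ρ₀ - d ∈ timeInterval T := by
      refine ⟨sub_nonneg.2 (min_le_left _ _), ?_⟩
      rw [hT]
      exact_mod_cast sub_lt_self _ hd0
    obtain ⟨h1, h2⟩ := hlim _ ht
    rw [sub_sub_cancel] at h2
    have h3 : r ≤ L * d :=
      (Real.rpow_le_rpow_of_nonpos h1 (hB _ ht) (by linarith)).trans h2
    have h4 : L * d ≤ r / 2 := by
      calc L * d ≤ L * (r / L / 2) := mul_le_mul_of_nonneg_left (min_le_right _ _) hL.le
        _ = r / 2 := by field_simp
    linarith
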